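/- Let $\sigma_1,\sigma_2,\sigma_3$ be the Pauli matrices, $\alpha_j=\begin{pmatrix}0&\sigma_j\\ \sigma_j&0\end{pmatrix}$ and $\beta=\begin{pmatrix}I_2&0\\0&-I_2\end{pmatrix}$ the Dirac matrices, $\mathcal D=-i\sum_{j=1}^3\alpha_j\partial_j$ the Dirac operator on $\mathbb R^3$, and let $e^{-it(\mathcal D+\beta)}$, $t\in\mathbb R$, be the Dirac flow of mass $1$ on $L^2(\mathbb R^3;\mathbb C^4)$, that is, the Fourier multiplier with the matrix symbol $e^{-it(\alpha\cdot\xi+\beta)}$. Let $\|f\|_{H^\sigma}=\|(1-\Delta)^{\sigma/2}f\|_{L^2}$. For $1\le p,q\le\infty$ and a window $\varphi\in C_0^\infty$ with $\|\varphi\|_{L^2}=1$, the Wiener amalgam norm is $\|g\|_{W(p,q)}=\big\|\,\|g\,\varphi(\cdot-x)\|_{L^p}\,\big\|_{L^q_x}$. Fix windows $\varphi$ on $\mathbb R$ and $\psi$ on $\mathbb R^3$, and let $\|u\|_{W(\tilde q,q)_tW(\tilde r,r)_x}$ be the $W(\tilde q,q)$ norm on $\mathbb R$ (with window $\varphi$)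 of the function $t\mapsto\|u(\cdot,t)\|_{W(\tilde r,r)}$ (with window $\psi$). (1) Let $\sigma>1$, $2\le\tilde q\le\infty$, $2<q<\infty$ and $6<r\le\tilde r<\infty$. If $$\frac1{\tilde q}+\frac3{\tilde r}>\frac32-\sigma\qquad\text{and}\qquad\frac1q+\frac3r=\frac12,$$ then there is a constant $C$, depending only on $\sigma,q,\tilde q,r,\tilde r$ and the windows, such that for all $f\in H^\sigma(\mathbb R^3;\mathbb C^4)$ $$\|e^{-it(\mathcal D+\beta)}f\|_{W(\tilde q,q)_tW(\tilde r,r)_x}\le C\,\|f\|_{H^\sigma}.$$ (2) In particular (the case $\tilde q=q$, $\tilde r=r$), if $\sigma>1$, $2<q<\infty$, $6<r<\infty$ and $\frac1q+\frac3r=\frac12$, then there is a constant $C$, depending only on $\sigma,q,r$, such that for all $f\in H^\sigma(\mathbb R^3;\mathbb C^4)$ $$\|e^{-it(\mathcal D+\beta)}f\|_{L^q_tL^r_x}\le C\,\|f\|_{H^\sigma}.$$ -/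

import Mathlib

open MeasureTheory FourierTransform
open scoped ENNReal NNReal ContDiff SchwartzMap

noncomputable section

/-- Physical space `ℝ³`. -/
abbrev Space : Type := EuclideanSpace ℝ (Fin 3)

/-- The space `ℂ⁴` in which the wave function takes its values. -/
abbrev Spinor : Type := EuclideanSpace ℂ (Fin 4)

/-- `L²(ℝ³; ℂ⁴)`. -/
abbrev SpinorL2 : Type := Lp (α := Space) Spinor 2 (volume : Measure Space)

/-- The Pauli matrices. -/
def pauli : Fin 3 → Matrix (Fin 2) (Fin 2) ℂ :=
  ![!![0, 1; 1, 0], !![0, -Complex.I; Complex.I, 0], !![1, 0; 0, -1]]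

/-- The Dirac matrices `α_j`, with block rows `(0, σ_j)` and `(σ_j, 0)`. -/
def diracAlpha (j : Fin 3) : Matrix (Fin 4) (Fin 4) ℂ :=
  Matrix.reindex (finSumFinEquiv (m := 2) (n := 2)) (finSumFinEquiv (m := 2) (n := 2))
    (Matrix.fromBlocks 0 (pauli j) (pauli j) 0)

/-- The Dirac matrix `β`, with block rows `(I₂, 0)` and `(0, -I₂)`. -/
def diracBeta : Matrix (Fin 4) (Fin 4) ℂ :=
  Matrix.reindex (finSumFinEquiv (m := 2) (n := 2)) (finSumFinEquiv (m := 2) (n := 2))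
    (Matrix.fromBlocks 1 0 0 (-1))

/-- The symbol of `𝒟 + β = -i ∑ α_j ∂_j + β`. The Fourier transform is
`𝓕 f ξ = ∫ exp (-2πi ⟪x, ξ⟫) f x`, so that `-i ∂_j` has the symbol `2π ξ_j`. -/
def diracSymbol (ξ : Space) : Matrix (Fin 4) (Fin 4) ℂ :=
  ∑ j : Fin 3, ((2 * Real.pi * ξ j : ℝ) : ℂ) • diracAlpha j + diracBeta

/-- The symbol of `𝒟 + β` as a linear operator on `ℂ⁴`. -/
def diracSymbolCLM (ξ : Space) : Spinor →L[ℂ] Spinor :=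
  Matrix.toEuclideanCLM (n := Fin 4) (𝕜 := ℂ) (diracSymbol ξ)

/-- The symbol of `exp (-i t (𝒟 + β))`, a linear operator on `ℂ⁴`. -/
def diracPropagator (t : ℝ) (ξ : Space) : Spinor →L[ℂ] Spinor :=
  NormedSpace.exp (-(Complex.I * (t : ℂ)) • diracSymbolCLM ξ)

lemma pauli_isHermitian (j : Fin 3) : (pauli j).IsHermitian := by
  ext a b
  fin_cases j <;> fin_cases a <;> fin_cases b <;> simp [pauli, Matrix.conjTranspose_apply]

lemma diracSymbol_isHermitian (ξ : Space) : (diracSymbol ξ).IsHermitian := by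
  unfold diracSymbol Matrix.IsHermitian
  rw [Matrix.conjTranspose_add, Matrix.conjTranspose_sum]
  congr 1
  · refine Finset.sum_congr rfl fun j _ => ?_
    rw [Matrix.conjTranspose_smul, Complex.star_def, Complex.conj_ofReal]
    congr 1
    simp only [diracAlpha, Matrix.conjTranspose_reindex, Matrix.fromBlocks_conjTranspose,
      Matrix.conjTranspose_zero, (pauli_isHermitian j).eq]
  · simp only [diracBeta, Matrix.conjTranspose_reindex, Matrix.fromBlocks_conjTranspose,
      Matrix.conjTranspose_zero, Matrix.conjTranspose_one, Matrix.conjTranspose_neg]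

lemma norm_diracPropagator_le (t : ℝ) (ξ : Space) : ‖diracPropagator t ξ‖ ≤ 1 := by
  have h : -(Complex.I * (t : ℂ)) • diracSymbolCLM ξ ∈
      skewAdjoint (Spinor →L[ℂ] Spinor) := by
    rw [skewAdjoint.mem_iff, star_smul, diracSymbolCLM, ← map_star, Matrix.star_eq_conjTranspose,
      (diracSymbol_isHermitian ξ).eq]
    simp only [star_neg, star_mul', Complex.star_def, Complex.conj_I, Complex.conj_ofReal]
    module
  let +nondep : NormedAlgebra ℚ (Spinor →L[ℂ] Spinor) := .restrictScalars ℚ ℂ _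
  exact CStarRing.norm_of_mem_unitary (NormedSpace.exp_mem_unitary_of_mem_skewAdjoint h) |>.le

lemma continuous_diracPropagator (t : ℝ) : Continuous (diracPropagator t) := by
  have h : Continuous diracSymbol := by
    unfold diracSymbol
    fun_prop
  have h2 : Continuous (Matrix.toEuclideanCLM (n := Fin 4) (𝕜 := ℂ)) :=
    LinearMap.continuous_of_finiteDimensional
      (Matrix.toEuclideanCLM (n := Fin 4) (𝕜 := ℂ)).toAlgEquiv.toLinearMap
  let +nondep : NormedAlgebra ℚ (Spinor →L[ℂ] Spinor) := .restrictScalars ℚ ℂ _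
  exact NormedSpace.exp_continuous.comp
    (g := NormedSpace.exp) ((h2.comp h).const_smul (-(Complex.I * (t : ℂ))))

lemma memLp_diracPropagator (t : ℝ) (g : SpinorL2) :
    MemLp (fun ξ : Space => diracPropagator t ξ (g ξ)) 2 volume := by
  refine MemLp.of_le (Lp.memLp g) ?_ (Filter.Eventually.of_forall fun ξ => ?_)
  · exact (ContinuousLinearMap.apply ℂ Spinor).flip.aestronglyMeasurable_comp₂
      (continuous_diracPropagator t).aestronglyMeasurable (Lp.aestronglyMeasurable g)
  · simpa using (diracPropagator t ξ).le_of_opNorm_le (norm_diracPropagator_le t ξ) (g ξ)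

/-- The Dirac flow `exp (-i t (𝒟 + β)) f` of mass `1`, for `f ∈ L²(ℝ³; ℂ⁴)`. -/
def diracFlow (t : ℝ) (f : SpinorL2) : SpinorL2 :=
  𝓕⁻ ((memLp_diracPropagator t (𝓕 f)).toLp
    (fun ξ : Space => diracPropagator t ξ ((𝓕 f : SpinorL2) ξ)))

/-- The norm of `H^σ(ℝ³; ℂ⁴)`, namely `‖(1 - Δ)^(σ/2) f‖_{L²}`, computed on the Fourier side
(`∞` if `f ∉ H^σ`). -/
def sobolevNorm (σ : ℝ) (f : SpinorL2) : ℝ≥0∞ :=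
  eLpNorm (fun ξ : Space => (1 + ‖(2 * Real.pi) • ξ‖ ^ 2) ^ (σ / 2) • (𝓕 f : SpinorL2) ξ) 2 volume

/-- A window: a test function with `L²` norm `1`. -/
structure IsWindow {E : Type*} [NormedAddCommGroup E] [NormedSpace ℝ E] [MeasureSpace E]
    (φ : E → ℂ) : Prop where
  contDiff : ContDiff ℝ ∞ φ
  hasCompactSupport : HasCompactSupport φ
  norm_eq_one : eLpNorm φ 2 volume = 1

/-- The norm `‖f‖_{W(p,q)} = ‖ ‖f τ_x φ‖_{L^p} ‖_{L^q_x}` of the Wiener amalgam space `W(p,q)`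
with respect to the window `φ`, where `τ_x φ = φ(· - x)`. -/
def amalgamNorm {E F : Type*} [NormedAddCommGroup E] [MeasureSpace E] [ENorm F]
    (p q : ℝ≥0∞) (φ : E → ℂ) (f : E → F) : ℝ≥0∞ :=
  eLpNorm (fun x : E => eLpNorm (fun y : E => ‖f y‖ₑ * ‖φ (y - x)‖ₑ) p volume) q volume

end

/-!
The symbol of `𝒟 + β` squares to `⟨2πξ⟩²`, so the Dirac flow is a sum of two half-waves
`e^{∓it⟨D⟩} Π_±` (`diracPropagator_eq`), and the estimate is one for the Klein-Gordon propagator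
`e^{∓it⟨D⟩}⟨D⟩^{-σ}` on `L²`. Its `TT*` operator is convolution in space-time with the kernel of
`e^{-it⟨D⟩}⟨D⟩^{-2σ}`, where it is no loss to take `1 < σ < 3/2`; write `2σ = 3 - a` with
`0 < a < 1`.

* *Kernel bounds.* In three dimensions the kernel is `1 / |x|` times a one-dimensional sine
  transform (`kleinGordonKernel_eq`). The size of the integrand, one integration by parts and van der
  Corput's test give the bounds `|x|^{-μ}` and `|t|^{-μ}` for `a < μ ≤ 1`, and `|x|⁻¹ |t|^{-ε}` for
  a small `ε > 0`. Geometric means of these bound the kernel by a product of a function of `t` and a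
  function of `x`, each a power near the origin and another power at infinity
  (`exists_kleinGordonKernel_le_powerWeight`). The condition `3/2 - σ < 1/qt + 3/rt` makes the two
  factors locally integrable to the powers `qt/2` and `rt/2`; the gain `ε` and `1/q + 3/r = 1/2` with
  `r > 6` make them globally integrable to the powers `q/2` and `r/2`.

* *Duality.* Because of this strict integrability no fractional integration is needed: convolution
  with either factor maps the dual amalgam space into the amalgam space by Young's inequality, used
  once for the pieces cut out by two windows and once for the norms of the pieces
  (`lintegral_dualFun_kernel_dualFun_le`). Instead of duality of amalgam spaces, the `TT*` inequality
  (`enorm_integral_inner_le`) is tested on the extremizer of the norm of the solution, for which all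
  quantities are explicit (`mixedNorm_le_of_pairing`).

* *Limits.* All of this is done for frequencies in a ball, where the solution is an absolutely
  convergent Fourier integral. The cut-off is removed by Fatou's lemma, since the truncated solutions
  converge in `L²` at each time (`mixedNorm_diracFlow_le`). The exponent `qt = ∞` is the limit of
  finite exponents with uniform constants (`amalgamNorm_top_le`).

The classical norm is, up to a constant, an amalgam norm with equal local and global exponents
(`mixedNorm_self`).
-/

noncomputable section

/-! ### Young's inequality and duality for amalgam norms -/

/-- Young's inequality in the form of Schur's test, for `F` and `G` in `L^p` and a kernel bounded by
`M` in `L^(p/2)` in each variable: Hölder's inequality with the exponents `1/p`, `1/p`, `1 - 2/p` for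
`F^p k^(p/2)`, `G^p k^(p/2)`, `F^p G^p`. -/
theorem lintegral_lintegral_mul_kernel_mul_le {α : Type*} [MeasurableSpace α] {μ : Measure α}
    [SFinite μ] {p : ℝ} (hp : 2 ≤ p) {F G : α → ℝ≥0∞} (hF : Measurable F) (hG : Measurable G)
    {k : α → α → ℝ≥0∞} (hk : Measurable (Function.uncurry k)) {M : ℝ≥0∞}
    (h₁ : ∀ x, ∫⁻ y, k x y ^ (p / 2) ∂μ ≤ M ^ (p / 2))
    (h₂ : ∀ y, ∫⁻ x, k x y ^ (p / 2) ∂μ ≤ M ^ (p / 2)) :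
    ∫⁻ x, ∫⁻ y, F x ^ (p - 1) * k x y * G y ^ (p - 1) ∂μ ∂μ ≤
      M * (∫⁻ x, F x ^ p ∂μ) ^ ((p - 1) / p) * (∫⁻ y, G y ^ p ∂μ) ^ ((p - 1) / p) := by
  have hp0 : 0 < p := by linarith
  have hk1 : Measurable fun z : α × α => k z.1 z.2 := hk
  set a : Fin 3 → α × α → ℝ≥0∞ := ![fun z => F z.1 ^ p * k z.1 z.2 ^ (p / 2),
    fun z => G z.2 ^ p * k z.1 z.2 ^ (p / 2), fun z => F z.1 ^ p * G z.2 ^ p] with ha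
  set e : Fin 3 → ℝ := ![1 / p, 1 / p, 1 - 2 / p] with he
  have hp2 : 0 ≤ 1 - 2 / p := by
    rw [sub_nonneg, div_le_one hp0]; exact hp
  have key := ENNReal.lintegral_prod_norm_pow_le (μ := μ.prod μ) (s := Finset.univ) (f := a)
    (by intro i _; fin_cases i <;> simp only [ha] <;> dsimp <;> fun_prop)
    (p := e) (by simp [he, Fin.sum_univ_three]; ring)
    (by intro i _; fin_cases i <;> simp [he] <;> first | positivity | simpa using hp2)
  simp only [Fin.prod_univ_three, ha, he, Matrix.cons_val_zero, Matrix.cons_val_one,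
    Matrix.cons_val] at key
  have hpow : ∀ x : ℝ≥0∞, (x ^ p) ^ (1 / p) * (x ^ p) ^ (1 - 2 / p) = x ^ (p - 1) := by
    intro x
    rw [← ENNReal.rpow_add_of_nonneg _ _ (by positivity) hp2, ← ENNReal.rpow_mul]
    congr 1; field_simp; ring
  have hk2 : ∀ x : ℝ≥0∞, (x ^ (p / 2)) ^ (1 / p) * (x ^ (p / 2)) ^ (1 / p) = x := by
    intro x
    rw [← ENNReal.rpow_add_of_nonneg _ _ (by positivity) (by positivity), ← ENNReal.rpow_mul]
    convert ENNReal.rpow_one x using 2; field_simp; ring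
  have hL : ∫⁻ x, ∫⁻ y, F x ^ (p - 1) * k x y * G y ^ (p - 1) ∂μ ∂μ
      = ∫⁻ z, (F z.1 ^ p * k z.1 z.2 ^ (p / 2)) ^ (1 / p) *
        (G z.2 ^ p * k z.1 z.2 ^ (p / 2)) ^ (1 / p) *
        (F z.1 ^ p * G z.2 ^ p) ^ (1 - 2 / p) ∂(μ.prod μ) := by
    rw [lintegral_prod _ (by fun_prop)]
    refine lintegral_congr fun x => lintegral_congr fun y => ?_
    rw [ENNReal.mul_rpow_of_nonneg _ _ (by positivity), ENNReal.mul_rpow_of_nonneg _ _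
      (by positivity), ENNReal.mul_rpow_of_nonneg _ _ hp2, ← hpow (F x), ← hpow (G y)]
    nth_rw 1 [← hk2 (k x y)]
    ring
  have hA : ∫⁻ z, F z.1 ^ p * k z.1 z.2 ^ (p / 2) ∂(μ.prod μ)
      ≤ M ^ (p / 2) * ∫⁻ x, F x ^ p ∂μ := by
    rw [lintegral_prod _ (by fun_prop), mul_comm, ← lintegral_mul_const _ (by fun_prop)]
    refine lintegral_mono fun x => ?_
    dsimp only
    rw [lintegral_const_mul _ (by fun_prop)]
    gcongr
    exact h₁ x
  have hB : ∫⁻ z, G z.2 ^ p * k z.1 z.2 ^ (p / 2) ∂(μ.prod μ)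
      ≤ M ^ (p / 2) * ∫⁻ x, G x ^ p ∂μ := by
    rw [lintegral_prod_symm _ (by fun_prop), mul_comm, ← lintegral_mul_const _ (by fun_prop)]
    refine lintegral_mono fun x => ?_
    dsimp only
    rw [lintegral_const_mul _ (by fun_prop)]
    gcongr
    exact h₂ x
  have hC : ∫⁻ z, F z.1 ^ p * G z.2 ^ p ∂(μ.prod μ) = (∫⁻ x, F x ^ p ∂μ) * ∫⁻ x, G x ^ p ∂μ :=
    lintegral_prod_mul (hF.pow_const p).aemeasurable (hG.pow_const p).aemeasurable
  rw [hL]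
  refine key.trans ?_
  rw [hC]
  set IF := ∫⁻ x, F x ^ p ∂μ
  set IG := ∫⁻ x, G x ^ p ∂μ
  have hpow' : ∀ x : ℝ≥0∞, x ^ (1 / p) * x ^ (1 - 2 / p) = x ^ ((p - 1) / p) := by
    intro x
    rw [← ENNReal.rpow_add_of_nonneg _ _ (by positivity) hp2]
    congr 1; field_simp; ring
  calc _ ≤ (M ^ (p / 2) * IF) ^ (1 / p) * (M ^ (p / 2) * IG) ^ (1 / p) *
        (IF * IG) ^ (1 - 2 / p) := by gcongr
    _ = _ := by
      rw [ENNReal.mul_rpow_of_nonneg _ _ (by positivity), ENNReal.mul_rpow_of_nonneg _ _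
        (by positivity), ENNReal.mul_rpow_of_nonneg _ _ hp2, ← hpow' IF, ← hpow' IG]
      nth_rw 3 [← hk2 M]
      ring

theorem lintegral_swap_pairs {α β : Type*} [MeasurableSpace α] [MeasurableSpace β]
    {μ : Measure α} {ν : Measure β} [SFinite μ] [SFinite ν] {Φ : α → α → β → β → ℝ≥0∞}
    (hΦ : Measurable fun z : (α × α) × (β × β) => Φ z.1.1 z.1.2 z.2.1 z.2.2) :
    ∫⁻ y, ∫⁻ y', ∫⁻ x, ∫⁻ x', Φ x x' y y' ∂μ ∂μ ∂ν ∂ν =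
      ∫⁻ x, ∫⁻ x', ∫⁻ y, ∫⁻ y', Φ x x' y y' ∂ν ∂ν ∂μ ∂μ := by
  have hΦ' : Measurable fun w : (β × β) × (α × α) => Φ w.2.1 w.2.2 w.1.1 w.1.2 :=
    hΦ.comp measurable_swap
  have h1 : ∀ y y', ∫⁻ x, ∫⁻ x', Φ x x' y y' ∂μ ∂μ = ∫⁻ u, Φ u.1 u.2 y y' ∂(μ.prod μ) := fun y y' =>
    (lintegral_prod (fun u : α × α => Φ u.1 u.2 y y')
      (hΦ.comp (g := fun z : (α × α) × (β × β) => Φ z.1.1 z.1.2 z.2.1 z.2.2)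
        (measurable_prodMk_right (y := (y, y')))).aemeasurable).symm
  have h2 : ∀ x x', ∫⁻ y, ∫⁻ y', Φ x x' y y' ∂ν ∂ν = ∫⁻ u, Φ x x' u.1 u.2 ∂(ν.prod ν) := fun x x' =>
    (lintegral_prod (fun u : β × β => Φ x x' u.1 u.2)
      (hΦ.comp (g := fun z : (α × α) × (β × β) => Φ z.1.1 z.1.2 z.2.1 z.2.2)
        (measurable_prodMk_left (x := (x, x')))).aemeasurable).symm
  simp_rw [h1, h2]
  rw [← lintegral_prod (fun z : β × β => ∫⁻ u, Φ u.1 u.2 z.1 z.2 ∂(μ.prod μ))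
      hΦ'.lintegral_prod_right'.aemeasurable,
    ← lintegral_prod (fun z : α × α => ∫⁻ u, Φ z.1 z.2 u.1 u.2 ∂(ν.prod ν))
      hΦ.lintegral_prod_right'.aemeasurable]
  exact lintegral_lintegral_swap hΦ'.aemeasurable

section Amalgam

variable {E : Type*} [NormedAddCommGroup E] [MeasureSpace E]

/-- The local part `x ↦ ‖v τ_x ψ‖_{L^p}` of the amalgam norm of a function `v ≥ 0`, with respect to
a window `ψ ≥ 0`, for a finite exponent `p`. -/
def localNorm (p : ℝ) (ψ v : E → ℝ≥0∞) (x : E) : ℝ≥0∞ :=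
  (∫⁻ y, (v y * ψ (y - x)) ^ p) ^ (1 / p)

/-- The amalgam norm of a function `v ≥ 0`, with respect to a window `ψ ≥ 0`, for finite exponents:
`p` is the local one, `q` the global one. -/
def mixedNorm (p q : ℝ) (ψ v : E → ℝ≥0∞) : ℝ≥0∞ :=
  (∫⁻ x, localNorm p ψ v x ^ q) ^ (1 / q)

/-- The function that extremizes, up to normalization, the duality pairing with `v` with respect to
the norm `mixedNorm p q ψ`. -/
def dualFun (p q : ℝ) (ψ v : E → ℝ≥0∞) (y : E) : ℝ≥0∞ :=
  v y ^ (p - 1) * ∫⁻ x, ψ (y - x) ^ p * localNorm p ψ v x ^ (q - p)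

/-- Convolution with `k ≥ 0` is bounded between the amalgam spaces dual to and defined by
`mixedNorm p q ψ`, in the form needed for Young's inequality: `b x` bounds the `L^(p/2)` norms of
the pieces of `k` cut out by two windows that lie `x` apart, and `C` bounds the `L^(q/2)` norm
of `b`. -/
structure IsAmalgamKernel (p q : ℝ) (ψ k b : E → ℝ≥0∞) (C : ℝ≥0∞) : Prop where
  measurable_kernel : Measurable k
  measurable_bound : Measurable b
  left : ∀ x x' y, ∫⁻ y', (ψ (y - x) * k (y - y') * ψ (y' - x')) ^ (p / 2) ≤ b (x - x') ^ (p / 2)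
  right : ∀ x x' y', ∫⁻ y, (ψ (y - x) * k (y - y') * ψ (y' - x')) ^ (p / 2) ≤ b (x - x') ^ (p / 2)
  bound_left : ∀ x, ∫⁻ x', b (x - x') ^ (q / 2) ≤ C ^ (q / 2)
  bound_right : ∀ x', ∫⁻ x, b (x - x') ^ (q / 2) ≤ C ^ (q / 2)

variable {p q : ℝ} {ψ v w k b : E → ℝ≥0∞} {C : ℝ≥0∞}

theorem localNorm_rpow (hp : 0 < p) (x : E) :
    localNorm p ψ v x ^ p = ∫⁻ y, (v y * ψ (y - x)) ^ p := by
  rw [localNorm, ← ENNReal.rpow_mul, one_div_mul_cancel hp.ne', ENNReal.rpow_one]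

theorem mixedNorm_rpow (hq : 0 < q) :
    mixedNorm p q ψ v ^ q = ∫⁻ x, localNorm p ψ v x ^ q := by
  rw [mixedNorm, ← ENNReal.rpow_mul, one_div_mul_cancel hq.ne', ENNReal.rpow_one]

variable [BorelSpace E] [SecondCountableTopology E] [SFinite (volume : Measure E)]

theorem measurable_localNorm {T : Type*} [MeasurableSpace T] {v : T → E → ℝ≥0∞}
    (hψ : Measurable ψ) (hv : Measurable (Function.uncurry v)) :
    Measurable fun z : T × E => localNorm p ψ (v z.1) z.2 := by
  unfold localNorm
  refine Measurable.pow_const ?_ _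
  refine Measurable.lintegral_prod_right' (f := fun w : (T × E) × E =>
    (v w.1.1 w.2 * ψ (w.2 - w.1.2)) ^ p) ?_
  have : Measurable fun w : (T × E) × E => v w.1.1 w.2 :=
    hv.comp (f := fun w : (T × E) × E => (w.1.1, w.2)) (by fun_prop)
  fun_prop

theorem measurable_mixedNorm {T : Type*} [MeasurableSpace T] {v : T → E → ℝ≥0∞}
    (hψ : Measurable ψ) (hv : Measurable (Function.uncurry v)) :
    Measurable fun t : T => mixedNorm p q ψ (v t) := by
  unfold mixedNorm
  refine Measurable.pow_const ?_ _
  exact Measurable.lintegral_prod_right' (f := fun w : T × E => localNorm p ψ (v w.1) w.2 ^ q)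
    ((measurable_localNorm hψ hv).pow_const _)

theorem measurable_dualFun {T : Type*} [MeasurableSpace T] {v : T → E → ℝ≥0∞}
    (hψ : Measurable ψ) (hv : Measurable (Function.uncurry v)) :
    Measurable fun z : T × E => dualFun p q ψ (v z.1) z.2 := by
  unfold dualFun
  refine Measurable.mul (Measurable.pow_const hv _) ?_
  refine Measurable.lintegral_prod_right' (f := fun w : (T × E) × E =>
    ψ (w.1.2 - w.2) ^ p * localNorm p ψ (v w.1.1) w.2 ^ (q - p)) ?_
  have : Measurable fun w : (T × E) × E => localNorm p ψ (v w.1.1) w.2 :=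
    (measurable_localNorm hψ hv).comp (f := fun w : (T × E) × E => (w.1.1, w.2)) (by fun_prop)
  fun_prop

theorem ENNReal.rpow_mul_rpow_of_add_eq {x : ℝ≥0∞} (hx : x ≠ ⊤) {a b c : ℝ} (ha : 0 < a) (hc : 0 < c)
    (h : a + b = c) : x ^ a * x ^ b = x ^ c := by
  rcases eq_or_ne x 0 with rfl | h0
  · rw [ENNReal.zero_rpow_of_pos ha, ENNReal.zero_rpow_of_pos hc, zero_mul]
  · rw [← ENNReal.rpow_add _ _ h0 hx, h]

theorem lintegral_mul_dualFun (hp : 1 < p) (hq : 1 < q) (hψ : Measurable ψ) (hv : Measurable v)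
    (hfin : ∀ x, localNorm p ψ v x ≠ ⊤) :
    ∫⁻ y, v y * dualFun p q ψ v y = mixedNorm p q ψ v ^ q := by
  have hm : Measurable (localNorm p ψ v) :=
    (measurable_localNorm (T := Unit) (v := fun _ => v) hψ (by fun_prop)).comp
      (f := fun x => ((), x)) (by fun_prop)
  have hp0 : 0 < p := by linarith
  rw [mixedNorm_rpow (by linarith)]
  calc ∫⁻ y, v y * dualFun p q ψ v y
      = ∫⁻ y, ∫⁻ x, (v y * ψ (y - x)) ^ p * localNorm p ψ v x ^ (q - p) := by
        refine lintegral_congr fun y => ?_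
        rw [dualFun, ← mul_assoc, ← lintegral_const_mul _ (by fun_prop)]
        refine lintegral_congr fun x => ?_
        have : v y * v y ^ (p - 1) = v y ^ p := by
          nth_rw 1 [← ENNReal.rpow_one (v y)]
          rw [← ENNReal.rpow_add_of_nonneg _ _ zero_le_one (by linarith)]
          congr 1; ring
        rw [this, ENNReal.mul_rpow_of_nonneg _ _ hp0.le, mul_assoc]
    _ = ∫⁻ x, ∫⁻ y, (v y * ψ (y - x)) ^ p * localNorm p ψ v x ^ (q - p) :=
        lintegral_lintegral_swap (by fun_prop)
    _ = _ := by
        refine lintegral_congr fun x => ?_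
        rw [lintegral_mul_const _ (by fun_prop), ← localNorm_rpow hp0]
        exact ENNReal.rpow_mul_rpow_of_add_eq (hfin x) hp0 (by linarith) (by ring)

/-- Young's inequality for amalgam spaces, tested on extremizers. The weights of the two extremizers
insert a pair of windows, Young's inequality in `L^p` bounds the contribution of each pair and
Young's inequality in `L^q` their sum. -/
theorem lintegral_dualFun_kernel_dualFun_le (hp : 2 ≤ p) (hq : 2 ≤ q) (hψ : Measurable ψ)
    (hv : Measurable v) (hw : Measurable w)
    (hvfin : ∀ x, localNorm p ψ v x ≠ ⊤) (hwfin : ∀ x, localNorm p ψ w x ≠ ⊤)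
    (hk : IsAmalgamKernel p q ψ k b C) :
    ∫⁻ y, ∫⁻ y', dualFun p q ψ v y * k (y - y') * dualFun p q ψ w y' ≤
      C * mixedNorm p q ψ v ^ (q - 1) * mixedNorm p q ψ w ^ (q - 1) := by
  have hmeas : ∀ {v : E → ℝ≥0∞}, Measurable v → Measurable (localNorm p ψ v) := fun {v} hv =>
    (measurable_localNorm (T := Unit) (v := fun _ => v) hψ (by fun_prop)).comp
      (f := fun x => ((), x)) (by fun_prop)
  have hmv := hmeas hv
  have hmw := hmeas hw
  have hkm := hk.measurable_kernel
  have hbm := hk.measurable_bound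
  set m := localNorm p ψ v with hm
  set n := localNorm p ψ w with hn
  have hp0 : 0 < p := by linarith
  have hq0 : 0 < q := by linarith
  -- the integrand after the two windows have been inserted
  set Φ : E → E → E → E → ℝ≥0∞ := fun x x' y y' => m x ^ (q - p) * n x' ^ (q - p) *
    ((v y * ψ (y - x)) ^ (p - 1) * (ψ (y - x) * k (y - y') * ψ (y' - x')) *
      (w y' * ψ (y' - x')) ^ (p - 1)) with hΦ
  have hexp : ∀ y y', dualFun p q ψ v y * k (y - y') * dualFun p q ψ w y' =
      ∫⁻ x, ∫⁻ x', Φ x x' y y' := by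
    intro y y'
    have hs : ∀ a : ℝ≥0∞, a ^ p = a ^ (p - 1) * a := by
      intro a
      nth_rw 3 [← ENNReal.rpow_one a]
      rw [← ENNReal.rpow_add_of_nonneg _ _ (by linarith) zero_le_one]
      congr 1; ring
    have h1 : ∀ x, ∫⁻ x', Φ x x' y y' = (v y ^ (p - 1) * (ψ (y - x) ^ p * m x ^ (q - p))) *
        k (y - y') * dualFun p q ψ w y' := by
      intro x
      rw [dualFun, ← lintegral_const_mul _ (by fun_prop), ← lintegral_const_mul _ (by fun_prop)]
      refine lintegral_congr fun x' => ?_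
      simp only [hΦ]
      rw [hs (ψ (y - x)), hs (ψ (y' - x')), ENNReal.mul_rpow_of_nonneg _ _ (by linarith),
        ENNReal.mul_rpow_of_nonneg _ _ (by linarith)]
      ring
    simp_rw [h1]
    rw [lintegral_mul_const _ (by fun_prop), lintegral_mul_const _ (by fun_prop),
      lintegral_const_mul _ (by fun_prop)]
    rfl
  have hin : ∀ x x', ∫⁻ y, ∫⁻ y', Φ x x' y y' ≤
      m x ^ (q - 1) * b (x - x') * n x' ^ (q - 1) := by
    intro x x'
    have := lintegral_lintegral_mul_kernel_mul_le (μ := volume) hp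
      (F := fun y => v y * ψ (y - x)) (G := fun y' => w y' * ψ (y' - x')) (by fun_prop)
      (by fun_prop) (k := fun y y' => ψ (y - x) * k (y - y') * ψ (y' - x')) (by fun_prop)
      (hk.left x x') (hk.right x x')
    have e1 : ∀ a : ℝ≥0∞, a ^ ((p - 1) / p) = (a ^ (1 / p)) ^ (p - 1) := by
      intro a
      rw [← ENNReal.rpow_mul]
      congr 1; field_simp
    rw [e1, e1] at this
    change _ ≤ b (x - x') * m x ^ (p - 1) * n x' ^ (p - 1) at this
    calc ∫⁻ y, ∫⁻ y', Φ x x' y y' = m x ^ (q - p) * n x' ^ (q - p) * ∫⁻ y, ∫⁻ y',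
          ((v y * ψ (y - x)) ^ (p - 1) * (ψ (y - x) * k (y - y') * ψ (y' - x')) *
          (w y' * ψ (y' - x')) ^ (p - 1)) := by
          rw [← lintegral_const_mul _ (by fun_prop)]
          refine lintegral_congr fun y => ?_
          rw [← lintegral_const_mul _ (by fun_prop)]
      _ ≤ m x ^ (q - p) * n x' ^ (q - p) * (b (x - x') * m x ^ (p - 1) * n x' ^ (p - 1)) := by
          gcongr
      _ = (m x ^ (p - 1) * m x ^ (q - p)) * b (x - x') * (n x' ^ (p - 1) * n x' ^ (q - p)) := by
          ring
      _ = _ := by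
          rw [ENNReal.rpow_mul_rpow_of_add_eq (hvfin x) (by linarith) (by linarith : 0 < q - 1) (by ring),
            ENNReal.rpow_mul_rpow_of_add_eq (hwfin x') (by linarith) (by linarith : 0 < q - 1) (by ring)]
  have hΦm : Measurable fun z : (E × E) × (E × E) => Φ z.1.1 z.1.2 z.2.1 z.2.2 := by
    simp only [hΦ]; fun_prop
  have hout := lintegral_lintegral_mul_kernel_mul_le (μ := volume) hq hmv hmw
      (k := fun x x' => b (x - x')) (by fun_prop) hk.bound_left hk.bound_right
  have e2 : ∀ a : ℝ≥0∞, a ^ ((q - 1) / q) = (a ^ (1 / q)) ^ (q - 1) := by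
    intro a
    rw [← ENNReal.rpow_mul]
    congr 1; field_simp
  rw [e2, e2] at hout
  calc _ = ∫⁻ y, ∫⁻ y', ∫⁻ x, ∫⁻ x', Φ x x' y y' := by simp_rw [hexp]
    _ = ∫⁻ x, ∫⁻ x', ∫⁻ y, ∫⁻ y', Φ x x' y y' := lintegral_swap_pairs hΦm
    _ ≤ ∫⁻ x, ∫⁻ x', m x ^ (q - 1) * b (x - x') * n x' ^ (q - 1) := by
        gcongr with x x'; exact hin x x'
    _ ≤ _ := hout

end Amalgam

section SpaceTime

variable {T E : Type*} [NormedAddCommGroup T] [MeasureSpace T] [BorelSpace T]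
  [SecondCountableTopology T] [SFinite (volume : Measure T)]
  [NormedAddCommGroup E] [MeasureSpace E] [BorelSpace E]
  [SecondCountableTopology E] [SFinite (volume : Measure E)]
  {qt q rt r : ℝ} {φ A a : T → ℝ≥0∞} {ψ B b : E → ℝ≥0∞} {CA CB : ℝ≥0∞} {v : T → E → ℝ≥0∞}

/-- The extremizer for the norm `mixedNorm qt q φ` in time of `mixedNorm rt r ψ` in space: at each
time the extremizer in space, divided by the power `r - 1` of the norm, times the extremizer in time
of the function `t ↦ mixedNorm rt r ψ (v t)`. -/
def spaceTimeDualFun (qt q rt r : ℝ) (φ : T → ℝ≥0∞) (ψ : E → ℝ≥0∞) (v : T → E → ℝ≥0∞)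
    (t : T) (y : E) : ℝ≥0∞ :=
  dualFun rt r ψ (v t) y * (mixedNorm rt r ψ (v t) ^ (1 - r) *
    dualFun qt q φ (fun t => mixedNorm rt r ψ (v t)) t)

theorem measurable_spaceTimeDualFun (hφ : Measurable φ) (hψ : Measurable ψ)
    (hv : Measurable (Function.uncurry v)) :
    Measurable fun z : T × E => spaceTimeDualFun qt q rt r φ ψ v z.1 z.2 := by
  have h1 := measurable_mixedNorm (p := rt) (q := r) hψ hv
  have h2 : Measurable fun t => dualFun qt q φ (fun t => mixedNorm rt r ψ (v t)) t :=
    (measurable_dualFun (T := Unit) (v := fun _ t => mixedNorm rt r ψ (v t)) hφ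
      (h1.comp measurable_snd)).comp
      (f := fun x => ((), x)) (by fun_prop)
  have h3 := measurable_dualFun (p := rt) (q := r) hψ hv
  exact h3.mul (((h1.comp measurable_fst).pow_const _).mul (h2.comp measurable_fst))

theorem lintegral_mul_spaceTimeDualFun (hqt : 1 < qt) (hq : 1 < q) (hrt : 1 < rt) (hr : 1 < r)
    (hφ : Measurable φ) (hψ : Measurable ψ) (hv : Measurable (Function.uncurry v))
    (hfin : ∀ t x, localNorm rt ψ (v t) x ≠ ⊤) (hfin' : ∀ t, mixedNorm rt r ψ (v t) ≠ ⊤)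
    (hfin'' : ∀ s, localNorm qt φ (fun t => mixedNorm rt r ψ (v t)) s ≠ ⊤) :
    ∫⁻ t, ∫⁻ y, v t y * spaceTimeDualFun qt q rt r φ ψ v t y =
      mixedNorm qt q φ (fun t => mixedNorm rt r ψ (v t)) ^ q := by
  have h1 := measurable_mixedNorm (p := rt) (q := r) hψ hv
  rw [← lintegral_mul_dualFun hqt hq hφ h1 hfin'']
  refine lintegral_congr fun t => ?_
  have hvt : Measurable (v t) := hv.comp (by fun_prop : Measurable fun y => (t, y))
  have h3 : Measurable (dualFun rt r ψ (v t)) :=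
    (measurable_dualFun (p := rt) (q := r) hψ hv).comp (by fun_prop : Measurable fun y => (t, y))
  simp only [spaceTimeDualFun, ← mul_assoc]
  rw [lintegral_mul_const _ (by fun_prop), lintegral_mul_const _ (by fun_prop),
    lintegral_mul_dualFun hrt hr hψ hvt (hfin t)]
  congr 1
  conv_rhs => rw [← ENNReal.rpow_one (mixedNorm rt r ψ (v t))]
  exact ENNReal.rpow_mul_rpow_of_add_eq (hfin' t) (by linarith) one_pos (by ring)

theorem lintegral_spaceTimeDualFun_kernel_le (hqt : 2 ≤ qt) (hq : 2 ≤ q) (hrt : 2 ≤ rt)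
    (hr : 2 ≤ r)
    (hφ : Measurable φ) (hψ : Measurable ψ) (hv : Measurable (Function.uncurry v))
    (hfin : ∀ t x, localNorm rt ψ (v t) x ≠ ⊤) (hfin' : ∀ t, mixedNorm rt r ψ (v t) ≠ ⊤)
    (hfin'' : ∀ s, localNorm qt φ (fun t => mixedNorm rt r ψ (v t)) s ≠ ⊤)
    (hA : IsAmalgamKernel qt q φ A a CA) (hB : IsAmalgamKernel rt r ψ B b CB) :
    ∫⁻ t, ∫⁻ t', ∫⁻ y, ∫⁻ y', spaceTimeDualFun qt q rt r φ ψ v t y * (A (t - t') * B (y - y')) *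
        spaceTimeDualFun qt q rt r φ ψ v t' y' ≤
      CA * CB * (mixedNorm qt q φ (fun t => mixedNorm rt r ψ (v t)) ^ (q - 1)) ^ 2 := by
  have hAm := hA.measurable_kernel
  have hBm := hB.measurable_kernel
  have h1 := measurable_mixedNorm (p := rt) (q := r) hψ hv
  set μ : T → ℝ≥0∞ := fun t => mixedNorm rt r ψ (v t) with hμ
  have h2 : Measurable (dualFun qt q φ μ) :=
    (measurable_dualFun (T := Unit) (v := fun _ t => mixedNorm rt r ψ (v t)) hφ
      (h1.comp measurable_snd)).comp
      (f := fun x => ((), x)) (by fun_prop)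
  have hvt : ∀ t, Measurable (v t) := fun t => hv.comp (by fun_prop : Measurable fun y => (t, y))
  have h3 : ∀ t, Measurable (dualFun rt r ψ (v t)) := fun t =>
    (measurable_dualFun (p := rt) (q := r) hψ hv).comp (by fun_prop : Measurable fun y => (t, y))
  have hone : ∀ t, μ t ^ (1 - r) * μ t ^ (r - 1) ≤ 1 := by
    intro t
    rcases eq_or_ne (μ t) 0 with h0 | h0
    · rw [h0, ENNReal.zero_rpow_of_pos (by linarith : 0 < r - 1), mul_zero]; exact zero_le_one
    · rw [← ENNReal.rpow_add _ _ h0 (hfin' t)]; simp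
  calc _ ≤ ∫⁻ t, ∫⁻ t', CB * (dualFun qt q φ μ t * A (t - t') * dualFun qt q φ μ t') := by
        refine lintegral_mono fun t => lintegral_mono fun t' => ?_
        have hvt' := h3 t
        have hvt'' := h3 t'
        calc _ = (μ t ^ (1 - r) * dualFun qt q φ μ t) * A (t - t') *
              (μ t' ^ (1 - r) * dualFun qt q φ μ t') *
              ∫⁻ y, ∫⁻ y', dualFun rt r ψ (v t) y * B (y - y') * dualFun rt r ψ (v t') y' := by
              rw [← lintegral_const_mul _ (by fun_prop)]
              refine lintegral_congr fun y => ?_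
              rw [← lintegral_const_mul _ (by fun_prop)]
              refine lintegral_congr fun y' => ?_
              simp only [spaceTimeDualFun]
              ring
          _ ≤ (μ t ^ (1 - r) * dualFun qt q φ μ t) * A (t - t') *
              (μ t' ^ (1 - r) * dualFun qt q φ μ t') *
              (CB * μ t ^ (r - 1) * μ t' ^ (r - 1)) := by
              gcongr
              exact lintegral_dualFun_kernel_dualFun_le hrt hr hψ (hvt t) (hvt t') (hfin t)
                (hfin t') hB
          _ = (μ t ^ (1 - r) * μ t ^ (r - 1)) * (μ t' ^ (1 - r) * μ t' ^ (r - 1)) *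
              (CB * (dualFun qt q φ μ t * A (t - t') * dualFun qt q φ μ t')) := by ring
          _ ≤ 1 * 1 * (CB * (dualFun qt q φ μ t * A (t - t') * dualFun qt q φ μ t')) := by
              gcongr <;> apply hone
          _ = _ := by ring
    _ = CB * ∫⁻ t, ∫⁻ t', dualFun qt q φ μ t * A (t - t') * dualFun qt q φ μ t' := by
        rw [← lintegral_const_mul _ (by fun_prop)]
        refine lintegral_congr fun y => ?_
        rw [← lintegral_const_mul _ (by fun_prop)]
    _ ≤ CB * (CA * mixedNorm qt q φ μ ^ (q - 1) * mixedNorm qt q φ μ ^ (q - 1)) := by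
        gcongr
        exact lintegral_dualFun_kernel_dualFun_le hqt hq hφ h1 h1 hfin'' hfin'' hA
    _ = _ := by ring

end SpaceTime

/-! ### Oscillatory integrals on the half-line -/

/-- Van der Corput's second derivative test. -/
theorem norm_integral_exp_phase_le {φ φ' φ'' : ℝ → ℝ} {a b m : ℝ} (hab : a ≤ b) (hm : 0 < m)
    (h1 : ∀ x, HasDerivAt φ (φ' x) x) (h2 : ∀ x, HasDerivAt φ' (φ'' x) x) (hc : Continuous φ'')
    (h3 : ∀ x ∈ Set.Icc a b, m ≤ φ'' x) :
    ‖∫ x in a..b, Complex.exp (Complex.I * φ x)‖ ≤ (1 + 2 * Real.pi) / √m := by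
  -- with `u = φ' / √m`, split `1 = 1 / (1 + u ^ 2) + u ^ 2 / (1 + u ^ 2)`: the first term is bounded
  -- by `(arctan u)' / √m`, and the second is integrated by parts
  set c := √m with hcdef
  have hc0 : 0 < c := Real.sqrt_pos.2 hm
  have hcc : c * c = m := Real.mul_self_sqrt hm.le
  set u : ℝ → ℝ := fun x => φ' x / c with hu
  have hφc : Continuous φ := continuous_iff_continuousAt.2 fun x => (h1 x).continuousAt
  have hφ'c : Continuous φ' := continuous_iff_continuousAt.2 fun x => (h2 x).continuousAt
  have huc : Continuous u := hφ'c.div_const c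
  have hu' : ∀ x, HasDerivAt u (φ'' x / c) x := fun x => (h2 x).div_const c
  have hpos : ∀ x, 0 < 1 + u x ^ 2 := fun x => by positivity
  have hne : ∀ x, 1 + u x ^ 2 ≠ 0 := fun x => (hpos x).ne'
  set W : ℝ → ℂ := fun x => Complex.exp (Complex.I * φ x) with hW
  have hWn : ∀ x, ‖W x‖ = 1 := fun x => by
    simp only [hW]; rw [mul_comm]; exact Complex.norm_exp_ofReal_mul_I _
  have hWc : Continuous W := by fun_prop
  have hW' : ∀ x, HasDerivAt W (W x * (Complex.I * φ' x)) x := fun x =>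
    ((h1 x).ofReal_comp.const_mul Complex.I).cexp
  set h : ℝ → ℝ := fun x => u x / (1 + u x ^ 2) with hh
  set h' : ℝ → ℝ := fun x => (φ'' x / c) * (1 - u x ^ 2) / (1 + u x ^ 2) ^ 2 with hh'
  have hhd : ∀ x, HasDerivAt h (h' x) x := fun x => by
    refine ((hu' x).div (((hu' x).pow 2).const_add 1) (hne x)).congr_deriv ?_
    simp only [hh', Pi.pow_apply]; congr 1; push_cast; ring
  have hh'c : Continuous h' := by
    simp only [hh']; exact Continuous.div (by fun_prop) (by fun_prop) fun x => pow_ne_zero _ (hne x)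
  have hhb : ∀ x, |h x| ≤ 1 / 2 := fun x => by
    simp only [hh]; rw [abs_div, abs_of_pos (hpos x), div_le_iff₀ (hpos x)]
    nlinarith [sq_nonneg (|u x| - 1), sq_abs (u x)]
  set d : ℝ → ℝ := fun x => (φ'' x / c) / (1 + u x ^ 2) with hd
  have hdc : Continuous d := by
    simp only [hd]; exact Continuous.div (by fun_prop) (by fun_prop) hne
  have harc : ∫ x in a..b, d x ≤ Real.pi := by
    rw [intervalIntegral.integral_eq_sub_of_hasDerivAt (f := fun x => Real.arctan (u x))]
    · linarith [Real.arctan_lt_pi_div_two (u b), Real.neg_pi_div_two_lt_arctan (u a)]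
    · intro x _
      refine ((hu' x).arctan).congr_deriv ?_
      simp only [hd]; ring
    · exact hdc.intervalIntegrable _ _
  have hdge : ∀ x ∈ Set.Icc a b, c / (1 + u x ^ 2) ≤ d x := fun x hx => by
    simp only [hd]
    have hp := hpos x
    gcongr
    rw [le_div_iff₀ hc0, hcc]; exact h3 x hx
  have hd0 : ∀ x ∈ Set.Icc a b, 0 ≤ φ'' x / c := fun x hx =>
    div_nonneg (hm.le.trans (h3 x hx)) hc0.le
  have hI1 : ‖∫ x in a..b, W x * ((1 / (1 + u x ^ 2) : ℝ) : ℂ)‖ ≤ Real.pi / c := by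
    refine (intervalIntegral.norm_integral_le_of_norm_le hab (g := fun x => d x / c)
      (ae_of_all _ fun x hx => ?_) ((hdc.div_const c).intervalIntegrable _ _)).trans ?_
    · rw [norm_mul, hWn, one_mul, Complex.norm_real, Real.norm_of_nonneg (by positivity),
        le_div_iff₀ hc0]
      calc _ = c / (1 + u x ^ 2) := by ring
        _ ≤ _ := hdge x ⟨hx.1.le, hx.2⟩
    · rw [intervalIntegral.integral_div]; gcongr
  have hI2 : ‖∫ x in a..b, (h' x : ℂ) * W x‖ ≤ Real.pi := by
    refine (intervalIntegral.norm_integral_le_of_norm_le hab (g := d)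
      (ae_of_all _ fun x hx => ?_) (hdc.intervalIntegrable _ _)).trans harc
    rw [norm_mul, hWn, mul_one, Complex.norm_real, Real.norm_eq_abs]
    simp only [hh', hd]
    have hp := hpos x
    have h0 := hd0 x ⟨hx.1.le, hx.2⟩
    rw [abs_div, abs_mul, abs_of_nonneg h0, abs_of_pos (pow_pos hp 2), div_le_div_iff₀
      (pow_pos hp 2) hp, pow_two (1 + u x ^ 2), ← mul_assoc]
    gcongr
    rw [abs_le]; constructor <;> nlinarith [sq_nonneg (u x)]
  have hparts := intervalIntegral.integral_mul_deriv_eq_deriv_mul (a := a) (b := b)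
    (u := fun x => (h x : ℂ)) (u' := fun x => (h' x : ℂ)) (v := W)
    (v' := fun x => W x * (Complex.I * φ' x)) (fun x _ => (hhd x).ofReal_comp) (fun x _ => hW' x)
    (by apply Continuous.intervalIntegrable; fun_prop)
    (by apply Continuous.intervalIntegrable; fun_prop)
  have hsplit : ∫ x in a..b, W x = (∫ x in a..b, W x * ((1 / (1 + u x ^ 2) : ℝ) : ℂ)) +
      (1 / (Complex.I * c)) * ∫ x in a..b, (h x : ℂ) * (W x * (Complex.I * φ' x)) := by
    rw [← intervalIntegral.integral_const_mul, ← intervalIntegral.integral_add]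
    · refine intervalIntegral.integral_congr fun x _ => ?_
      have hx : (1 + (u x : ℂ) ^ 2) ≠ 0 := by exact_mod_cast hne x
      have hcC : (c : ℂ) ≠ 0 := by exact_mod_cast hc0.ne'
      have : (φ' x : ℂ) = c * u x := by
        simp only [hu]; push_cast; field_simp
      simp only [hh]
      rw [this]
      push_cast
      field_simp
    · apply Continuous.intervalIntegrable
      have : Continuous fun x => 1 / (1 + u x ^ 2) :=
        Continuous.div (by fun_prop) (by fun_prop) hne
      fun_prop
    · apply Continuous.intervalIntegrable
      have : Continuous h := Continuous.div (by fun_prop) (by fun_prop) hne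
      fun_prop
  change ‖∫ x in a..b, W x‖ ≤ _
  rw [hsplit, hparts]
  have hb : ∀ x, ‖(h x : ℂ) * W x‖ ≤ 1 / 2 := fun x => by
    rw [norm_mul, hWn, mul_one, Complex.norm_real]; exact hhb x
  have hn : ‖(1 / (Complex.I * c) : ℂ)‖ = 1 / c := by
    rw [norm_div, norm_mul, Complex.norm_I, one_mul, norm_one, Complex.norm_real,
      Real.norm_of_nonneg hc0.le]
  calc _ ≤ Real.pi / c + 1 / c * (1 / 2 + 1 / 2 + Real.pi) := by
        refine (norm_add_le _ _).trans (add_le_add hI1 ?_)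
        rw [norm_mul, hn]
        gcongr
        refine (norm_sub_le _ _).trans (add_le_add ((norm_sub_le _ _).trans
          (add_le_add (hb b) (hb a))) hI2)
    _ = _ := by field_simp; ring

/-- The Japanese bracket `(1 + x ^ 2) ^ (1 / 2)`. -/
def japanese (x : ℝ) : ℝ := √(1 + x ^ 2)

theorem one_le_japanese (x : ℝ) : 1 ≤ japanese x := by
  rw [japanese, Real.one_le_sqrt]; nlinarith [sq_nonneg x]

theorem japanese_pos (x : ℝ) : 0 < japanese x := one_pos.trans_le (one_le_japanese x)

theorem abs_le_japanese (x : ℝ) : |x| ≤ japanese x :=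
  Real.abs_le_sqrt (by linarith)

theorem japanese_sq (x : ℝ) : japanese x ^ 2 = 1 + x ^ 2 := Real.sq_sqrt (by positivity)

@[fun_prop]
theorem continuous_japanese : Continuous japanese := by
  unfold japanese; fun_prop

theorem hasDerivAt_japanese (x : ℝ) : HasDerivAt japanese (x / japanese x) x := by
  have h : HasDerivAt (fun x : ℝ => 1 + x ^ 2) (2 * x) x := by
    simpa using (hasDerivAt_pow 2 x).const_add 1
  refine (h.sqrt (by positivity)).congr_deriv ?_
  rw [japanese]; field_simp

theorem continuous_japanese_rpow (c : ℝ) : Continuous fun x => japanese x ^ c :=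
  continuous_japanese.rpow_const fun x => Or.inl (japanese_pos x).ne'

theorem hasDerivAt_japanese_rpow (c x : ℝ) :
    HasDerivAt (fun x => japanese x ^ c) (c * x * japanese x ^ (c - 2)) x := by
  refine ((hasDerivAt_japanese x).rpow_const (Or.inl (japanese_pos x).ne')).congr_deriv ?_
  have : japanese x ^ (c - 1) = japanese x ^ (c - 2) * japanese x := by
    rw [← Real.rpow_add_one (japanese_pos x).ne']; ring_nf
  have := (japanese_pos x).ne'
  rw [‹japanese x ^ (c - 1) = _›]; field_simp

theorem exists_integral_japanese_rpow_le {c : ℝ} (hc : c < -1) :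
    ∃ C : ℝ, 0 ≤ C ∧ ∀ L, 0 ≤ L → ∫ x in 0..L, japanese x ^ c ≤ C := by
  have hint : Integrable fun x : ℝ => japanese x ^ c := by
    have := integrable_rpow_neg_one_add_norm_sq (E := ℝ) (μ := volume) (r := -c)
      (by simp; linarith)
    refine this.congr (ae_of_all _ fun x => ?_)
    simp only [japanese, Real.sqrt_eq_rpow, Real.norm_eq_abs, sq_abs]
    rw [← Real.rpow_mul (by positivity)]
    ring_nf
  refine ⟨∫ x, japanese x ^ c, integral_nonneg fun x => (Real.rpow_pos_of_pos (japanese_pos x) _).le,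
    fun L hL => ?_⟩
  rw [intervalIntegral.integral_of_le hL]
  exact setIntegral_le_integral hint
    (ae_of_all _ fun x => (Real.rpow_pos_of_pos (japanese_pos x) _).le)

/-- Integration by parts against a primitive `W` that grows more slowly than the amplitude `h`
decays. -/
theorem exists_norm_integral_mul_deriv_le {α β : ℝ} (hαβ : α + β < 0) :
    ∃ C : ℝ, 0 ≤ C ∧ ∀ (c D L : ℝ) (h h' : ℝ → ℝ) (W W' : ℝ → ℂ), 0 ≤ c → 0 ≤ D → 0 ≤ L →
      (∀ x, HasDerivAt h (h' x) x) → (∀ x, HasDerivAt W (W' x) x) → Continuous h' →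
      Continuous W' → W 0 = 0 → (∀ x, 0 ≤ x → |h x| ≤ c * japanese x ^ α) →
      (∀ x, 0 ≤ x → |h' x| ≤ c * japanese x ^ (α - 1)) →
      (∀ x, 0 ≤ x → ‖W x‖ ≤ D * japanese x ^ β) →
      ‖∫ x in 0..L, (h x : ℂ) * W' x‖ ≤ C * (c * D) := by
  obtain ⟨C, hC0, hC⟩ := exists_integral_japanese_rpow_le (c := α + β - 1) (by linarith)
  refine ⟨1 + C, by linarith, fun c D L h h' W W' hc hD hL hd hW hh'c hW'c hW0 hb hb' hWb => ?_⟩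
  have hWc : Continuous W := continuous_iff_continuousAt.2 fun x => (hW x).continuousAt
  rw [intervalIntegral.integral_mul_deriv_eq_deriv_mul (u := fun x => (h x : ℂ))
    (u' := fun x => (h' x : ℂ)) (fun x _ => (hd x).ofReal_comp) (fun x _ => hW x)
    (by apply Continuous.intervalIntegrable; fun_prop)
    (by apply Continuous.intervalIntegrable; fun_prop), hW0, mul_zero, sub_zero]
  have hprod : ∀ x, 0 ≤ x → ∀ (z : ℝ) (γ : ℝ), |z| ≤ c * japanese x ^ γ →
      ‖(z : ℂ) * W x‖ ≤ c * D * japanese x ^ (γ + β) := by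
    intro x hx z γ hz
    rw [norm_mul, Complex.norm_real, Real.norm_eq_abs]
    calc _ ≤ (c * japanese x ^ γ) * (D * japanese x ^ β) :=
          mul_le_mul hz (hWb x hx) (norm_nonneg _) ((abs_nonneg _).trans hz)
      _ = _ := by rw [Real.rpow_add (japanese_pos x)]; ring
  have h1 : ‖(h L : ℂ) * W L‖ ≤ c * D := by
    refine (hprod L hL _ _ (hb L hL)).trans (mul_le_of_le_one_right (by positivity) ?_)
    exact Real.rpow_le_one_of_one_le_of_nonpos (one_le_japanese L) hαβ.le
  have h2 : ‖∫ x in 0..L, (h' x : ℂ) * W x‖ ≤ c * D * C := by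
    refine (intervalIntegral.norm_integral_le_of_norm_le hL
      (g := fun x => c * D * japanese x ^ (α + β - 1)) (ae_of_all _ fun x hx => ?_)
      ((continuous_japanese_rpow _).const_mul _ |>.intervalIntegrable _ _)).trans ?_
    · have := hprod x hx.1.le _ _ (hb' x hx.1.le)
      rwa [show α - 1 + β = α + β - 1 by ring] at this
    · rw [intervalIntegral.integral_const_mul]
      exact mul_le_mul_of_nonneg_left (hC L hL) (by positivity)
  calc _ ≤ c * D + c * D * C := (norm_sub_le _ _).trans (add_le_add h1 h2)
    _ = _ := by ring

/-- The radial profile of the kernel of `e^{-it⟨D⟩} ⟨D⟩^(a-3)` with the frequencies cut off at `L`,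
up to a factor `|x|`. -/
def radialProfile (a t s L : ℝ) : ℂ :=
  ∫ x in 0..L, ((x * japanese x ^ (a - 3) * Real.sin (x * s) : ℝ) : ℂ) *
    Complex.exp (Complex.I * ((-t * japanese x : ℝ) : ℂ))

theorem abs_sin_le_rpow {x θ : ℝ} (hx : 0 ≤ x) (h0 : 0 ≤ θ) (h1 : θ ≤ 1) :
    |Real.sin x| ≤ x ^ θ := by
  rcases le_total x 1 with h | h
  · calc |Real.sin x| ≤ |x| := Real.abs_sin_le_abs
      _ = x ^ (1 : ℝ) := by rw [abs_of_nonneg hx, Real.rpow_one]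
      _ ≤ x ^ θ := Real.rpow_le_rpow_of_exponent_ge' hx h h0 h1
  · exact (Real.abs_sin_le_one x).trans (Real.one_le_rpow h h0)

/-- The integral converges absolutely, by `|sin (x s)| ≤ (x s) ^ (1 - μ)`. -/
theorem exists_norm_radialProfile_le_space {a μ : ℝ} (haμ : a < μ) (hμ0 : 0 ≤ μ) (hμ : μ ≤ 1) :
    ∃ C : ℝ, 0 ≤ C ∧ ∀ t s L : ℝ, 0 < s → 0 ≤ L →
      ‖radialProfile a t s L‖ ≤ C * s ^ (1 - μ) := by
  obtain ⟨C, hC0, hC⟩ := exists_integral_japanese_rpow_le (c := a - 1 - μ) (by linarith)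
  refine ⟨C, hC0, fun t s L hs hL => ?_⟩
  refine (intervalIntegral.norm_integral_le_of_norm_le hL
      (g := fun x => s ^ (1 - μ) * japanese x ^ (a - 1 - μ)) (ae_of_all _ fun x hx => ?_)
      ((continuous_japanese_rpow _).const_mul _ |>.intervalIntegrable _ _)).trans ?_
  · have hx0 : 0 ≤ x := hx.1.le
    have hj := japanese_pos x
    have hxj : x ≤ japanese x := (le_abs_self x).trans (abs_le_japanese x)
    rw [norm_mul, mul_comm Complex.I, Complex.norm_exp_ofReal_mul_I, mul_one, Complex.norm_real,
      Real.norm_eq_abs, abs_mul, abs_mul, abs_of_nonneg hx0, abs_of_pos (Real.rpow_pos_of_pos hj _)]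
    calc _ ≤ x * japanese x ^ (a - 3) * (x * s) ^ (1 - μ) := by
          gcongr
          exact abs_sin_le_rpow (by positivity) (by linarith) (by linarith)
      _ ≤ japanese x * japanese x ^ (a - 3) * (japanese x * s) ^ (1 - μ) := by
          have : 0 ≤ 1 - μ := by linarith
          gcongr
      _ = _ := by
          rw [Real.mul_rpow hj.le hs.le, show a - 1 - μ = 1 + (a - 3) + (1 - μ) by ring,
            Real.rpow_add hj, Real.rpow_add hj, Real.rpow_one]
          ring
  · rw [intervalIntegral.integral_const_mul, mul_comm]
    exact mul_le_mul_of_nonneg_right (hC L hL) (by positivity)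

theorem le_rpow_mul_rpow {z P Q θ : ℝ} (hz : 0 ≤ z) (hP : z ≤ P) (hQ : z ≤ Q) (h0 : 0 ≤ θ)
    (h1 : θ ≤ 1) : z ≤ P ^ θ * Q ^ (1 - θ) := by
  rcases hz.eq_or_lt with rfl | hz'
  · positivity
  calc z = z ^ θ * z ^ (1 - θ) := by rw [← Real.rpow_add hz']; simp
    _ ≤ _ := by
      have : 0 ≤ 1 - θ := by linarith
      have : 0 ≤ P := hz.trans hP
      gcongr

/-- One integration by parts against the primitive of `e^{-it⟨x⟩} x / ⟨x⟩`, which is bounded by a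
geometric mean of `2 / |t|` and `⟨x⟩`. -/
theorem exists_norm_radialProfile_le_time {a κ : ℝ} (ha0 : 0 < a) (haκ : a < κ) (hκ : κ ≤ 1) :
    ∃ C : ℝ, 0 ≤ C ∧ ∀ t s L : ℝ, t ≠ 0 → 0 < s → 0 ≤ L →
      ‖radialProfile a t s L‖ ≤ C * (s * |t| ^ (-κ)) := by
  obtain ⟨C, hC0, hC⟩ := exists_norm_integral_mul_deriv_le (α := a - 1) (β := 1 - κ) (by linarith)
  refine ⟨C * 6, by positivity, fun t s L ht hs hL => ?_⟩
  have htC : (-Complex.I * t : ℂ) ≠ 0 := by simp [ht]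
  have key := hC (3 * s) (2 * |t| ^ (-κ)) L (fun x => japanese x ^ (a - 2) * Real.sin (x * s))
    (fun x => (a - 2) * x * japanese x ^ (a - 2 - 2) * Real.sin (x * s) +
      japanese x ^ (a - 2) * (Real.cos (x * s) * s))
    (fun x => (Complex.exp (Complex.I * ((-t * japanese x : ℝ) : ℂ)) -
      Complex.exp (Complex.I * ((-t : ℝ) : ℂ))) / (-Complex.I * t))
    (fun x => Complex.exp (Complex.I * ((-t * japanese x : ℝ) : ℂ)) * ((x / japanese x : ℝ) : ℂ))
    (by positivity) (by positivity) hL ?_ ?_ ?_ ?_ ?_ ?_ ?_ ?_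
  · calc _ = ‖∫ x in 0..L, ((japanese x ^ (a - 2) * Real.sin (x * s) : ℝ) : ℂ) *
          (Complex.exp (Complex.I * ((-t * japanese x : ℝ) : ℂ)) * ((x / japanese x : ℝ) : ℂ))‖ := by
          rw [radialProfile]
          congr 1
          refine intervalIntegral.integral_congr fun x _ => ?_
          have hj := japanese_pos x
          have : x * japanese x ^ (a - 3) * Real.sin (x * s) =
              japanese x ^ (a - 2) * Real.sin (x * s) * (x / japanese x) := by
            rw [show a - 2 = (a - 3) + 1 by ring, Real.rpow_add_one hj.ne']; field_simp
          simp only [this]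
          push_cast; ring
      _ ≤ _ := key
      _ = _ := by ring
  · intro x
    exact (hasDerivAt_japanese_rpow (a - 2) x).mul (((hasDerivAt_id x).mul_const s).sin.congr_deriv
      (by simp))
  · intro x
    have hj : HasDerivAt (fun x => ((-t * japanese x : ℝ) : ℂ)) ((-t * (x / japanese x) : ℝ) : ℂ) x :=
      ((hasDerivAt_japanese x).const_mul (-t)).ofReal_comp
    refine (((hj.const_mul Complex.I).cexp.sub_const _).div_const _).congr_deriv ?_
    rw [div_eq_iff htC]; push_cast; ring
  · have := continuous_japanese_rpow (a - 2)
    have := continuous_japanese_rpow (a - 2 - 2)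
    fun_prop
  · have : Continuous fun x => x / japanese x :=
      continuous_id.div continuous_japanese fun x => (japanese_pos x).ne'
    fun_prop
  · simp [japanese]
  · intro x hx
    have hj := japanese_pos x
    have hxj : x ≤ japanese x := (le_abs_self x).trans (abs_le_japanese x)
    rw [abs_mul, abs_of_pos (Real.rpow_pos_of_pos hj _)]
    calc _ ≤ japanese x ^ (a - 2) * (japanese x * s) := by
          gcongr
          calc _ ≤ |x * s| := Real.abs_sin_le_abs
            _ = x * s := abs_of_nonneg (by positivity)
            _ ≤ _ := by gcongr
      _ = 1 * s * japanese x ^ (a - 1) := by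
          rw [show a - 1 = a - 2 + 1 by ring, Real.rpow_add_one hj.ne']; ring
      _ ≤ _ := by gcongr; norm_num
  · intro x hx
    have hj := japanese_pos x
    have hxj : x ≤ japanese x := (le_abs_self x).trans (abs_le_japanese x)
    have h1 : |(a - 2) * x * japanese x ^ (a - 2 - 2) * Real.sin (x * s)| ≤
        2 * s * japanese x ^ (a - 1 - 1) := by
      rw [abs_mul, abs_mul, abs_mul, abs_of_nonneg hx, abs_of_pos (Real.rpow_pos_of_pos hj _)]
      calc _ ≤ 2 * japanese x * japanese x ^ (a - 2 - 2) * (japanese x * s) := by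
            gcongr
            · rw [abs_le]; constructor <;> linarith
            · calc _ ≤ |x * s| := Real.abs_sin_le_abs
                _ = x * s := abs_of_nonneg (by positivity)
                _ ≤ _ := by gcongr
        _ = _ := by
          rw [show a - 1 - 1 = a - 2 - 2 + 1 + 1 by ring, Real.rpow_add_one hj.ne',
            Real.rpow_add_one hj.ne']
          ring
    have h2 : |japanese x ^ (a - 2) * (Real.cos (x * s) * s)| ≤ s * japanese x ^ (a - 1 - 1) := by
      rw [abs_mul, abs_mul, abs_of_pos (Real.rpow_pos_of_pos hj _), abs_of_pos hs,
        show a - 1 - 1 = a - 2 by ring]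
      calc _ ≤ japanese x ^ (a - 2) * (1 * s) := by gcongr; exact Real.abs_cos_le_one _
        _ = _ := by ring
    calc _ ≤ _ := abs_add_le _ _
      _ ≤ _ := add_le_add h1 h2
      _ = _ := by ring
  · intro x hx
    have hj := japanese_pos x
    have ht' : 0 < |t| := abs_pos.2 ht
    have hn : ‖(-Complex.I * t : ℂ)‖ = |t| := by simp
    rw [norm_div, hn]
    set z := ‖Complex.exp (Complex.I * ((-t * japanese x : ℝ) : ℂ)) -
      Complex.exp (Complex.I * ((-t : ℝ) : ℂ))‖ with hz
    have hz2 : z ≤ 2 := by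
      refine (norm_sub_le _ _).trans ?_
      rw [mul_comm, Complex.norm_exp_ofReal_mul_I, mul_comm, Complex.norm_exp_ofReal_mul_I]
      norm_num
    have hz1 : z ≤ |t| * japanese x := by
      have : z = ‖Complex.exp (Complex.I * ((-t * (japanese x - 1) : ℝ) : ℂ)) - 1‖ := by
        calc z = ‖(Complex.exp (Complex.I * ((-t * (japanese x - 1) : ℝ) : ℂ)) - 1) *
              Complex.exp (Complex.I * ((-t : ℝ) : ℂ))‖ := by
              rw [hz, sub_mul, ← Complex.exp_add, one_mul]
              congr 3; push_cast; ring
          _ = _ := by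
              rw [norm_mul, mul_comm Complex.I ((-t : ℝ) : ℂ), Complex.norm_exp_ofReal_mul_I,
                mul_one]
      rw [this]
      refine (Real.norm_exp_I_mul_ofReal_sub_one_le).trans ?_
      rw [norm_mul, norm_neg, Real.norm_eq_abs, Real.norm_eq_abs]
      gcongr
      rw [abs_of_nonneg (by linarith [one_le_japanese x])]
      linarith
    have := le_rpow_mul_rpow (z := z / |t|) (by positivity) (P := 2 / |t|) (Q := japanese x) (θ := κ)
      (by gcongr) (by rw [div_le_iff₀ ht']; linarith) (by linarith) hκ
    refine this.trans ?_
    gcongr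
    rw [Real.div_rpow zero_le_two ht'.le, Real.rpow_neg ht'.le, div_eq_mul_inv]
    gcongr
    calc (2 : ℝ) ^ κ ≤ 2 ^ (1 : ℝ) := Real.rpow_le_rpow_of_exponent_le (by norm_num) hκ
      _ = 2 := Real.rpow_one 2

/-- The second derivative `⟨x⟩^(-3)` of `⟨x⟩` is at least `⟨L⟩^(-3)` on `[0, L]`. -/
theorem norm_integral_exp_japanese_le {t s L : ℝ} (ht : t ≠ 0) (hL : 0 ≤ L) :
    ‖∫ x in 0..L, Complex.exp (Complex.I * ((s * x - t * japanese x : ℝ) : ℂ))‖ ≤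
      (1 + 2 * Real.pi) * (japanese L ^ (3 / 2 : ℝ) * |t| ^ (-(1 / 2) : ℝ)) := by
  -- the case of a convex phase
  have pos : ∀ t s : ℝ, t < 0 →
      ‖∫ x in 0..L, Complex.exp (Complex.I * ((s * x - t * japanese x : ℝ) : ℂ))‖ ≤
      (1 + 2 * Real.pi) * (japanese L ^ (3 / 2 : ℝ) * |t| ^ (-(1 / 2) : ℝ)) := by
    intro t s ht
    have ht' : 0 < |t| := abs_pos.2 ht.ne
    have hjL := japanese_pos L
    have h2 : ∀ x : ℝ, HasDerivAt (fun x => x / japanese x) (japanese x ^ (-3 : ℝ)) x := by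
      intro x
      have hj := japanese_pos x
      refine ((hasDerivAt_id x).div (hasDerivAt_japanese x) hj.ne').congr_deriv ?_
      have : japanese x ^ (-3 : ℝ) = (japanese x ^ 3)⁻¹ := by
        rw [Real.rpow_neg hj.le]; norm_cast
      have h2 := japanese_sq x
      rw [this]
      simp only [id]
      field_simp
      linarith
    have := norm_integral_exp_phase_le hL (m := |t| * japanese L ^ (-3 : ℝ)) (by positivity)
      (φ := fun x => s * x - t * japanese x) (φ' := fun x => s - t * (x / japanese x))
      (φ'' := fun x => -t * japanese x ^ (-3 : ℝ))
      (fun x => (((hasDerivAt_id x).const_mul s).sub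
        ((hasDerivAt_japanese x).const_mul t)).congr_deriv (by ring))
      (fun x => (((h2 x).const_mul t).const_sub s).congr_deriv (by ring))
      (by have := continuous_japanese_rpow (-3); fun_prop)
      (fun x hx => by
        have hjx := japanese_pos x
        rw [abs_of_neg ht]
        have : japanese x ≤ japanese L := by
          unfold japanese; gcongr; exacts [hx.1, hx.2]
        have ht2 : 0 ≤ -t := by linarith
        exact mul_le_mul_of_nonneg_left
          (Real.rpow_le_rpow_of_nonpos hjx this (by norm_num)) ht2)
    refine this.trans (le_of_eq ?_)
    rw [div_eq_mul_inv, Real.sqrt_eq_rpow, Real.mul_rpow ht'.le (by positivity),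
      ← Real.rpow_mul hjL.le, mul_inv, ← Real.rpow_neg ht'.le, ← Real.rpow_neg hjL.le]
    norm_num
    left; ring
  rcases lt_or_gt_of_ne ht with h | h
  · exact pos t s h
  · have := pos (-t) (-s) (by linarith)
    rw [abs_neg] at this
    rw [← RCLike.norm_conj, ← intervalIntegral.intervalIntegral_conj]
    refine (le_of_eq ?_).trans this
    congr 1
    refine intervalIntegral.integral_congr fun x _ => ?_
    rw [← Complex.exp_conj]
    simp
    ring_nf

/-- The curvature of the mass shell gives some decay in time, uniformly in `s`: van der Corput's test
is interpolated with the trivial bound just so far that the growth in `x` stays integrable. -/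
theorem exists_norm_radialProfile_le_decay {a ε : ℝ} (ha0 : 0 < a) (hε0 : 0 < ε) (hε : ε ≤ 1 / 2)
    (haε : a + ε < 1) :
    ∃ C : ℝ, 0 ≤ C ∧ ∀ t s L : ℝ, t ≠ 0 → 0 ≤ L →
      ‖radialProfile a t s L‖ ≤ C * |t| ^ (-ε) := by
  obtain ⟨C, hC0, hC⟩ := exists_norm_integral_mul_deriv_le (α := a - 2) (β := 1 + ε) (by linarith)
  have hpi := Real.pi_pos
  refine ⟨C * (4 * (1 + 2 * Real.pi)), by positivity, fun t s L ht hL => ?_⟩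
  have ht' : 0 < |t| := abs_pos.2 ht
  have hexp : ∀ s, ‖∫ x in 0..L, ((x * japanese x ^ (a - 3) : ℝ) : ℂ) *
      Complex.exp (Complex.I * ((s * x - t * japanese x : ℝ) : ℂ))‖ ≤
      C * (4 * ((1 + 2 * Real.pi) * |t| ^ (-ε))) := by
    intro s
    have hcont : Continuous fun x : ℝ =>
        Complex.exp (Complex.I * ((s * x - t * japanese x : ℝ) : ℂ)) := by fun_prop
    refine hC 4 ((1 + 2 * Real.pi) * |t| ^ (-ε)) L (fun x => x * japanese x ^ (a - 3))
      (fun x => 1 * japanese x ^ (a - 3) + x * ((a - 3) * x * japanese x ^ (a - 3 - 2)))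
      (fun y => ∫ x in 0..y, Complex.exp (Complex.I * ((s * x - t * japanese x : ℝ) : ℂ)))
      (fun x => Complex.exp (Complex.I * ((s * x - t * japanese x : ℝ) : ℂ)))
      (by positivity) (by positivity) hL ?_ ?_ ?_ hcont ?_ ?_ ?_ ?_
    · exact fun x => (hasDerivAt_id x).mul (hasDerivAt_japanese_rpow (a - 3) x)
    · exact fun x => intervalIntegral.integral_hasDerivAt_right (hcont.intervalIntegrable _ _)
        (hcont.stronglyMeasurableAtFilter _ _) hcont.continuousAt
    · have := continuous_japanese_rpow (a - 3)
      have := continuous_japanese_rpow (a - 3 - 2)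
      fun_prop
    · simp
    · intro x hx
      have hj := japanese_pos x
      have hxj := abs_le_japanese x
      rw [abs_mul, abs_of_pos (Real.rpow_pos_of_pos hj _)]
      calc _ ≤ japanese x * japanese x ^ (a - 3) := by gcongr
        _ = 1 * japanese x ^ (a - 2) := by
          rw [show a - 2 = a - 3 + 1 by ring, Real.rpow_add_one hj.ne']; ring
        _ ≤ _ := by gcongr; norm_num
    · intro x hx
      have hj := japanese_pos x
      have hxj := abs_le_japanese x
      have h1 : |x * ((a - 3) * x * japanese x ^ (a - 3 - 2))| ≤ 3 * japanese x ^ (a - 3) := by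
        rw [abs_mul, abs_mul, abs_mul, abs_of_pos (Real.rpow_pos_of_pos hj _)]
        calc _ ≤ japanese x * (3 * japanese x * japanese x ^ (a - 3 - 2)) := by
              gcongr
              rw [abs_le]; constructor <;> linarith
          _ = 3 * japanese x ^ (a - 3 - 2 + 1 + 1) := by
              rw [Real.rpow_add_one hj.ne', Real.rpow_add_one hj.ne']; ring
          _ = _ := by ring_nf
      calc _ ≤ |1 * japanese x ^ (a - 3)| + _ := abs_add_le _ _
        _ ≤ japanese x ^ (a - 3) + 3 * japanese x ^ (a - 3) := by
            rw [one_mul, abs_of_pos (Real.rpow_pos_of_pos hj _)]; gcongr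
        _ = 4 * japanese x ^ (a - 2 - 1) := by
            rw [show a - 2 - 1 = a - 3 by ring]; ring
    · intro x hx
      have hj := japanese_pos x
      set z := ‖∫ x in 0..x, Complex.exp (Complex.I * ((s * x - t * japanese x : ℝ) : ℂ))‖ with hz
      have hz1 : z ≤ (1 + 2 * Real.pi) * japanese x := by
        have : z ≤ 1 * |x - 0| := intervalIntegral.norm_integral_le_of_norm_le_const fun x _ => by
          rw [mul_comm, Complex.norm_exp_ofReal_mul_I]
        rw [sub_zero] at this
        have := abs_le_japanese x
        nlinarith
      have hz2 : z ≤ (1 + 2 * Real.pi) * (japanese x ^ (3 / 2 : ℝ) * |t| ^ (-(1 / 2) : ℝ)) :=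
        norm_integral_exp_japanese_le ht hx
      refine (le_rpow_mul_rpow (norm_nonneg _) hz2 hz1 (θ := 2 * ε) (by linarith)
        (by linarith)).trans (le_of_eq ?_)
      have h2π : 0 < 1 + 2 * Real.pi := by positivity
      rw [Real.mul_rpow h2π.le (by positivity), Real.mul_rpow h2π.le (by positivity),
        Real.mul_rpow (by positivity) (by positivity), ← Real.rpow_mul hj.le,
        ← Real.rpow_mul ht'.le]
      calc _ = ((1 + 2 * Real.pi) ^ (2 * ε) * (1 + 2 * Real.pi) ^ (1 - 2 * ε)) *
            |t| ^ (-(1 / 2) * (2 * ε)) *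
            (japanese x ^ (3 / 2 * (2 * ε)) * japanese x ^ (1 - 2 * ε)) := by ring
        _ = _ := by
            rw [← Real.rpow_add h2π, ← Real.rpow_add hj]
            ring_nf
            simp
            ring_nf
  have hsin : radialProfile a t s L = (Complex.I / 2) *
      ((∫ x in 0..L, ((x * japanese x ^ (a - 3) : ℝ) : ℂ) *
        Complex.exp (Complex.I * ((-s * x - t * japanese x : ℝ) : ℂ))) -
      ∫ x in 0..L, ((x * japanese x ^ (a - 3) : ℝ) : ℂ) *
        Complex.exp (Complex.I * ((s * x - t * japanese x : ℝ) : ℂ))) := by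
    have hc := continuous_japanese_rpow (a - 3)
    rw [← intervalIntegral.integral_sub (by apply Continuous.intervalIntegrable; fun_prop)
      (by apply Continuous.intervalIntegrable; fun_prop), ← intervalIntegral.integral_const_mul,
      radialProfile]
    refine intervalIntegral.integral_congr fun x _ => ?_
    have e1 : ∀ s : ℝ, Complex.exp (Complex.I * ((s * x - t * japanese x : ℝ) : ℂ)) =
        Complex.exp ((x * s : ℂ) * Complex.I) * Complex.exp (Complex.I * ((-t * japanese x : ℝ) : ℂ)) := by
      intro s
      rw [← Complex.exp_add]; congr 1; push_cast; ring
    simp only [e1]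
    push_cast
    rw [Complex.sin]
    rw [show -((x : ℂ) * s) * Complex.I = (x : ℂ) * -s * Complex.I by ring]
    ring
  rw [hsin, norm_mul]
  have hI : ‖Complex.I / 2‖ = 1 / 2 := by simp
  rw [hI]
  calc _ ≤ 1 / 2 * (C * (4 * ((1 + 2 * Real.pi) * |t| ^ (-ε))) +
        C * (4 * ((1 + 2 * Real.pi) * |t| ^ (-ε)))) := by
        gcongr
        exact (norm_sub_le _ _).trans (add_le_add (hexp (-s)) (hexp s))
    _ = _ := by ring

/-! ### Fourier integrals of radial functions on `ℝ³` -/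

/-- Slicing of `ℝ³` into planes orthogonal to the first coordinate axis. -/
theorem exists_measurePreserving_slicing :
    ∃ e : ℝ × EuclideanSpace ℝ (Fin 2) ≃ᵐ Space, MeasurePreserving e ∧
      (∀ z w, e (z, w) 0 = z) ∧ ∀ z w, ‖e (z, w)‖ = √(z ^ 2 + ‖w‖ ^ 2) := by
  refine ⟨((MeasurableEquiv.refl ℝ).prodCongr (MeasurableEquiv.toLp 2 (Fin 2 → ℝ)).symm).trans
    ((MeasurableEquiv.piFinSuccAbove (fun _ : Fin 3 => ℝ) 0).symm.trans
      (MeasurableEquiv.toLp 2 (Fin 3 → ℝ))), ?_, fun z w => rfl, fun z w => ?_⟩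
  · refine (PiLp.volume_preserving_toLp (Fin 3)).comp
      (((volume_preserving_piFinSuccAbove (fun _ : Fin 3 => ℝ) 0).symm).comp ?_)
    exact (MeasurePreserving.id volume).prod
      (EuclideanSpace.volume_preserving_symm_measurableEquiv_toLp (Fin 2))
  · rw [EuclideanSpace.norm_eq, EuclideanSpace.norm_eq, Real.sq_sqrt (by positivity),
      Fin.sum_univ_succ]
    simp only [Real.norm_eq_abs, sq_abs]
    rfl

/-- The substitution of `√(z ^ 2 + r ^ 2)` for the radius `r` in a plane at distance `|z|` from the
origin. -/
theorem integral_plane_radial {F : ℝ → ℂ} (hF : Continuous F) (z R : ℝ) :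
    ∫ w : EuclideanSpace ℝ (Fin 2),
        (if √(z ^ 2 + ‖w‖ ^ 2) ≤ R then F (√(z ^ 2 + ‖w‖ ^ 2)) else 0) =
      if |z| ≤ R then 2 * Real.pi * ∫ x in |z|..R, x * F x else 0 := by
  have hpol := integral_fun_norm_addHaar (volume : Measure (EuclideanSpace ℝ (Fin 2)))
    (fun r => if √(z ^ 2 + r ^ 2) ≤ R then F (√(z ^ 2 + r ^ 2)) else 0)
  rw [hpol]
  have hvol : (volume : Measure (EuclideanSpace ℝ (Fin 2))).real (Metric.ball 0 1) = Real.pi := by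
    rw [Measure.real, EuclideanSpace.volume_ball_fin_two]
    simp [Real.pi_pos.le]
  rw [hvol]
  simp only [finrank_euclideanSpace, Fintype.card_fin, Nat.add_one_sub_one, pow_one]
  have hzs : ∀ r, |z| ≤ √(z ^ 2 + r ^ 2) := fun r => Real.abs_le_sqrt (by nlinarith [sq_nonneg r])
  split_ifs with h
  · have hR : 0 ≤ R := (abs_nonneg z).trans h
    have hzR : z ^ 2 ≤ R ^ 2 := sq_le_sq' (by linarith [neg_abs_le z]) ((le_abs_self z).trans h)
    set r₀ := √(R ^ 2 - z ^ 2) with hr₀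
    have hr₀0 : 0 ≤ r₀ := Real.sqrt_nonneg _
    have hiff : ∀ r, 0 < r → (√(z ^ 2 + r ^ 2) ≤ R ↔ r ≤ r₀) := fun r hr => by
      rw [Real.sqrt_le_left hR, hr₀, Real.le_sqrt hr.le (by linarith)]
      constructor <;> intro h <;> linarith
    have h1 : ∫ r in Set.Ioi (0 : ℝ), r • (if √(z ^ 2 + r ^ 2) ≤ R then F (√(z ^ 2 + r ^ 2)) else 0)
        = ∫ r in (0 : ℝ)..r₀, (r : ℂ) * F (√(z ^ 2 + r ^ 2)) := by
      rw [intervalIntegral.integral_of_le hr₀0, ← integral_indicator measurableSet_Ioi,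
        ← integral_indicator measurableSet_Ioc]
      congr 1
      ext r
      by_cases hr : 0 < r
      · by_cases hr' : r ≤ r₀
        · rw [Set.indicator_of_mem (show r ∈ Set.Ioi 0 from hr),
            Set.indicator_of_mem (show r ∈ Set.Ioc 0 r₀ from ⟨hr, hr'⟩), if_pos ((hiff r hr).2 hr')]
          exact Complex.real_smul
        · rw [Set.indicator_of_mem (show r ∈ Set.Ioi 0 from hr),
            Set.indicator_of_notMem (show r ∉ Set.Ioc 0 r₀ from fun h => hr' h.2),
            if_neg (fun h => hr' ((hiff r hr).1 h)), smul_zero]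
      · rw [Set.indicator_of_notMem (show r ∉ Set.Ioi 0 from hr),
            Set.indicator_of_notMem (show r ∉ Set.Ioc 0 r₀ from fun h => hr h.1)]
    have hxF : Continuous fun x : ℝ => (x : ℂ) * F x := by fun_prop
    have h2 : ∫ r in (0 : ℝ)..r₀, (r : ℂ) * F (√(z ^ 2 + r ^ 2)) = ∫ x in |z|..R, x * F x := by
      have hQ : ∀ y, HasDerivAt (fun y => ∫ x in (0 : ℝ)..y, (x : ℂ) * F x) (y * F y) y := fun y =>
        intervalIntegral.integral_hasDerivAt_right (hxF.intervalIntegrable _ _)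
          (hxF.stronglyMeasurableAtFilter _ _) hxF.continuousAt
      have hQc : Continuous fun y => ∫ x in (0 : ℝ)..y, (x : ℂ) * F x :=
        continuous_iff_continuousAt.2 fun y => (hQ y).continuousAt
      rw [intervalIntegral.integral_eq_sub_of_hasDerivAt_of_le hr₀0
        (f := fun r => ∫ x in (0 : ℝ)..√(z ^ 2 + r ^ 2), (x : ℂ) * F x)]
      · rw [hr₀, Real.sq_sqrt (by linarith)]
        have e1 : √(z ^ 2 + (R ^ 2 - z ^ 2)) = R := by
          rw [add_sub_cancel, Real.sqrt_sq hR]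
        have e2 : √(z ^ 2 + 0 ^ 2) = |z| := by
          rw [zero_pow two_ne_zero, add_zero, Real.sqrt_sq_eq_abs]
        rw [e1, e2]
        exact intervalIntegral.integral_interval_sub_left (hxF.intervalIntegrable _ _)
          (hxF.intervalIntegrable _ _)
      · exact (hQc.comp (by fun_prop : Continuous fun r : ℝ => √(z ^ 2 + r ^ 2))).continuousOn
      · intro r hr
        have hpos : 0 < z ^ 2 + r ^ 2 := by have := hr.1; positivity
        have hs : HasDerivAt (fun r : ℝ => √(z ^ 2 + r ^ 2)) (r / √(z ^ 2 + r ^ 2)) r := by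
          have h : HasDerivAt (fun x : ℝ => z ^ 2 + x ^ 2) (2 * r) r := by
            simpa using (hasDerivAt_pow 2 r).const_add (z ^ 2)
          refine (h.sqrt hpos.ne').congr_deriv ?_
          field_simp
        refine ((hQ _).scomp r hs).congr_deriv ?_
        have : (√(z ^ 2 + r ^ 2) : ℂ) ≠ 0 := by
          exact_mod_cast (Real.sqrt_pos.2 hpos).ne'
        rw [Complex.real_smul]
        push_cast
        field_simp
      · apply Continuous.intervalIntegrable
        fun_prop
    rw [h1, h2, Complex.real_smul, nsmul_eq_mul]
    push_cast
    ring
  · have : ∀ r : ℝ, ¬ √(z ^ 2 + r ^ 2) ≤ R := fun r hr => h ((hzs r).trans hr)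
    simp [this]

/-- The Fourier transform of a radial function on `ℝ³` is a sine transform: integrate over the
planes orthogonal to `x` first, then by parts. -/
theorem setIntegral_closedBall_exp_mul_radial {F : ℝ → ℂ} (hF : Continuous F) {R : ℝ} (hR : 0 ≤ R)
    {x : Space} (hx : x ≠ 0) :
    ∫ ξ in Metric.closedBall (0 : Space) R,
        Complex.exp (Complex.I * ((2 * Real.pi * inner ℝ x ξ : ℝ) : ℂ)) * F ‖ξ‖ =
      2 / ‖x‖ * ∫ ρ in 0..R, ρ * Real.sin (2 * Real.pi * ρ * ‖x‖) * F ρ := by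
  set s := ‖x‖ with hs
  have hs0 : 0 < s := norm_pos_iff.2 hx
  set c : ℝ → ℂ := fun z => Complex.exp (Complex.I * ((2 * Real.pi * s * z : ℝ) : ℂ)) with hc
  have hcc : Continuous c := by fun_prop
  -- rotate `x` to the first coordinate axis
  set y : Space := s • EuclideanSpace.single 0 1 with hy
  have hyn : ‖y‖ = ‖x‖ := by
    simp [hy, norm_smul, hs]
  set g := (ℝ ∙ (y - x))ᗮ.reflection with hg
  have hgy : g y = x := Submodule.reflection_sub hyn
  have h1 : ∫ ξ in Metric.closedBall (0 : Space) R,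
        Complex.exp (Complex.I * ((2 * Real.pi * inner ℝ x ξ : ℝ) : ℂ)) * F ‖ξ‖ =
      ∫ ξ : Space, if ‖ξ‖ ≤ R then c (ξ 0) * F ‖ξ‖ else 0 := by
    rw [← integral_indicator Metric.isClosed_closedBall.measurableSet,
      ← (g.measurePreserving).integral_comp g.toHomeomorph.measurableEmbedding]
    congr 1
    ext ξ
    simp only [Set.indicator, mem_closedBall_zero_iff, g.norm_map]
    congr 1
    rw [← hgy, g.inner_map_map, hy, inner_smul_left, EuclideanSpace.inner_single_left]
    simp only [hc]
    simp
    left; congr 2; ring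
  obtain ⟨e, he, he0, hen⟩ := exists_measurePreserving_slicing
  have hint : Integrable fun ξ : Space => if ‖ξ‖ ≤ R then c (ξ 0) * F ‖ξ‖ else 0 := by
    have : IntegrableOn (fun ξ : Space => c (ξ 0) * F ‖ξ‖) (Metric.closedBall 0 R) :=
      (by fun_prop : Continuous fun ξ : Space => c (ξ 0) * F ‖ξ‖).continuousOn.integrableOn_compact
        (isCompact_closedBall _ _)
    rw [← integrable_indicator_iff Metric.isClosed_closedBall.measurableSet] at this
    refine this.congr (ae_of_all _ fun ξ => ?_)
    simp only [Set.indicator, mem_closedBall_zero_iff]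
  have h2 : ∫ ξ : Space, (if ‖ξ‖ ≤ R then c (ξ 0) * F ‖ξ‖ else 0) =
      ∫ z : ℝ, if |z| ≤ R then c z * (2 * Real.pi * ∫ x in |z|..R, x * F x) else 0 := by
    rw [← he.integral_comp e.measurableEmbedding]
    have hint' := (he.integrable_comp_emb e.measurableEmbedding).2 hint
    rw [Measure.volume_eq_prod]
    refine (integral_prod _ hint').trans ?_
    congr 1
    ext z
    simp only [Function.comp_apply, he0, hen]
    have : ∀ w : EuclideanSpace ℝ (Fin 2), (if √(z ^ 2 + ‖w‖ ^ 2) ≤ R then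
        c z * F (√(z ^ 2 + ‖w‖ ^ 2)) else 0) = c z * (if √(z ^ 2 + ‖w‖ ^ 2) ≤ R then
        F (√(z ^ 2 + ‖w‖ ^ 2)) else 0) := fun w => by split_ifs <;> simp
    simp_rw [this]
    rw [integral_const_mul, integral_plane_radial hF]
    split_ifs <;> simp
  have hxF : Continuous fun x : ℝ => (x : ℂ) * F x := by fun_prop
  set Q : ℝ → ℂ := fun z => ∫ x in z..R, x * F x with hQ
  have hQd : ∀ z, HasDerivAt Q (-(z * F z)) z := fun z =>
    intervalIntegral.integral_hasDerivAt_left (hxF.intervalIntegrable _ _)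
      (hxF.stronglyMeasurableAtFilter _ _) hxF.continuousAt
  have hQc : Continuous Q := continuous_iff_continuousAt.2 fun z => (hQd z).continuousAt
  have h3 : ∫ z : ℝ, (if |z| ≤ R then c z * (2 * Real.pi * ∫ x in |z|..R, x * F x) else 0) =
      ∫ z in (-R)..R, c z * (2 * Real.pi * Q |z|) := by
    rw [intervalIntegral.integral_of_le (by linarith), ← integral_Icc_eq_integral_Ioc,
      ← integral_indicator measurableSet_Icc]
    congr 1
    ext z
    simp only [Set.indicator, Set.mem_Icc, ← abs_le, hQ]
  have h4 : ∫ z in (-R)..R, c z * (2 * Real.pi * Q |z|) =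
      ∫ z in 0..R, Q z * (4 * Real.pi * Real.cos (2 * Real.pi * s * z) : ℝ) := by
    have hcont : Continuous fun z => c z * (2 * Real.pi * Q |z|) := by fun_prop
    have hcont' : Continuous fun z => c (-z) * (2 * Real.pi * Q |z|) := by fun_prop
    rw [← intervalIntegral.integral_add_adjacent_intervals (b := 0)
      (hcont.intervalIntegrable _ _) (hcont.intervalIntegrable _ _)]
    have hneg : ∫ z in (-R)..0, c z * (2 * Real.pi * Q |z|) =
        ∫ z in 0..R, c (-z) * (2 * Real.pi * Q |z|) := by
      have := intervalIntegral.integral_comp_neg (a := 0) (b := R)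
        (fun z => c z * (2 * Real.pi * Q |z|))
      rw [neg_zero] at this
      rw [← this]
      simp only [abs_neg]
    rw [hneg, ← intervalIntegral.integral_add (hcont'.intervalIntegrable _ _)
      (hcont.intervalIntegrable _ _)]
    refine intervalIntegral.integral_congr fun z hz => ?_
    rw [Set.uIcc_of_le hR] at hz
    simp only [abs_of_nonneg hz.1, hc]
    push_cast
    rw [Complex.cos]
    rw [show Complex.I * (2 * Real.pi * s * -z : ℂ) = -(2 * Real.pi * s * z : ℂ) * Complex.I by ring,
      show Complex.I * (2 * Real.pi * s * z : ℂ) = (2 * Real.pi * s * z : ℂ) * Complex.I by ring]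
    ring
  have h5 : ∫ z in 0..R, Q z * (4 * Real.pi * Real.cos (2 * Real.pi * s * z) : ℝ) =
      2 / s * ∫ ρ in 0..R, ρ * Real.sin (2 * Real.pi * ρ * s) * F ρ := by
    have hsd : ∀ z, HasDerivAt (fun z : ℝ => ((2 / s * Real.sin (2 * Real.pi * s * z) : ℝ) : ℂ))
        ((4 * Real.pi * Real.cos (2 * Real.pi * s * z) : ℝ) : ℂ) z := fun z => by
      have := (((hasDerivAt_id z).const_mul (2 * Real.pi * s)).sin.const_mul (2 / s)).ofReal_comp
      refine this.congr_deriv ?_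
      congr 1
      simp only [id]
      field_simp
      ring
    rw [intervalIntegral.integral_mul_deriv_eq_deriv_mul (u' := fun z => -(z * F z))
      (v := fun z : ℝ => ((2 / s * Real.sin (2 * Real.pi * s * z) : ℝ) : ℂ))
      (fun z _ => hQd z) (fun z _ => hsd z) (hxF.neg.intervalIntegrable _ _)
      (by apply Continuous.intervalIntegrable; fun_prop)]
    have : Q R = 0 := intervalIntegral.integral_same
    rw [this, mul_zero, Real.sin_zero, mul_zero, Complex.ofReal_zero, mul_zero, zero_mul, sub_zero,
      zero_sub, ← intervalIntegral.integral_neg, ← intervalIntegral.integral_const_mul]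
    refine intervalIntegral.integral_congr fun z _ => ?_
    rw [show 2 * Real.pi * z * s = 2 * Real.pi * s * z by ring]
    push_cast
    ring
  rw [h1, h2, h3, h4, h5]

/-- The kernel of `e^{-it⟨D⟩} ⟨D⟩^(a-3)` on `ℝ³` with the frequencies cut off at `R`. -/
def kleinGordonKernel (a R t : ℝ) (x : Space) : ℂ :=
  ∫ ξ in Metric.closedBall (0 : Space) R,
    Complex.exp (Complex.I * ((2 * Real.pi * inner ℝ x ξ : ℝ) : ℂ)) *
      (Complex.exp (Complex.I * ((-t * japanese (2 * Real.pi * ‖ξ‖) : ℝ) : ℂ)) *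
        ((japanese (2 * Real.pi * ‖ξ‖) ^ (a - 3) : ℝ) : ℂ))

theorem kleinGordonKernel_eq (a t : ℝ) {R : ℝ} (hR : 0 ≤ R) {x : Space} (hx : x ≠ 0) :
    kleinGordonKernel a R t x =
      1 / (2 * Real.pi ^ 2 * ‖x‖) * radialProfile a t ‖x‖ (2 * Real.pi * R) := by
  have hj := continuous_japanese_rpow (a - 3)
  have := setIntegral_closedBall_exp_mul_radial
    (F := fun ρ => Complex.exp (Complex.I * ((-t * japanese (2 * Real.pi * ρ) : ℝ) : ℂ)) *
        ((japanese (2 * Real.pi * ρ) ^ (a - 3) : ℝ) : ℂ)) (by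
      have : Continuous fun ρ => japanese (2 * Real.pi * ρ) ^ (a - 3) :=
        hj.comp (by fun_prop : Continuous fun ρ : ℝ => 2 * Real.pi * ρ)
      fun_prop) hR hx
  rw [kleinGordonKernel, this, radialProfile]
  have hπ : (2 * Real.pi : ℝ) ≠ 0 := by positivity
  have hsub := intervalIntegral.integral_comp_mul_left (a := 0) (b := R)
    (fun y : ℝ => ((y * japanese y ^ (a - 3) * Real.sin (y * ‖x‖) : ℝ) : ℂ) *
    Complex.exp (Complex.I * ((-t * japanese y : ℝ) : ℂ))) hπ
  rw [mul_zero, Complex.real_smul] at hsub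
  have hπC : (Real.pi : ℂ) ≠ 0 := by exact_mod_cast Real.pi_ne_zero
  have hx' : (‖x‖ : ℂ) ≠ 0 := by exact_mod_cast (norm_pos_iff.2 hx).ne'
  set P := ∫ (y : ℝ) in 0..2 * Real.pi * R,
    ((y * japanese y ^ (a - 3) * Real.sin (y * ‖x‖) : ℝ) : ℂ) *
      Complex.exp (Complex.I * ((-t * japanese y : ℝ) : ℂ))
  have hsub' : (2 * Real.pi : ℂ) * ∫ ρ in 0..R, ρ * Real.sin (2 * Real.pi * ρ * ‖x‖) *
      (Complex.exp (Complex.I * ((-t * japanese (2 * Real.pi * ρ) : ℝ) : ℂ)) *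
        ((japanese (2 * Real.pi * ρ) ^ (a - 3) : ℝ) : ℂ)) =
        (((2 * Real.pi)⁻¹ : ℝ) : ℂ) * P := by
    rw [← intervalIntegral.integral_const_mul]
    exact (intervalIntegral.integral_congr fun ρ _ => by push_cast; ring).trans hsub
  rw [← eq_inv_mul_iff_mul_eq₀ (by simp [hπC])] at hsub'
  rw [hsub']
  push_cast
  field_simp

theorem norm_kleinGordonKernel_le (a t : ℝ) {R : ℝ} (hR : 0 ≤ R) {x : Space} (hx : x ≠ 0) :
    ‖kleinGordonKernel a R t x‖ ≤ ‖x‖⁻¹ * ‖radialProfile a t ‖x‖ (2 * Real.pi * R)‖ := by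
  have hs : 0 < ‖x‖ := norm_pos_iff.2 hx
  have hπ := Real.pi_gt_three
  rw [kleinGordonKernel_eq a t hR hx, norm_mul]
  have h1 : (1 / (2 * Real.pi ^ 2 * ‖x‖) : ℂ) = ((1 / (2 * Real.pi ^ 2 * ‖x‖) : ℝ) : ℂ) := by
    push_cast; rfl
  rw [h1, Complex.norm_real, Real.norm_of_nonneg (by positivity)]
  gcongr
  rw [← one_div]
  gcongr
  exact le_mul_of_one_le_left hs.le (by nlinarith)

theorem exists_norm_kleinGordonKernel_le_space {a μ : ℝ} (ha0 : 0 < a) (haμ : a < μ) (hμ : μ ≤ 1) :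
    ∃ C : ℝ, 0 ≤ C ∧ ∀ (R t : ℝ) (x : Space), 0 ≤ R → x ≠ 0 →
      ‖kleinGordonKernel a R t x‖ ≤ C * ‖x‖ ^ (-μ) := by
  obtain ⟨C, hC0, hC⟩ := exists_norm_radialProfile_le_space haμ (ha0.trans haμ).le hμ
  refine ⟨C, hC0, fun R t x hR hx => ?_⟩
  have hs : 0 < ‖x‖ := norm_pos_iff.2 hx
  calc _ ≤ ‖x‖⁻¹ * (C * ‖x‖ ^ (1 - μ)) := by
        refine (norm_kleinGordonKernel_le a t hR hx).trans ?_
        gcongr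
        exact hC t ‖x‖ _ hs (by positivity)
    _ = _ := by
      rw [show 1 - μ = -μ + 1 by ring, Real.rpow_add_one hs.ne']; field_simp

theorem exists_norm_kleinGordonKernel_le_time {a κ : ℝ} (ha0 : 0 < a) (haκ : a < κ) (hκ : κ ≤ 1) :
    ∃ C : ℝ, 0 ≤ C ∧ ∀ (R t : ℝ) (x : Space), 0 ≤ R → t ≠ 0 → x ≠ 0 →
      ‖kleinGordonKernel a R t x‖ ≤ C * |t| ^ (-κ) := by
  obtain ⟨C, hC0, hC⟩ := exists_norm_radialProfile_le_time ha0 haκ hκ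
  refine ⟨C, hC0, fun R t x hR ht hx => ?_⟩
  have hs : 0 < ‖x‖ := norm_pos_iff.2 hx
  calc _ ≤ ‖x‖⁻¹ * (C * (‖x‖ * |t| ^ (-κ))) := by
        refine (norm_kleinGordonKernel_le a t hR hx).trans ?_
        gcongr
        exact hC t ‖x‖ _ ht hs (by positivity)
    _ = _ := by field_simp

theorem exists_norm_kleinGordonKernel_le_decay {a ε : ℝ} (ha0 : 0 < a) (hε0 : 0 < ε)
    (hε : ε ≤ 1 / 2) (haε : a + ε < 1) :
    ∃ C : ℝ, 0 ≤ C ∧ ∀ (R t : ℝ) (x : Space), 0 ≤ R → t ≠ 0 → x ≠ 0 →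
      ‖kleinGordonKernel a R t x‖ ≤ C * (‖x‖⁻¹ * |t| ^ (-ε)) := by
  obtain ⟨C, hC0, hC⟩ := exists_norm_radialProfile_le_decay ha0 hε0 hε haε
  refine ⟨C, hC0, fun R t x hR ht hx => ?_⟩
  have hs : 0 < ‖x‖ := norm_pos_iff.2 hx
  calc _ ≤ ‖x‖⁻¹ * (C * |t| ^ (-ε)) := by
        refine (norm_kleinGordonKernel_le a t hR hx).trans ?_
        gcongr
        exact hC t ‖x‖ _ ht (by positivity)
    _ = _ := by ring

/-! ### Power weights as amalgam kernels -/

section PowerWeight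

variable {E : Type*} [NormedAddCommGroup E]

/-- The weight that is `‖x‖ ^ (-α)` near the origin and `‖x‖ ^ (-γ)` away from it. -/
def powerWeight (α γ : ℝ) (x : E) : ℝ≥0∞ :=
  if ‖x‖ ≤ 1 then ‖x‖ₑ ^ (-α) else ‖x‖ₑ ^ (-γ)

theorem powerWeight_neg (α γ : ℝ) (x : E) : powerWeight α γ (-x) = powerWeight α γ x := by
  simp [powerWeight]

theorem measurable_powerWeight [MeasurableSpace E] [BorelSpace E] (α γ : ℝ) :
    Measurable (powerWeight α γ : E → ℝ≥0∞) := by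
  unfold powerWeight
  refine Measurable.ite (measurableSet_le (by fun_prop) (by fun_prop)) ?_ ?_ <;>
  fun_prop

theorem enorm_rpow_neg {x : E} (hx : x ≠ 0) (α : ℝ) :
    ‖x‖ₑ ^ (-α) = ENNReal.ofReal (‖x‖ ^ (-α)) := by
  rw [← ofReal_norm, ENNReal.ofReal_rpow_of_pos (norm_pos_iff.2 hx)]

theorem powerWeight_ne_zero {α γ : ℝ} (hα : 0 ≤ α) (hγ : 0 ≤ γ) (x : E) :
    powerWeight α γ x ≠ 0 := by
  unfold powerWeight
  split_ifs <;> simp [ENNReal.rpow_eq_zero_iff, hα.not_gt, hγ.not_gt]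

theorem one_le_powerWeight {α γ : ℝ} (hα : 0 ≤ α) {x : E} (hx : ‖x‖ ≤ 1) :
    1 ≤ powerWeight α γ x := by
  rw [powerWeight, if_pos hx, ENNReal.rpow_neg, ENNReal.one_le_inv]
  refine ENNReal.rpow_le_one ?_ hα
  rw [← ofReal_norm]
  exact ENNReal.ofReal_le_one.2 hx

theorem powerWeight_le_one {γ : ℝ} (hγ : 0 ≤ γ) {x : E} (hx : 1 < ‖x‖) (α : ℝ) :
    powerWeight α γ x ≤ 1 := by
  rw [powerWeight, if_neg hx.not_ge, ← ENNReal.rpow_zero (x := ‖x‖ₑ)]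
  refine ENNReal.rpow_le_rpow_of_exponent_le ?_ (by linarith)
  rw [← ofReal_norm, ENNReal.one_le_ofReal]; exact hx.le

theorem powerWeight_zero_le_one {γ : ℝ} (hγ : 0 ≤ γ) (x : E) : powerWeight 0 γ x ≤ 1 := by
  rcases le_or_gt ‖x‖ 1 with h | h
  · rw [powerWeight, if_pos h]; simp
  · exact powerWeight_le_one hγ h 0

/-- A positive lower bound for `powerWeight` on bounded sets. -/
theorem exists_le_powerWeight {α γ : ℝ} (hα : 0 ≤ α) (hγ : 0 ≤ γ) (n : ℝ) :
    ∃ c : ℝ≥0∞, c ≠ 0 ∧ ∀ x : E, ‖x‖ ≤ n → c ≤ powerWeight α γ x := by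
  refine ⟨min 1 (ENNReal.ofReal n ^ (-γ)), ?_, fun x hx => ?_⟩
  · simp only [ne_eq, min_eq_iff, not_or, not_and_or]
    simp [ENNReal.rpow_eq_zero_iff, hγ.not_gt]
  · rcases le_or_gt ‖x‖ 1 with h | h
    · exact (min_le_left _ _).trans (one_le_powerWeight hα h)
    · refine (min_le_right _ _).trans ?_
      rw [powerWeight, if_neg h.not_ge, ENNReal.rpow_neg, ENNReal.rpow_neg, ENNReal.inv_le_inv]
      gcongr
      rw [← ofReal_norm]
      gcongr

variable [NormedSpace ℝ E] [FiniteDimensional ℝ E] [MeasureSpace E] [BorelSpace E]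
  [(volume : Measure E).IsAddHaarMeasure]

theorem setLIntegral_powerWeight_lt_top {α γ p : ℝ} (hd : 1 ≤ Module.finrank ℝ E) (hγ : 0 ≤ γ)
    (hp : 0 < p) (hα : α * p < Module.finrank ℝ E) (ρ : ℝ) :
    ∫⁻ x in Metric.closedBall (0 : E) ρ, powerWeight α γ x ^ p < ⊤ := by
  have h1 : IntegrableOn (fun x : E => ‖x‖ ^ (-(α * p))) (Metric.ball 0 2) :=
    integrableOn_ball_of_norm_le_rpow (C := 1) hd hα (ae_of_all _ fun x => by
      rw [one_mul, Real.norm_of_nonneg (by positivity)]) (by fun_prop : Measurable _).aestronglyMeasurable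
  have hne : ∀ᵐ x : E, x ≠ 0 := by
    have : Nontrivial E := Module.nontrivial_of_finrank_pos (R := ℝ) hd
    exact (compl_mem_ae_iff.2 (measure_singleton (0 : E)))
  calc ∫⁻ x in Metric.closedBall (0 : E) ρ, powerWeight α γ x ^ p
      ≤ ∫⁻ x in Metric.closedBall (0 : E) ρ,
        ((Metric.ball (0 : E) 2).indicator (fun x => ENNReal.ofReal (‖x‖ ^ (-(α * p)))) x + 1) := by
        refine lintegral_mono_ae (ae_restrict_of_ae ?_)
        filter_upwards [hne] with x hx
        rcases le_or_gt ‖x‖ 1 with h | h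
        · refine le_add_right ?_
          rw [Set.indicator_of_mem (by simpa using h.trans_lt one_lt_two), powerWeight, if_pos h,
            ← ENNReal.rpow_mul, neg_mul, enorm_rpow_neg hx]
        · exact le_add_left (ENNReal.rpow_le_one (powerWeight_le_one hγ h α) hp.le)
    _ = (∫⁻ x in Metric.closedBall (0 : E) ρ, (Metric.ball (0 : E) 2).indicator
          (fun x => ENNReal.ofReal (‖x‖ ^ (-(α * p)))) x) +
          volume (Metric.closedBall (0 : E) ρ) := by
        rw [lintegral_add_right _ measurable_const, setLIntegral_one]
    _ < ⊤ := by
        refine ENNReal.add_lt_top.2 ⟨?_, measure_closedBall_lt_top⟩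
        refine (setLIntegral_le_lintegral _ _).trans_lt ?_
        rw [lintegral_indicator Metric.isOpen_ball.measurableSet]
        exact h1.lintegral_lt_top

/-- The bound for a piece of a power weight cut out by two windows of radius `ρ`, at most `M`, that
lie `x` apart; `D` bounds the weight near the origin and `V` the volume of a window. -/
def powerWeightBound (γ ρ : ℝ) (M D V : ℝ≥0∞) (x : E) : ℝ≥0∞ :=
  M ^ 2 * (D * ENNReal.ofReal ((4 * ρ + 3) ^ γ) + V * ENNReal.ofReal (2 ^ γ)) *
    ENNReal.ofReal ((1 + ‖x‖) ^ (-γ))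

theorem lintegral_powerWeightBound_lt_top {γ ρ q : ℝ} {M D V : ℝ≥0∞} (hM : M ≠ ⊤) (hD : D ≠ ⊤)
    (hV : V ≠ ⊤) (hq : 0 < q) (hγ : (Module.finrank ℝ E : ℝ) < γ * q) :
    ∫⁻ x : E, powerWeightBound γ ρ M D V x ^ q < ⊤ := by
  have h : ∀ x : E, powerWeightBound γ ρ M D V x ^ q =
      (M ^ 2 * (D * ENNReal.ofReal ((4 * ρ + 3) ^ γ) + V * ENNReal.ofReal (2 ^ γ))) ^ q *
        ENNReal.ofReal ((1 + ‖x‖) ^ (-(γ * q))) := by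
    intro x
    have hx : 0 ≤ 1 + ‖x‖ := by positivity
    rw [powerWeightBound, ENNReal.mul_rpow_of_nonneg _ _ hq.le,
      ENNReal.ofReal_rpow_of_nonneg (by positivity) hq.le, ← Real.rpow_mul hx, neg_mul]
  simp_rw [h]
  rw [lintegral_const_mul _ (by fun_prop)]
  refine ENNReal.mul_lt_top (ENNReal.rpow_lt_top_of_nonneg hq.le ?_)
    (finite_integral_one_add_norm hγ)
  finiteness

theorem lintegral_window_powerWeight_window_le {α γ p ρ : ℝ} (hγ : 0 ≤ γ) (hp : 2 ≤ p)
    (hρ : 0 ≤ ρ) {ψ : E → ℝ≥0∞} {M D V : ℝ≥0∞} (hψM : ∀ y, ψ y ≤ M) (hψρ : ∀ y, ρ < ‖y‖ → ψ y = 0)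
    (hD : ∫⁻ x in Metric.closedBall (0 : E) (6 * ρ + 2), powerWeight α γ x ^ (p / 2) ≤ D ^ (p / 2))
    (hV : volume (Metric.closedBall (0 : E) ρ) ≤ V ^ (p / 2)) (x x' y : E) :
    ∫⁻ y', (ψ (y - x) * powerWeight α γ (y - y') * ψ (y' - x')) ^ (p / 2) ≤
      powerWeightBound γ ρ M D V (x - x') ^ (p / 2) := by
  have hp0 : 0 < p / 2 := by linarith
  rcases lt_or_ge ρ ‖y - x‖ with hyx | hyx
  · simp [hψρ _ hyx, ENNReal.zero_rpow_of_pos hp0]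
  have hx0 : 0 < 1 + ‖x - x'‖ := by positivity
  rcases le_or_gt ‖x - x'‖ (4 * ρ + 2) with h | h
  · -- the windows are close to each other: only small differences matter
    have hmeas := measurable_powerWeight (E := E) α γ
    calc _ ≤ ∫⁻ y', (M ^ 2) ^ (p / 2) * (Metric.closedBall (0 : E) (6 * ρ + 2)).indicator
          (fun z => powerWeight α γ z ^ (p / 2)) (y - y') := by
          refine lintegral_mono fun y' => ?_
          rcases lt_or_ge ρ ‖y' - x'‖ with hy' | hy'
          · simp [hψρ _ hy', ENNReal.zero_rpow_of_pos hp0]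
          · have : ‖y - y'‖ ≤ 6 * ρ + 2 := by
              calc ‖y - y'‖ = ‖(y - x) + (x - x') - (y' - x')‖ := by congr 1; abel
                _ ≤ ‖y - x‖ + ‖x - x'‖ + ‖y' - x'‖ :=
                  (norm_sub_le _ _).trans (by gcongr; exact norm_add_le _ _)
                _ ≤ _ := by linarith
            rw [Set.indicator_of_mem (by simpa using this), ← ENNReal.mul_rpow_of_nonneg _ _ hp0.le]
            refine ENNReal.rpow_le_rpow ?_ hp0.le
            calc _ ≤ M * powerWeight α γ (y - y') * M := by
                  gcongr <;> apply hψM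
              _ = _ := by ring
      _ = (M ^ 2) ^ (p / 2) *
          ∫⁻ z in Metric.closedBall (0 : E) (6 * ρ + 2), powerWeight α γ z ^ (p / 2) := by
          rw [lintegral_const_mul, lintegral_sub_left_eq_self
            ((Metric.closedBall (0 : E) (6 * ρ + 2)).indicator
              (fun z => powerWeight α γ z ^ (p / 2))),
            lintegral_indicator Metric.isClosed_closedBall.measurableSet]
          exact ((hmeas.pow_const _).indicator Metric.isClosed_closedBall.measurableSet).comp
            (by fun_prop)
      _ ≤ (M ^ 2) ^ (p / 2) * D ^ (p / 2) := by gcongr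
      _ = (M ^ 2 * D) ^ (p / 2) := by rw [ENNReal.mul_rpow_of_nonneg _ _ hp0.le]
      _ ≤ _ := by
          gcongr
          rw [powerWeightBound, mul_assoc]
          gcongr
          refine le_trans ?_ (mul_le_mul_left (le_add_right le_rfl) _)
          rw [mul_assoc, ← ENNReal.ofReal_mul (by positivity)]
          refine le_mul_of_one_le_right' ?_
          rw [ENNReal.one_le_ofReal, Real.rpow_neg hx0.le, ← div_eq_mul_inv,
            one_le_div (by positivity)]
          exact Real.rpow_le_rpow hx0.le (by linarith) hγ
  · -- the windows are far from each other: the weight is nearly constant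
    have hbd : ∀ y', (ψ (y - x) * powerWeight α γ (y - y') * ψ (y' - x')) ^ (p / 2) ≤
        (Metric.closedBall x' ρ).indicator
          (fun _ => (M ^ 2 * ENNReal.ofReal (2 ^ γ * (1 + ‖x - x'‖) ^ (-γ))) ^ (p / 2)) y' := by
      intro y'
      rcases lt_or_ge ρ ‖y' - x'‖ with hy' | hy'
      · simp [hψρ _ hy', ENNReal.zero_rpow_of_pos hp0]
      · rw [Set.indicator_of_mem (by rwa [mem_closedBall_iff_norm])]
        have hlow : (1 + ‖x - x'‖) / 2 ≤ ‖y - y'‖ := by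
          have : ‖x - x'‖ ≤ ‖y - x‖ + ‖y - y'‖ + ‖y' - x'‖ := by
            calc ‖x - x'‖ = ‖(y - y') - (y - x) + (y' - x')‖ := by congr 1; abel
              _ ≤ ‖y - y'‖ + ‖y - x‖ + ‖y' - x'‖ :=
                (norm_add_le _ _).trans (by gcongr; exact norm_sub_le _ _)
              _ = _ := by ring
          linarith
        have h1 : 1 < ‖y - y'‖ := by linarith
        have hne : y - y' ≠ 0 := norm_pos_iff.1 (by linarith)
        refine ENNReal.rpow_le_rpow ?_ hp0.le
        calc _ ≤ M * powerWeight α γ (y - y') * M := by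
              gcongr <;> apply hψM
          _ = M ^ 2 * powerWeight α γ (y - y') := by ring
          _ ≤ _ := by
              rw [powerWeight, if_neg h1.not_ge, enorm_rpow_neg hne]
              gcongr
              calc ‖y - y'‖ ^ (-γ) ≤ ((1 + ‖x - x'‖) / 2) ^ (-γ) :=
                    Real.rpow_le_rpow_of_nonpos (by positivity) hlow (by linarith)
                _ = _ := by
                    rw [Real.div_rpow hx0.le zero_le_two, Real.rpow_neg zero_le_two]
                    field_simp
    calc _ ≤ _ := lintegral_mono hbd
      _ = (M ^ 2 * ENNReal.ofReal (2 ^ γ * (1 + ‖x - x'‖) ^ (-γ))) ^ (p / 2) *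
          volume (Metric.closedBall x' ρ) := by
          rw [lintegral_indicator Metric.isClosed_closedBall.measurableSet, setLIntegral_const]
      _ ≤ (M ^ 2 * ENNReal.ofReal (2 ^ γ * (1 + ‖x - x'‖) ^ (-γ))) ^ (p / 2) * V ^ (p / 2) := by
          gcongr
          rwa [Measure.addHaar_closedBall_center]
      _ = (M ^ 2 * ENNReal.ofReal (2 ^ γ * (1 + ‖x - x'‖) ^ (-γ)) * V) ^ (p / 2) :=
          (ENNReal.mul_rpow_of_nonneg _ _ hp0.le).symm
      _ ≤ _ := by
          gcongr
          rw [powerWeightBound, ENNReal.ofReal_mul (by positivity)]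
          calc _ = M ^ 2 * (V * ENNReal.ofReal (2 ^ γ)) * ENNReal.ofReal ((1 + ‖x - x'‖) ^ (-γ)) := by
                ring
            _ ≤ _ := by gcongr; exact le_add_left le_rfl

theorem isAmalgamKernel_powerWeight {α γ p q ρ : ℝ} (hγ : 0 ≤ γ) (hp : 2 ≤ p) (hq : 2 ≤ q)
    (hρ : 0 ≤ ρ) {ψ : E → ℝ≥0∞} {M D V : ℝ≥0∞} (hψM : ∀ y, ψ y ≤ M) (hψρ : ∀ y, ρ < ‖y‖ → ψ y = 0)
    (hD : ∫⁻ x in Metric.closedBall (0 : E) (6 * ρ + 2), powerWeight α γ x ^ (p / 2) ≤ D ^ (p / 2))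
    (hV : volume (Metric.closedBall (0 : E) ρ) ≤ V ^ (p / 2)) :
    IsAmalgamKernel p q ψ (powerWeight α γ) (powerWeightBound γ ρ M D V)
      ((∫⁻ x : E, powerWeightBound γ ρ M D V x ^ (q / 2)) ^ (2 / q)) := by
  have hC : ((∫⁻ x : E, powerWeightBound γ ρ M D V x ^ (q / 2)) ^ (2 / q)) ^ (q / 2) =
      ∫⁻ x : E, powerWeightBound γ ρ M D V x ^ (q / 2) := by
    rw [← ENNReal.rpow_mul, div_mul_div_cancel₀ (by linarith), div_self two_ne_zero,
      ENNReal.rpow_one]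
  have heven : ∀ z : E, powerWeightBound γ ρ M D V (-z) = powerWeightBound γ ρ M D V z := fun z => by
    simp [powerWeightBound]
  have hleft := lintegral_window_powerWeight_window_le hγ hp hρ hψM hψρ hD hV
  constructor
  · exact measurable_powerWeight α γ
  · unfold powerWeightBound; fun_prop
  · exact hleft
  · intro x x' y'
    rw [← neg_sub x' x, heven]
    refine le_trans (le_of_eq (lintegral_congr fun y => ?_)) (hleft x' x y')
    rw [← neg_sub y' y, powerWeight_neg]
    ring_nf
  · intro x
    rw [hC, lintegral_sub_left_eq_self (fun z => powerWeightBound γ ρ M D V z ^ (q / 2))]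
  · intro x'
    rw [hC, lintegral_sub_right_eq_self (fun z => powerWeightBound γ ρ M D V z ^ (q / 2))]

/-- A power weight acts on the amalgam spaces as soon as it is locally in `L^(p/2)` and globally
in `L^(q/2)`. -/
theorem exists_isAmalgamKernel_powerWeight (hd : 1 ≤ Module.finrank ℝ E) {α γ p q ρ : ℝ}
    (hγ : 0 ≤ γ) (hp : 2 ≤ p)
    (hq : 2 ≤ q) (hα : α * (p / 2) < Module.finrank ℝ E) (hγq : Module.finrank ℝ E < γ * (q / 2))
    (hρ : 0 ≤ ρ) {ψ : E → ℝ≥0∞} {M : ℝ≥0∞} (hM : M ≠ ⊤) (hψM : ∀ y, ψ y ≤ M)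
    (hψρ : ∀ y, ρ < ‖y‖ → ψ y = 0) :
    ∃ b C, C ≠ ⊤ ∧ IsAmalgamKernel p q ψ (powerWeight α γ) b C := by
  have hp0 : 0 < p / 2 := by linarith
  have hI := setLIntegral_powerWeight_lt_top hd hγ hp0 hα (6 * ρ + 2)
  have hroot : ∀ x : ℝ≥0∞, x ≤ (x ^ (2 / p)) ^ (p / 2) := fun x => by
    rw [← ENNReal.rpow_mul, div_mul_div_cancel₀ (by linarith), div_self two_ne_zero,
      ENNReal.rpow_one]
  have hfin : ∀ x : ℝ≥0∞, x ≠ ⊤ → x ^ (2 / p) ≠ ⊤ := fun x hx =>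
    ENNReal.rpow_ne_top_of_nonneg (by positivity) hx
  refine ⟨_, _, ?_, isAmalgamKernel_powerWeight hγ hp hq hρ hψM hψρ (hroot _)
    (hroot (volume (Metric.closedBall (0 : E) ρ)))⟩
  exact ENNReal.rpow_ne_top_of_nonneg (by positivity) (lintegral_powerWeightBound_lt_top hM
    (hfin _ hI.ne) (hfin _ measure_closedBall_lt_top.ne) (by linarith) hγq).ne

/-- Without a singularity at the origin, the constants are uniform in the local exponent. -/
theorem exists_forall_isAmalgamKernel_powerWeight {γ q ρ : ℝ} (hγ : 0 ≤ γ)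
    (hq : 2 ≤ q) (hγq : Module.finrank ℝ E < γ * (q / 2))
    (hρ : 0 ≤ ρ) {ψ : E → ℝ≥0∞} {M : ℝ≥0∞} (hM : M ≠ ⊤) (hψM : ∀ y, ψ y ≤ M)
    (hψρ : ∀ y, ρ < ‖y‖ → ψ y = 0) :
    ∃ b C, C ≠ ⊤ ∧ ∀ p, 2 ≤ p → IsAmalgamKernel p q ψ (powerWeight 0 γ) b C := by
  set D := max 1 (volume (Metric.closedBall (0 : E) (6 * ρ + 2))) with hD
  have hDtop : D ≠ ⊤ := by simp [hD, measure_closedBall_lt_top.ne]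
  have hDp : ∀ p : ℝ, 2 ≤ p → volume (Metric.closedBall (0 : E) (6 * ρ + 2)) ≤ D ^ (p / 2) :=
    fun p hp => calc _ ≤ D := le_max_right _ _
      _ = D ^ (1 : ℝ) := (ENNReal.rpow_one D).symm
      _ ≤ _ := ENNReal.rpow_le_rpow_of_exponent_le (le_max_left _ _) (by linarith)
  refine ⟨_, _, ?_, fun p hp => isAmalgamKernel_powerWeight (D := D) (V := D) hγ hp hq hρ hψM hψρ
    ?_ ?_⟩
  · exact ENNReal.rpow_ne_top_of_nonneg (by positivity) (lintegral_powerWeightBound_lt_top hM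
      hDtop hDtop (by linarith) hγq).ne
  · refine le_trans ?_ (hDp p hp)
    rw [← setLIntegral_one]
    gcongr with x
    exact ENNReal.rpow_le_one (powerWeight_zero_le_one hγ x) (by linarith)
  · refine le_trans ?_ (hDp p hp)
    gcongr
    linarith

end PowerWeight

/-! ### The kernel is bounded by a product of power weights -/

/-- With `c = 2 / qt`, the weights are locally in `L^(rt/2)` in space (`α < 6 / rt`) and in
`L^(qt/2)` in time (`β < c`, and `β = 0` if `qt = ∞`), and globally in `L^(r/2)` (`γ > 6 / r`) and
`L^(q/2)` (`δ > 2 / q`). -/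
theorem exists_kleinGordonKernel_le_powerWeight {a c q r rt : ℝ} (ha0 : 0 < a) (ha1 : a < 1)
    (hc : 0 ≤ c) (hr : 6 < r) (hrt : r ≤ rt) (hqr : 1 / q + 3 / r = 1 / 2) (hac : a < 6 / rt + c) :
    ∃ α β γ δ : ℝ, 0 < α ∧ α < 6 / rt ∧ 0 ≤ β ∧ (c = 0 → β = 0) ∧ (0 < c → β < c) ∧
      6 / r < γ ∧ 2 / q < δ ∧ ∃ C : ℝ≥0, ∀ (R t : ℝ) (x : Space), 0 ≤ R →
        ‖kleinGordonKernel a R t x‖ₑ ≤ C * (powerWeight β δ t * powerWeight α γ x) := by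
  set b := 6 / rt with hb
  have hb0 : 0 < b := by have : 0 < rt := by linarith
                         positivity
  set d := 6 / r with hd
  have hd0 : 0 < d := by have : 0 < r := by linarith
                         positivity
  have hd1 : d < 1 := by rw [hd, div_lt_one (by linarith)]; exact hr
  have hqd : 2 / q = 1 - d := by
    have h1 : 2 / q = 2 * (1 / q) := by ring
    have h2 : d = 2 * (3 / r) := by rw [hd]; ring
    linarith
  -- `ε` is the decay rate gained from the curvature of the mass shell
  set ε := (1 - a) / 2 with hε
  have hε0 : 0 < ε := by rw [hε]; linarith
  have hε1 : ε < 1 / 2 := by rw [hε]; linarith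
  -- `γ` exceeds `6 / r` by so little that `ε γ` makes up for the loss in `1 - γ < 2 / q`
  obtain ⟨γ, hγd, hγ⟩ : ∃ γ, d < γ ∧ γ < min 1 (d / (1 - ε)) := by
    refine exists_between (lt_min hd1 ?_)
    rw [lt_div_iff₀ (by linarith)]
    nlinarith
  have hγ1 : γ < 1 := hγ.trans_le (min_le_left _ _)
  have hγε : γ * (1 - ε) < d := by
    have := hγ.trans_le (min_le_right _ _)
    rwa [lt_div_iff₀ (by linarith)] at this
  have hγ0 : 0 < γ := hd0.trans hγd
  -- the singularity of order `μ` is shared between space and time in the ratio `θ : 1 - θ`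
  obtain ⟨μ, haμ, hμ⟩ : ∃ μ, a < μ ∧ μ < min 1 (b + c) := exists_between (lt_min ha1 hac)
  have hμ1 : μ < 1 := hμ.trans_le (min_le_left _ _)
  have hμbc : μ < b + c := hμ.trans_le (min_le_right _ _)
  have hμ0 : 0 < μ := ha0.trans haμ
  have hbc : 0 < b + c := by linarith
  set θ := b / (b + c) with hθ
  have hθ0 : 0 < θ := by positivity
  have hθ1 : θ ≤ 1 := by rw [hθ, div_le_one hbc]; linarith
  have hθ' : 1 - θ = c / (b + c) := by rw [hθ]; field_simp; ring
  obtain ⟨C₁, hC₁0, hC₁⟩ := exists_norm_kleinGordonKernel_le_space ha0 haμ hμ1.le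
  obtain ⟨C₂, hC₂0, hC₂⟩ := exists_norm_kleinGordonKernel_le_space ha0 ha1 le_rfl
  obtain ⟨C₃, hC₃0, hC₃⟩ := exists_norm_kleinGordonKernel_le_time ha0 haμ hμ1.le
  obtain ⟨C₄, hC₄0, hC₄⟩ := exists_norm_kleinGordonKernel_le_time ha0 ha1 le_rfl
  obtain ⟨C₅, hC₅0, hC₅⟩ := exists_norm_kleinGordonKernel_le_decay (ε := ε) ha0 hε0 hε1.le
    (by rw [hε]; linarith)
  set C := 1 + C₁ + C₂ + C₃ + C₄ + C₅ with hC
  have hC0 : 0 < C := by positivity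
  set β := μ * (1 - θ) with hβ
  have hβ0 : 0 ≤ β := mul_nonneg hμ0.le (by linarith)
  set δ := ε * γ + (1 - γ) with hδ
  have hδ0 : 0 < δ := by have := mul_pos hε0 hγ0; linarith
  have hα0 : 0 < μ * θ := by positivity
  refine ⟨μ * θ, β, γ, δ, hα0, ?_, hβ0, fun h => ?_, fun h => ?_, hγd, ?_, C.toNNReal, ?_⟩
  · rw [hθ, ← mul_div_assoc, div_lt_iff₀ hbc, mul_comm]
    gcongr
  · rw [hβ, hθ', h]; simp
  · rw [hβ, hθ', ← mul_div_assoc, div_lt_iff₀ hbc, mul_comm]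
    gcongr
  · rw [hqd, hδ]; nlinarith
  intro R t x hR
  change _ ≤ ENNReal.ofReal C * _
  have hCne : ENNReal.ofReal C ≠ 0 := by simp [hC0]
  rcases eq_or_ne x 0 with rfl | hx
  · have : powerWeight (μ * θ) γ (0 : Space) = ⊤ := by
      simp [powerWeight, hα0]
    rw [this, ENNReal.mul_top (powerWeight_ne_zero hβ0 hδ0.le t), ENNReal.mul_top hCne]
    exact le_top
  have hs : 0 < ‖x‖ := norm_pos_iff.2 hx
  rcases eq_or_ne t 0 with rfl | ht
  · rcases hβ0.eq_or_lt' with h0 | h0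
    · -- only `‖x‖ ^ (-μ)` and `‖x‖⁻¹` are needed at time zero
      have hθ1' : θ = 1 := by
        rcases mul_eq_zero.1 (hβ.symm.trans h0) with h | h <;> linarith
      have h1 : powerWeight β δ (0 : ℝ) = 1 := by simp [powerWeight, h0]
      rw [h1, one_mul, hθ1', mul_one, ← ofReal_norm, powerWeight]
      split_ifs with hx1
      · rw [enorm_rpow_neg hx, ← ENNReal.ofReal_mul hC0.le]
        refine ENNReal.ofReal_le_ofReal ((hC₁ R 0 x hR hx).trans ?_)
        gcongr; linarith
      · rw [enorm_rpow_neg hx, ← ENNReal.ofReal_mul hC0.le]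
        refine ENNReal.ofReal_le_ofReal ((hC₂ R 0 x hR hx).trans ?_)
        have : ‖x‖ ^ (-1 : ℝ) ≤ ‖x‖ ^ (-γ) :=
          Real.rpow_le_rpow_of_exponent_le (by linarith) (by linarith)
        gcongr; linarith
    · have : powerWeight β δ (0 : ℝ) = ⊤ := by simp [powerWeight, h0]
      rw [this, ENNReal.top_mul (powerWeight_ne_zero hα0.le hγ0.le x), ENNReal.mul_top hCne]
      exact le_top
  have ht0 : 0 < |t| := abs_pos.2 ht
  have htn : ‖t‖ = |t| := rfl
  have hz0 := norm_nonneg (kleinGordonKernel a R t x)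
  -- the five bounds with a common constant
  set z := ‖kleinGordonKernel a R t x‖ / C with hz
  have hz0 : 0 ≤ z := by positivity
  have hdiv : ∀ {D P : ℝ}, D ≤ C → 0 ≤ P → ‖kleinGordonKernel a R t x‖ ≤ D * P → z ≤ P :=
    fun hD hP h => by
      rw [hz, div_le_iff₀ hC0, mul_comm]
      exact h.trans (mul_le_mul_of_nonneg_right hD hP)
  have k1 := hdiv (by linarith) (by positivity) (hC₁ R t x hR hx)
  have k2 := hdiv (by linarith) (by positivity) (hC₂ R t x hR hx)
  have k3 := hdiv (by linarith) (by positivity) (hC₃ R t x hR ht hx)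
  have k4 := hdiv (by linarith) (by positivity) (hC₄ R t x hR ht hx)
  have k5 := hdiv (by linarith) (by positivity) (hC₅ R t x hR ht hx)
  have hfin : ∀ P Q : ℝ, 0 ≤ P → z ≤ P * Q → ‖kleinGordonKernel a R t x‖ₑ ≤
      ENNReal.ofReal C * (ENNReal.ofReal P * ENNReal.ofReal Q) := by
    intro P Q hP h
    rw [← ENNReal.ofReal_mul hP, ← ofReal_norm, ← ENNReal.ofReal_mul hC0.le]
    refine ENNReal.ofReal_le_ofReal ?_
    rwa [hz, div_le_iff₀ hC0, mul_comm] at h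
  rcases le_or_gt ‖t‖ 1 with ht1 | ht1 <;> rcases le_or_gt ‖x‖ 1 with hx1 | hx1
  · rw [powerWeight, powerWeight, if_pos ht1, if_pos hx1, enorm_rpow_neg ht, enorm_rpow_neg hx]
    refine hfin _ _ (by positivity) ?_
    have := le_rpow_mul_rpow hz0 k1 k3 hθ0.le hθ1
    rw [← Real.rpow_mul hs.le, ← Real.rpow_mul ht0.le] at this
    rw [htn]
    calc z ≤ _ := this
      _ = _ := by rw [mul_comm, hβ]; ring_nf
  · rw [powerWeight, powerWeight, if_pos ht1, if_neg hx1.not_ge, enorm_rpow_neg ht,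
      enorm_rpow_neg hx]
    refine hfin _ _ (by positivity) (k2.trans ?_)
    have h1 : ‖x‖ ^ (-1 : ℝ) ≤ ‖x‖ ^ (-γ) :=
      Real.rpow_le_rpow_of_exponent_le hx1.le (by linarith)
    have h2 : 1 ≤ ‖t‖ ^ (-β) :=
      Real.one_le_rpow_of_pos_of_le_one_of_nonpos ht0 ht1 (by linarith)
    exact h1.trans (le_mul_of_one_le_left (by positivity) h2)
  · rw [powerWeight, powerWeight, if_neg ht1.not_ge, if_pos hx1, enorm_rpow_neg ht,
      enorm_rpow_neg hx]
    refine hfin _ _ (by positivity) (k4.trans ?_)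
    have h1 : |t| ^ (-1 : ℝ) ≤ ‖t‖ ^ (-δ) :=
      Real.rpow_le_rpow_of_exponent_le ht1.le (by rw [hδ]; nlinarith)
    have h2 : 1 ≤ ‖x‖ ^ (-(μ * θ)) :=
      Real.one_le_rpow_of_pos_of_le_one_of_nonpos hs hx1 (by linarith)
    exact h1.trans (le_mul_of_one_le_right (by positivity) h2)
  · rw [powerWeight, powerWeight, if_neg ht1.not_ge, if_neg hx1.not_ge, enorm_rpow_neg ht,
      enorm_rpow_neg hx]
    refine hfin _ _ (by positivity) ?_
    have := le_rpow_mul_rpow hz0 k5 k4 hγ0.le hγ1.le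
    rw [Real.mul_rpow (by positivity) (by positivity), ← Real.rpow_mul ht0.le,
      ← Real.rpow_mul ht0.le, Real.inv_rpow hs.le, ← Real.rpow_neg hs.le, mul_assoc,
      ← Real.rpow_add ht0] at this
    rw [htn]
    calc z ≤ _ := this
      _ = _ := by rw [mul_comm, hδ]; ring_nf

/-! ### The `TT*` argument -/

section TTStar

variable {Z Ξ V : Type*} [MeasurableSpace Z] [MeasurableSpace Ξ] {ν : Measure Z} {μ : Measure Ξ}
  [SFinite ν] [IsFiniteMeasure μ] [NormedAddCommGroup V] [InnerProductSpace ℂ V]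
  [CompleteSpace V] {e : Z → Ξ → ℂ} {g : Ξ → V} {G : Z → V}

theorem integral_inner_integral_smul (he : StronglyMeasurable (Function.uncurry e))
    (he1 : ∀ z ξ, ‖e z ξ‖ ≤ 1) (hg : Integrable g μ) (hG : Integrable G ν) :
    ∫ z, inner ℂ (G z) (∫ ξ, e z ξ • g ξ ∂μ) ∂ν =
      ∫ ξ, inner ℂ (∫ z, (starRingEnd ℂ) (e z ξ) • G z ∂ν) (g ξ) ∂μ := by
  have hez : ∀ z, StronglyMeasurable (e z) := fun z =>
    he.comp_measurable (measurable_prodMk_left (x := z))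
  have heξ : ∀ ξ, StronglyMeasurable fun z => e z ξ := fun ξ =>
    he.comp_measurable (measurable_prodMk_right (y := ξ))
  have h1 : ∀ z, inner ℂ (G z) (∫ ξ, e z ξ • g ξ ∂μ) = ∫ ξ, e z ξ * inner ℂ (G z) (g ξ) ∂μ := by
    intro z
    have hi : Integrable (fun ξ => e z ξ • g ξ) μ :=
      hg.bdd_smul 1 (hez z).aestronglyMeasurable (ae_of_all _ (he1 z))
    rw [← integral_inner hi]
    simp_rw [inner_smul_right]
  have h2 : ∀ ξ, inner ℂ (∫ z, (starRingEnd ℂ) (e z ξ) • G z ∂ν) (g ξ) =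
      ∫ z, e z ξ * inner ℂ (G z) (g ξ) ∂ν := by
    intro ξ
    have hi : Integrable (fun z => (starRingEnd ℂ) (e z ξ) • G z) ν :=
      hG.bdd_smul 1 (continuous_star.comp_stronglyMeasurable (heξ ξ)).aestronglyMeasurable
        (ae_of_all _ fun z => by simpa using he1 z ξ)
    rw [← inner_conj_symm, ← integral_inner hi, ← integral_conj]
    congr 1
    ext z
    rw [inner_smul_right, map_mul, inner_conj_symm]
    simp
  simp_rw [h1, h2]
  refine integral_integral_swap ?_
  have hprod : Integrable (fun p : Z × Ξ => ‖G p.1‖ * ‖g p.2‖) (ν.prod μ) :=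
    hG.norm.mul_prod hg.norm
  refine hprod.mono' ?_ (ae_of_all _ fun p => ?_)
  · refine he.aestronglyMeasurable.mul ?_
    exact (hG.aestronglyMeasurable.comp_fst).inner (hg.aestronglyMeasurable.comp_snd)
  · simp only [Function.uncurry]
    rw [norm_mul]
    calc _ ≤ 1 * (‖G p.1‖ * ‖g p.2‖) := by
          gcongr
          · exact he1 _ _
          · exact norm_inner_le_norm _ _
      _ = _ := one_mul _

/-- The `TT*` inequality: the operator with kernel `e` pairs with `G` at most as the square root of
the quadratic form of the kernel of `TT*`. -/
theorem enorm_integral_inner_le (he : StronglyMeasurable (Function.uncurry e))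
    (he1 : ∀ z ξ, ‖e z ξ‖ ≤ 1) (hg : MemLp g 2 μ) (hG : Integrable G ν) :
    ‖∫ z, inner ℂ (G z) (∫ ξ, e z ξ • g ξ ∂μ) ∂ν‖ₑ ≤ eLpNorm g 2 μ *
      (∫⁻ z, ∫⁻ z', ‖G z‖ₑ * ‖∫ ξ, e z ξ * (starRingEnd ℂ) (e z' ξ) ∂μ‖ₑ * ‖G z'‖ₑ ∂ν ∂ν) ^
        (1 / 2 : ℝ) := by
  set h : Ξ → V := fun ξ => ∫ z, (starRingEnd ℂ) (e z ξ) • G z ∂ν with hh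
  have hcm : StronglyMeasurable fun p : Z × Ξ => (starRingEnd ℂ) (e p.1 p.2) :=
    continuous_star.comp_stronglyMeasurable he
  have hcξ : ∀ ξ, StronglyMeasurable fun z => (starRingEnd ℂ) (e z ξ) := fun ξ =>
    hcm.comp_measurable (measurable_prodMk_right (y := ξ))
  have hez : ∀ z, StronglyMeasurable (e z) := fun z =>
    he.comp_measurable (measurable_prodMk_left (x := z))
  have hhm : AEStronglyMeasurable h μ := by
    have : AEStronglyMeasurable (fun p : Ξ × Z => (starRingEnd ℂ) (e p.2 p.1) • G p.2) (μ.prod ν) :=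
      (hcm.comp_measurable measurable_swap).aestronglyMeasurable.smul
        hG.aestronglyMeasurable.comp_snd
    exact this.integral_prod_right'
  have hhb : ∀ ξ, ‖h ξ‖ ≤ ∫ z, ‖G z‖ ∂ν := fun ξ => by
    refine norm_integral_le_of_norm_le hG.norm (ae_of_all _ fun z => ?_)
    rw [norm_smul]
    exact mul_le_of_le_one_left (norm_nonneg _) (by simpa using he1 z ξ)
  have hhint : Integrable h μ := Integrable.of_bound hhm _ (ae_of_all _ hhb)
  have hgint : Integrable g μ := hg.integrable (by norm_num)
  have hh2 : MemLp h 2 μ := MemLp.of_bound hhm _ (ae_of_all _ hhb)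
  rw [integral_inner_integral_smul he he1 hgint hG]
  -- Cauchy-Schwarz on the frequency side
  have hCS : ‖∫ ξ, inner ℂ (h ξ) (g ξ) ∂μ‖ₑ ≤ eLpNorm h 2 μ * eLpNorm g 2 μ := by
    calc _ ≤ ∫⁻ ξ, ‖inner ℂ (h ξ) (g ξ)‖ₑ ∂μ := enorm_integral_le_lintegral_enorm _
      _ ≤ ∫⁻ ξ, ‖h ξ‖ₑ * ‖g ξ‖ₑ ∂μ := lintegral_mono fun ξ => by
          rw [← ofReal_norm, ← ofReal_norm, ← ofReal_norm, ← ENNReal.ofReal_mul (norm_nonneg _)]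
          exact ENNReal.ofReal_le_ofReal (norm_inner_le_norm _ _)
      _ ≤ (∫⁻ ξ, ‖h ξ‖ₑ ^ (2 : ℝ) ∂μ) ^ (1 / 2 : ℝ) * (∫⁻ ξ, ‖g ξ‖ₑ ^ (2 : ℝ) ∂μ) ^ (1 / 2 : ℝ) :=
          ENNReal.lintegral_mul_le_Lp_mul_Lq _ Real.HolderConjugate.two_two hhm.enorm
            hg.1.enorm
      _ = _ := by
          rw [eLpNorm_eq_lintegral_rpow_enorm_toReal two_ne_zero ENNReal.ofNat_ne_top,
            eLpNorm_eq_lintegral_rpow_enorm_toReal two_ne_zero ENNReal.ofNat_ne_top]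
          simp
  refine hCS.trans ?_
  rw [mul_comm]
  gcongr
  -- the quadratic form of `TT*`
  have hsq : ∫⁻ ξ, ‖h ξ‖ₑ ^ (2 : ℝ) ∂μ ≤
      ∫⁻ z, ∫⁻ z', ‖G z‖ₑ * ‖∫ ξ, e z ξ * (starRingEnd ℂ) (e z' ξ) ∂μ‖ₑ * ‖G z'‖ₑ ∂ν ∂ν := by
    have h1 : ∫⁻ ξ, ‖h ξ‖ₑ ^ (2 : ℝ) ∂μ = ‖∫ ξ, inner ℂ (h ξ) (h ξ) ∂μ‖ₑ := by
      have e1 : ∫ ξ, inner ℂ (h ξ) (h ξ) ∂μ = ((∫ ξ, ‖h ξ‖ ^ 2 ∂μ : ℝ) : ℂ) := by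
        rw [← integral_complex_ofReal]
        congr 1; ext ξ
        rw [inner_self_eq_norm_sq_to_K]; simp
      rw [e1, ← ofReal_norm, Complex.norm_real, Real.norm_of_nonneg
        (integral_nonneg fun _ => by positivity), ofReal_integral_eq_lintegral_ofReal
        hh2.integrable_norm_pow' (ae_of_all _ fun _ => by positivity)]
      refine lintegral_congr fun ξ => ?_
      rw [← ofReal_norm, ENNReal.ofReal_rpow_of_nonneg (norm_nonneg _) zero_le_two]
      norm_num
    rw [h1, ← integral_inner_integral_smul he he1 hhint hG]
    refine (enorm_integral_le_lintegral_enorm _).trans (lintegral_mono fun z => ?_)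
    have h2 : ∫ ξ, e z ξ • h ξ ∂μ = ∫ z', (∫ ξ, e z ξ * (starRingEnd ℂ) (e z' ξ) ∂μ) • G z' ∂ν := by
      simp_rw [hh, ← integral_smul, ← integral_smul_const]
      simp_rw [smul_smul]
      refine integral_integral_swap (f := fun ξ z' => (e z ξ * (starRingEnd ℂ) (e z' ξ)) • G z') ?_
      have hd : Integrable (fun p : Ξ × Z => ‖(1 : ℝ)‖ * ‖G p.2‖) (μ.prod ν) :=
        ((integrable_const (1 : ℝ)).norm).mul_prod hG.norm
      refine hd.mono' ?_ (ae_of_all _ fun p => ?_)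
      · refine AEStronglyMeasurable.smul (AEStronglyMeasurable.mul ?_ ?_)
          hG.aestronglyMeasurable.comp_snd
        · exact ((hez z).comp_measurable measurable_fst).aestronglyMeasurable
        · exact (hcm.comp_measurable measurable_swap).aestronglyMeasurable
      · simp only [Function.uncurry]
        rw [norm_smul, norm_mul, norm_one, RCLike.norm_conj]
        gcongr
        exact mul_le_one₀ (he1 _ _) (norm_nonneg _) (he1 _ _)
    calc ‖inner ℂ (G z) (∫ ξ, e z ξ • h ξ ∂μ)‖ₑ ≤ ‖G z‖ₑ * ‖∫ ξ, e z ξ • h ξ ∂μ‖ₑ := by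
          rw [← ofReal_norm, ← ofReal_norm, ← ofReal_norm, ← ENNReal.ofReal_mul (norm_nonneg _)]
          exact ENNReal.ofReal_le_ofReal (norm_inner_le_norm _ _)
      _ ≤ ‖G z‖ₑ * ∫⁻ z', ‖∫ ξ, e z ξ * (starRingEnd ℂ) (e z' ξ) ∂μ‖ₑ * ‖G z'‖ₑ ∂ν := by
          gcongr
          rw [h2]
          refine (enorm_integral_le_lintegral_enorm _).trans (le_of_eq ?_)
          simp_rw [enorm_smul]
      _ = _ := by
          rw [← lintegral_const_mul' _ _ enorm_ne_top]
          simp_rw [mul_assoc]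
  rw [eLpNorm_eq_lintegral_rpow_enorm_toReal two_ne_zero ENNReal.ofNat_ne_top]
  simp only [ENNReal.toReal_ofNat]
  gcongr

end TTStar

/-! ### Fatou's lemma for amalgam norms -/

theorem lintegral_rpow_le_liminf {α : Type*} [MeasurableSpace α] {μ : Measure α} {p : ℝ}
    (hp : 0 < p) {v : α → ℝ≥0∞} {w : ℕ → α → ℝ≥0∞} (hw : ∀ n, AEMeasurable (w n) μ)
    (h : ∀ᵐ y ∂μ, v y ≤ Filter.liminf (fun n => w n y) Filter.atTop) :
    (∫⁻ y, v y ^ p ∂μ) ^ (1 / p) ≤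
      Filter.liminf (fun n => (∫⁻ y, w n y ^ p ∂μ) ^ (1 / p)) Filter.atTop := by
  have e : ∀ {s : ℝ} (_ : 0 < s) (f : ℕ → ℝ≥0∞), Filter.liminf f Filter.atTop ^ s =
      Filter.liminf (fun n => f n ^ s) Filter.atTop := fun hs f =>
    (ENNReal.orderIsoRpow _ hs).liminf_apply (u := f)
  have hp' : 0 < 1 / p := by positivity
  calc _ ≤ (∫⁻ y, Filter.liminf (fun n => w n y ^ p) Filter.atTop ∂μ) ^ (1 / p) := by
        refine ENNReal.rpow_le_rpow (lintegral_mono_ae ?_) hp'.le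
        filter_upwards [h] with y hy
        rw [← e hp]
        exact ENNReal.rpow_le_rpow hy hp.le
    _ ≤ (Filter.liminf (fun n => ∫⁻ y, w n y ^ p ∂μ) Filter.atTop) ^ (1 / p) := by
        gcongr
        exact lintegral_liminf_le' fun n => (hw n).pow_const _
    _ = _ := e hp' _

section Fatou

variable {E : Type*} [NormedAddCommGroup E] [MeasureSpace E] [BorelSpace E] {p q : ℝ} {ψ v : E → ℝ≥0∞} {w : ℕ → E → ℝ≥0∞}

theorem localNorm_le_liminf (hp : 0 < p) (hψ : Measurable ψ) (hψ' : ∀ y, ψ y ≠ ⊤)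
    (hw : ∀ n, Measurable (w n))
    (h : ∀ᵐ y, v y ≤ Filter.liminf (fun n => w n y) Filter.atTop) (x : E) :
    localNorm p ψ v x ≤ Filter.liminf (fun n => localNorm p ψ (w n) x) Filter.atTop := by
  refine lintegral_rpow_le_liminf hp (w := fun n y => w n y * ψ (y - x)) (fun n => ?_) ?_
  · have := hw n
    fun_prop
  · filter_upwards [h] with y hy
    rw [ENNReal.liminf_mul_const_of_ne_top (hψ' _), mul_comm]
    exact mul_le_mul' le_rfl hy

variable [SecondCountableTopology E] [SFinite (volume : Measure E)]

theorem mixedNorm_le_liminf (hp : 0 < p) (hq : 0 < q) (hψ : Measurable ψ) (hψ' : ∀ y, ψ y ≠ ⊤)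
    (hw : ∀ n, Measurable (w n))
    (h : ∀ᵐ y, v y ≤ Filter.liminf (fun n => w n y) Filter.atTop) :
    mixedNorm p q ψ v ≤ Filter.liminf (fun n => mixedNorm p q ψ (w n)) Filter.atTop := by
  refine lintegral_rpow_le_liminf hq (fun n => ?_)
    (ae_of_all _ fun x => localNorm_le_liminf hp hψ hψ' hw h x)
  exact ((measurable_localNorm (T := Unit) (v := fun _ => w n) hψ (by fun_prop)).comp
      (f := fun x => ((), x)) (by fun_prop)).aemeasurable

end Fatou

section Finite

variable {E : Type*} [NormedAddCommGroup E] [MeasureSpace E] {p q n ρ : ℝ} {ψ v : E → ℝ≥0∞} {c M : ℝ≥0∞}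

theorem localNorm_eq_zero (hp : 0 < p) (hv0 : ∀ y, n < ‖y‖ → v y = 0)
    (hψρ : ∀ y, ρ < ‖y‖ → ψ y = 0) {x : E} (hx : n + ρ < ‖x‖) : localNorm p ψ v x = 0 := by
  have : ∀ y, (v y * ψ (y - x)) ^ p = 0 := fun y => by
    rcases lt_or_ge n ‖y‖ with h | h
    · rw [hv0 y h, zero_mul, ENNReal.zero_rpow_of_pos hp]
    · have : ρ < ‖y - x‖ := by
        have := norm_sub_norm_le x y
        rw [norm_sub_rev] at this
        linarith
      rw [hψρ _ this, mul_zero, ENNReal.zero_rpow_of_pos hp]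
  simp [localNorm, this, hp]

variable [BorelSpace E]

theorem localNorm_le (hp : 0 < p) (hv : ∀ y, v y ≤ c) (hv0 : ∀ y, n < ‖y‖ → v y = 0)
    (hψM : ∀ y, ψ y ≤ M) (x : E) :
    localNorm p ψ v x ≤ c * M * volume (Metric.closedBall (0 : E) n) ^ (1 / p) := by
  calc localNorm p ψ v x ≤ (∫⁻ y, (Metric.closedBall (0 : E) n).indicator
        (fun _ => (c * M) ^ p) y) ^ (1 / p) := by
        unfold localNorm
        gcongr with y
        rcases lt_or_ge n ‖y‖ with h | h
        · rw [hv0 y h, zero_mul, ENNReal.zero_rpow_of_pos hp]; exact zero_le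
        · rw [Set.indicator_of_mem (by simpa using h)]
          gcongr
          exacts [hv y, hψM _]
    _ = _ := by
        rw [lintegral_indicator Metric.isClosed_closedBall.measurableSet, setLIntegral_const,
          ENNReal.mul_rpow_of_nonneg _ _ (by positivity), ← ENNReal.rpow_mul,
          mul_one_div_cancel hp.ne', ENNReal.rpow_one]

theorem mixedNorm_le (hp : 0 < p) (hq : 0 < q) (hv : ∀ y, v y ≤ c)
    (hv0 : ∀ y, n < ‖y‖ → v y = 0) (hψM : ∀ y, ψ y ≤ M) (hψρ : ∀ y, ρ < ‖y‖ → ψ y = 0) :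
    mixedNorm p q ψ v ≤ c * M * volume (Metric.closedBall (0 : E) n) ^ (1 / p) *
      volume (Metric.closedBall (0 : E) (n + ρ)) ^ (1 / q) := by
  set d := c * M * volume (Metric.closedBall (0 : E) n) ^ (1 / p) with hd
  calc mixedNorm p q ψ v ≤ (∫⁻ y, (Metric.closedBall (0 : E) (n + ρ)).indicator
        (fun _ => d ^ q) y) ^ (1 / q) := by
        unfold mixedNorm
        gcongr with y
        rcases lt_or_ge (n + ρ) ‖y‖ with h | h
        · rw [localNorm_eq_zero hp hv0 hψρ h, ENNReal.zero_rpow_of_pos hq]; exact zero_le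
        · rw [Set.indicator_of_mem (by simpa using h)]
          gcongr
          exact localNorm_le hp hv hv0 hψM y
    _ = _ := by
        rw [lintegral_indicator Metric.isClosed_closedBall.measurableSet, setLIntegral_const,
          ENNReal.mul_rpow_of_nonneg _ _ (by positivity), ← ENNReal.rpow_mul,
          mul_one_div_cancel hq.ne', ENNReal.rpow_one]

end Finite

/-! ### From the quadratic form to the space-time norm -/

section Duality

variable {qt q rt r β δ α γ ρ : ℝ} {φ : ℝ → ℝ≥0∞} {ψ : Space → ℝ≥0∞} {M : ℝ≥0∞}
  {a : ℝ → ℝ≥0∞} {b : Space → ℝ≥0∞} {CA CB D : ℝ≥0∞}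

theorem lintegral_prod_kernel_eq {S : ℝ → Space → ℝ≥0∞} {A : ℝ → ℝ≥0∞} {B : Space → ℝ≥0∞}
    (hS : Measurable (Function.uncurry S)) (hA : Measurable A) (hB : Measurable B) :
    ∫⁻ z : ℝ × Space, ∫⁻ z' : ℝ × Space,
        S z.1 z.2 * (A (z.1 - z'.1) * B (z.2 - z'.2)) * S z'.1 z'.2 =
      ∫⁻ t, ∫⁻ t', ∫⁻ y, ∫⁻ y', S t y * (A (t - t') * B (y - y')) * S t' y' := by
  have hS1 : Measurable fun z : ℝ × Space => S z.1 z.2 := hS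
  have hm : Measurable fun w : (ℝ × Space) × (ℝ × Space) =>
      S w.1.1 w.1.2 * (A (w.1.1 - w.2.1) * B (w.1.2 - w.2.2)) * S w.2.1 w.2.2 := by
    have h1 : Measurable fun w : (ℝ × Space) × (ℝ × Space) => S w.1.1 w.1.2 :=
      hS1.comp measurable_fst
    have h2 : Measurable fun w : (ℝ × Space) × (ℝ × Space) => S w.2.1 w.2.2 :=
      hS1.comp measurable_snd
    exact (h1.mul (by fun_prop)).mul h2
  rw [Measure.volume_eq_prod, lintegral_prod _ (hm.lintegral_prod_right').aemeasurable]
  refine lintegral_congr fun t => ?_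
  have h2 : ∀ y, ∫⁻ z' : ℝ × Space, S t y * (A (t - z'.1) * B (y - z'.2)) * S z'.1 z'.2
      ∂(volume.prod volume) = ∫⁻ t', ∫⁻ y', S t y * (A (t - t') * B (y - y')) * S t' y' := fun y => by
    rw [lintegral_prod]
    exact (hm.comp (measurable_prodMk_left (x := (t, y)))).aemeasurable
  simp_rw [h2]
  refine lintegral_lintegral_swap (f := fun y t' =>
    ∫⁻ y', S t y * (A (t - t') * B (y - y')) * S t' y') ?_
  refine (Measurable.lintegral_prod_right' (f := fun w : (Space × ℝ) × Space =>
    S t w.1.1 * (A (t - w.1.2) * B (w.1.1 - w.2)) * S w.1.2 w.2) ?_).aemeasurable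
  exact hm.comp (f := fun w : (Space × ℝ) × Space => ((t, w.1.1), (w.1.2, w.2))) (by fun_prop)

theorem dualFun_eq_zero {E : Type*} [NormedAddCommGroup E] [MeasureSpace E] {p q : ℝ} (hp : 1 < p)
    {ψ v : E → ℝ≥0∞} {y : E} (h : v y = 0) : dualFun p q ψ v y = 0 := by
  rw [dualFun, h, ENNReal.zero_rpow_of_pos (by linarith), zero_mul]

/-- The core of the duality argument, for functions supported in a ball: testing the pairing on
the extremizer bounds the norm. -/
theorem mixedNorm_le_of_pairing_of_support (hqt : 2 ≤ qt) (hq : 2 ≤ q) (hrt : 2 ≤ rt) (hr : 2 ≤ r)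
    (hφ : Measurable φ) (hψ : Measurable ψ) (hM : M ≠ ⊤) (hφM : ∀ t, φ t ≤ M)
    (hψM : ∀ x, ψ x ≤ M) (hφρ : ∀ t, ρ < ‖t‖ → φ t = 0) (hψρ : ∀ x, ρ < ‖x‖ → ψ x = 0)
    (hβ : 0 ≤ β) (hδ : 0 ≤ δ) (hα : 0 ≤ α) (hγ : 0 ≤ γ)
    (hA : IsAmalgamKernel qt q φ (powerWeight β δ) a CA) (hCA : CA ≠ ⊤)
    (hB : IsAmalgamKernel rt r ψ (powerWeight α γ) b CB) (hCB : CB ≠ ⊤)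
    {u : ℝ → Space → Spinor} (hu : StronglyMeasurable (Function.uncurry u)) {c : ℝ}
    (huc : ∀ t x, ‖u t x‖ ≤ c)
    (hD : ∀ G : ℝ × Space → Spinor, Integrable G →
      ‖∫ z, inner ℂ (G z) (u z.1 z.2)‖ₑ ≤ D * (∫⁻ z, ∫⁻ z', ‖G z‖ₑ *
        (powerWeight β δ (z.1 - z'.1) * powerWeight α γ (z.2 - z'.2)) * ‖G z'‖ₑ) ^ (1 / 2 : ℝ))
    {v : ℝ → Space → ℝ≥0∞} (hv : Measurable (Function.uncurry v)) {n : ℝ}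
    (hvu : ∀ t x, v t x ≤ ‖u t x‖ₑ) (hvt : ∀ t x, n < ‖t‖ → v t x = 0)
    (hvx : ∀ t x, n < ‖x‖ → v t x = 0) :
    mixedNorm qt q φ (fun t => mixedNorm rt r ψ (v t)) ≤ D * (CA * CB) ^ (1 / 2 : ℝ) := by
  have huE : ∀ t x, ‖u t x‖ₑ ≤ ENNReal.ofReal c := fun t x => by
    rw [← ofReal_norm]; exact ENNReal.ofReal_le_ofReal (huc t x)
  have hvc : ∀ t x, v t x ≤ ENNReal.ofReal c := fun t x => (hvu t x).trans (huE t x)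
  have hball : ∀ {p : ℝ} (_ : 2 ≤ p) (s : ℝ), volume (Metric.closedBall (0 : Space) s) ^ (1 / p) ≠ ⊤ :=
    fun hp s => ENNReal.rpow_ne_top_of_nonneg (by positivity) measure_closedBall_lt_top.ne
  have hball' : ∀ {p : ℝ} (_ : 2 ≤ p) (s : ℝ), volume (Metric.closedBall (0 : ℝ) s) ^ (1 / p) ≠ ⊤ :=
    fun hp s => ENNReal.rpow_ne_top_of_nonneg (by positivity) measure_closedBall_lt_top.ne
  have hm0 : ∀ t, n < ‖t‖ → mixedNorm rt r ψ (v t) = 0 := fun t ht => by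
    have := mixedNorm_le (p := rt) (q := r) (c := 0) (n := n) (by linarith) (by linarith)
      (fun y => (hvt t y ht).le) (hvx t) hψM hψρ
    simpa using this
  set d := ENNReal.ofReal c * M * volume (Metric.closedBall (0 : Space) n) ^ (1 / rt) *
      volume (Metric.closedBall (0 : Space) (n + ρ)) ^ (1 / r) with hd
  have hdtop : d ≠ ⊤ := ENNReal.mul_ne_top (ENNReal.mul_ne_top (ENNReal.mul_ne_top
    ENNReal.ofReal_ne_top hM) (hball hrt _)) (hball hr _)
  have hmd : ∀ t, mixedNorm rt r ψ (v t) ≤ d := fun t =>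
    mixedNorm_le (by linarith) (by linarith) (hvc t) (hvx t) hψM hψρ
  have hfin : ∀ t x, localNorm rt ψ (v t) x ≠ ⊤ := fun t x =>
    ((localNorm_le (by linarith) (hvc t) (hvx t) hψM x).trans_lt (lt_top_iff_ne_top.2
      (ENNReal.mul_ne_top (ENNReal.mul_ne_top ENNReal.ofReal_ne_top hM) (hball hrt _)))).ne
  have hfin' : ∀ t, mixedNorm rt r ψ (v t) ≠ ⊤ := fun t => ((hmd t).trans_lt hdtop.lt_top).ne
  have hfin'' : ∀ s, localNorm qt φ (fun t => mixedNorm rt r ψ (v t)) s ≠ ⊤ := fun s =>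
    ((localNorm_le (by linarith) hmd hm0 hφM s).trans_lt (lt_top_iff_ne_top.2
      (ENNReal.mul_ne_top (ENNReal.mul_ne_top hdtop hM) (hball' hqt _)))).ne
  set N := mixedNorm qt q φ (fun t => mixedNorm rt r ψ (v t)) with hN
  have hNtop : N ≠ ⊤ := ((mixedNorm_le (by linarith) (by linarith) hmd hm0 hφM hφρ).trans_lt
    (lt_top_iff_ne_top.2 (ENNReal.mul_ne_top (ENNReal.mul_ne_top (ENNReal.mul_ne_top hdtop hM)
      (hball' hqt _)) (hball' hq _)))).ne
  have hpair := lintegral_mul_spaceTimeDualFun (qt := qt) (q := q) (rt := rt) (r := r) (by linarith)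
    (by linarith) (by linarith) (by linarith) hφ hψ hv hfin hfin' hfin''
  have hquad := lintegral_spaceTimeDualFun_kernel_le hqt hq hrt hr hφ hψ hv hfin hfin' hfin'' hA hB
  rw [← hN] at hpair hquad
  set S := spaceTimeDualFun qt q rt r φ ψ v with hS
  have hSm : Measurable fun z : ℝ × Space => S z.1 z.2 := measurable_spaceTimeDualFun hφ hψ hv
  rw [← lintegral_prod_kernel_eq (S := S) hSm (measurable_powerWeight β δ) (measurable_powerWeight α γ)]
    at hquad
  have hSt : ∀ t x, n < ‖t‖ → S t x = 0 := fun t x ht => by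
    rw [hS, spaceTimeDualFun, dualFun_eq_zero (by linarith) (hvt t x ht), zero_mul]
  have hSx : ∀ t x, n < ‖x‖ → S t x = 0 := fun t x hx => by
    rw [hS, spaceTimeDualFun, dualFun_eq_zero (by linarith) (hvx t x hx), zero_mul]
  have hquadtop : ∫⁻ z : ℝ × Space, ∫⁻ z' : ℝ × Space, S z.1 z.2 *
      (powerWeight β δ (z.1 - z'.1) * powerWeight α γ (z.2 - z'.2)) * S z'.1 z'.2 < ⊤ := by
    refine hquad.trans_lt (lt_top_iff_ne_top.2 (ENNReal.mul_ne_top (ENNReal.mul_ne_top hCA hCB)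
      (ENNReal.pow_ne_top (ENNReal.rpow_ne_top_of_nonneg (by linarith) hNtop))))
  -- the weights are bounded below on the support of `S`, so `S` is integrable
  have hSint : ∫⁻ z : ℝ × Space, S z.1 z.2 < ⊤ := by
    obtain ⟨c₁, hc₁, h₁⟩ := exists_le_powerWeight (E := ℝ) hβ hδ (n + n)
    obtain ⟨c₂, hc₂, h₂⟩ := exists_le_powerWeight (E := Space) hα hγ (n + n)
    have hle : c₁ * c₂ * (∫⁻ z : ℝ × Space, S z.1 z.2) * (∫⁻ z : ℝ × Space, S z.1 z.2) < ⊤ := by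
      refine lt_of_le_of_lt ?_ hquadtop
      rw [← lintegral_const_mul _ hSm]
      refine lintegral_mono fun z => ?_
      rw [mul_right_comm, ← lintegral_const_mul _ hSm]
      refine lintegral_mono fun z' => ?_
      rcases lt_or_ge n ‖z.1‖ with h | hz1
      · simp [hSt _ _ h]
      rcases lt_or_ge n ‖z.2‖ with h | hz2
      · simp [hSx _ _ h]
      rcases lt_or_ge n ‖z'.1‖ with h | hz1'
      · simp [hSt _ _ h]
      rcases lt_or_ge n ‖z'.2‖ with h | hz2'
      · simp [hSx _ _ h]
      have k1 := h₁ (z.1 - z'.1) ((norm_sub_le _ _).trans (by linarith))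
      have k2 := h₂ (z.2 - z'.2) ((norm_sub_le _ _).trans (by linarith))
      calc _ = S z.1 z.2 * (c₁ * c₂) * S z'.1 z'.2 := by ring
        _ ≤ _ := by gcongr
    by_contra htop
    rw [not_lt, top_le_iff] at htop
    rw [htop, mul_assoc, ENNReal.top_mul_top, ENNReal.mul_top (mul_ne_zero hc₁ hc₂)] at hle
    exact lt_irrefl _ hle
  set G : ℝ × Space → Spinor := fun z =>
    ((S z.1 z.2).toReal * ‖u z.1 z.2‖⁻¹ : ℝ) • u z.1 z.2 with hG
  have hGm : AEStronglyMeasurable G := by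
    have h1 : Measurable fun z : ℝ × Space => (S z.1 z.2).toReal := hSm.ennreal_toReal
    have h2 : StronglyMeasurable fun z : ℝ × Space => u z.1 z.2 := hu
    exact ((h1.stronglyMeasurable.mul (h2.norm.measurable.inv.stronglyMeasurable)).smul
      h2).aestronglyMeasurable
  have hGS : ∀ z, ‖G z‖ₑ ≤ S z.1 z.2 := fun z => by
    rw [← ofReal_norm]
    refine (ENNReal.ofReal_le_ofReal ?_).trans ENNReal.ofReal_toReal_le
    rw [norm_smul, norm_mul, norm_inv, norm_norm, Real.norm_of_nonneg ENNReal.toReal_nonneg, mul_assoc]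
    exact mul_le_of_le_one_right ENNReal.toReal_nonneg inv_mul_le_one
  have hGint : Integrable G :=
    ⟨hGm, (lintegral_mono hGS).trans_lt hSint⟩
  have hinner : ∀ z, inner ℂ (G z) (u z.1 z.2) = (((S z.1 z.2).toReal * ‖u z.1 z.2‖ : ℝ) : ℂ) := by
    intro z
    rw [hG]
    dsimp only
    rw [RCLike.real_smul_eq_coe_smul (K := ℂ), inner_smul_left, inner_self_eq_norm_sq_to_K]
    rcases eq_or_ne (‖u z.1 z.2‖) 0 with h | h
    · rw [h]; simp
    · have : (‖u z.1 z.2‖ : ℂ) ≠ 0 := by exact_mod_cast h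
      simp
      field_simp
  have hlow : N ^ q ≤ ‖∫ z, inner ℂ (G z) (u z.1 z.2)‖ₑ := by
    simp_rw [hinner]
    have hm : Measurable fun z : ℝ × Space => (S z.1 z.2).toReal * ‖u z.1 z.2‖ := by
      have h2 : StronglyMeasurable fun z : ℝ × Space => u z.1 z.2 := hu
      exact hSm.ennreal_toReal.mul h2.norm.measurable
    rw [integral_complex_ofReal, ← ofReal_norm, Complex.norm_real, Real.norm_of_nonneg
      (integral_nonneg fun _ => by positivity)]
    have hint : Integrable fun z : ℝ × Space => (S z.1 z.2).toReal * ‖u z.1 z.2‖ := by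
      refine Integrable.mul_bdd (c := c) ?_ ?_ ?_
      · exact integrable_toReal_of_lintegral_ne_top hSm.aemeasurable hSint.ne
      · have h2 : StronglyMeasurable fun z : ℝ × Space => u z.1 z.2 := hu
        exact h2.norm.aestronglyMeasurable
      · exact ae_of_all _ fun z => by rw [norm_norm]; exact huc _ _
    rw [ofReal_integral_eq_lintegral_ofReal hint (ae_of_all _ fun _ => by positivity), ← hpair]
    have hvS : Measurable fun z : ℝ × Space => v z.1 z.2 * S z.1 z.2 := by
      have : Measurable fun z : ℝ × Space => v z.1 z.2 := hv
      exact this.mul hSm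
    rw [← lintegral_prod (fun z : ℝ × Space => v z.1 z.2 * S z.1 z.2) hvS.aemeasurable]
    refine lintegral_mono_ae ?_
    filter_upwards [ae_lt_top hSm hSint.ne] with z hz
    rw [ENNReal.ofReal_mul ENNReal.toReal_nonneg, ENNReal.ofReal_toReal hz.ne, ofReal_norm, mul_comm]
    gcongr
    exact hvu _ _
  have hmain : N ^ q ≤ D * (CA * CB) ^ (1 / 2 : ℝ) * N ^ (q - 1) := by
    refine hlow.trans ((hD G hGint).trans ?_)
    rw [mul_assoc]
    gcongr
    calc _ ≤ (CA * CB * (N ^ (q - 1)) ^ 2) ^ (1 / 2 : ℝ) := by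
          gcongr
          refine le_trans ?_ hquad
          gcongr <;> apply hGS
      _ = _ := by
          rw [ENNReal.mul_rpow_of_nonneg _ _ (by positivity), ← ENNReal.rpow_natCast (N ^ (q - 1)),
            ← ENNReal.rpow_mul (N ^ (q - 1))]
          norm_num
  rcases eq_or_ne N 0 with h0 | h0
  · rw [h0]; exact zero_le
  have hq1 : N ^ q = N * N ^ (q - 1) := by
    nth_rw 2 [← ENNReal.rpow_one N]
    rw [← ENNReal.rpow_add _ _ h0 hNtop]; congr 1; ring
  rw [hq1] at hmain
  exact (ENNReal.mul_le_mul_iff_left (ENNReal.rpow_pos (pos_iff_ne_zero.2 h0) hNtop).ne'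
    (ENNReal.rpow_ne_top_of_nonneg (by linarith) hNtop)).1 hmain

/-- A bound for the pairing of `u` with all integrable `G`, in terms of a quadratic form with a product
kernel, is a bound for the amalgam norm of `u`. -/
theorem mixedNorm_le_of_pairing (hqt : 2 ≤ qt) (hq : 2 ≤ q) (hrt : 2 ≤ rt) (hr : 2 ≤ r)
    (hφ : Measurable φ) (hψ : Measurable ψ) (hM : M ≠ ⊤) (hφM : ∀ t, φ t ≤ M)
    (hψM : ∀ x, ψ x ≤ M) (hφρ : ∀ t, ρ < ‖t‖ → φ t = 0) (hψρ : ∀ x, ρ < ‖x‖ → ψ x = 0)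
    (hβ : 0 ≤ β) (hδ : 0 ≤ δ) (hα : 0 ≤ α) (hγ : 0 ≤ γ)
    (hA : IsAmalgamKernel qt q φ (powerWeight β δ) a CA) (hCA : CA ≠ ⊤)
    (hB : IsAmalgamKernel rt r ψ (powerWeight α γ) b CB) (hCB : CB ≠ ⊤)
    {u : ℝ → Space → Spinor} (hu : StronglyMeasurable (Function.uncurry u)) {c : ℝ}
    (huc : ∀ t x, ‖u t x‖ ≤ c)
    (hD : ∀ G : ℝ × Space → Spinor, Integrable G →
      ‖∫ z, inner ℂ (G z) (u z.1 z.2)‖ₑ ≤ D * (∫⁻ z, ∫⁻ z', ‖G z‖ₑ *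
        (powerWeight β δ (z.1 - z'.1) * powerWeight α γ (z.2 - z'.2)) * ‖G z'‖ₑ) ^ (1 / 2 : ℝ)) :
    mixedNorm qt q φ (fun t => mixedNorm rt r ψ (fun x => ‖u t x‖ₑ)) ≤
      D * (CA * CB) ^ (1 / 2 : ℝ) := by
  set v : ℕ → ℝ → Space → ℝ≥0∞ := fun n t x =>
    if ‖t‖ ≤ n ∧ ‖x‖ ≤ n then ‖u t x‖ₑ else 0 with hv
  have hvm : ∀ n, Measurable (Function.uncurry (v n)) := fun n => by
    have h2 : StronglyMeasurable fun z : ℝ × Space => u z.1 z.2 := hu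
    have h3 : MeasurableSet {z : ℝ × Space | ‖z.1‖ ≤ n} := measurableSet_le (by fun_prop) (by fun_prop)
    have h4 : MeasurableSet {z : ℝ × Space | ‖z.2‖ ≤ n} := measurableSet_le (by fun_prop) (by fun_prop)
    exact Measurable.ite (p := fun z : ℝ × Space => ‖z.1‖ ≤ n ∧ ‖z.2‖ ≤ n) (h3.inter h4) h2.enorm
      measurable_const
  have hlim : ∀ t x, ‖u t x‖ₑ ≤ Filter.liminf (fun n => v n t x) Filter.atTop := fun t x => by
    refine Filter.le_liminf_of_le (by isBoundedDefault) ?_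
    filter_upwards [Filter.eventually_ge_atTop (max ⌈‖t‖⌉₊ ⌈‖x‖⌉₊)] with n hn
    simp only [hv]
    rw [if_pos]
    exact ⟨Nat.ceil_le.1 ((le_max_left _ _).trans hn), Nat.ceil_le.1 ((le_max_right _ _).trans hn)⟩
  refine (mixedNorm_le_liminf (by linarith) (by linarith) hφ (fun y => ((hφM y).trans_lt
    hM.lt_top).ne) (fun n => measurable_mixedNorm hψ (hvm n)) (ae_of_all _ fun t =>
    mixedNorm_le_liminf (by linarith) (by linarith) hψ (fun y => ((hψM y).trans_lt
    hM.lt_top).ne) (fun n => (hvm n).comp (measurable_prodMk_left (x := t))) (ae_of_all _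
    fun x => hlim t x))).trans ?_
  refine Filter.liminf_le_of_le (by isBoundedDefault) fun y hy => ?_
  obtain ⟨n, hn⟩ := hy.exists
  refine hn.trans (mixedNorm_le_of_pairing_of_support hqt hq hrt hr hφ hψ hM hφM hψM hφρ hψρ hβ hδ
    hα hγ hA hCA hB hCB hu huc hD (hvm n) (n := n) (fun t x => ?_) (fun t x h => ?_)
    (fun t x h => ?_))
  · simp only [hv]; split_ifs
    · exact le_rfl
    · exact zero_le
  · simp only [hv]; rw [if_neg]; exact fun h' => h.not_ge h'.1
  · simp only [hv]; rw [if_neg]; exact fun h' => h.not_ge h'.2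

end Duality

/-! ### The Dirac propagator -/

/-- The anticommutation relations `(α · ξ + β)² = 1 + |ξ|²` of the Dirac matrices. -/
theorem diracSymbol_mul_self (ξ : Space) :
    diracSymbol ξ * diracSymbol ξ = ((japanese (2 * Real.pi * ‖ξ‖) ^ 2 : ℝ) : ℂ) • 1 := by
  have hn : ‖ξ‖ ^ 2 = ξ 0 ^ 2 + ξ 1 ^ 2 + ξ 2 ^ 2 := by
    rw [EuclideanSpace.real_norm_sq_eq, Fin.sum_univ_three]
  rw [japanese_sq, mul_pow, hn]
  have hp : ∀ (a b c : ℝ), (∑ j : Fin 3, (((![a, b, c] j : ℝ)) : ℂ) • pauli j) =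
      !![(c : ℂ), a - b * Complex.I; a + b * Complex.I, -c] := by
    intro a b c
    ext i j
    fin_cases i <;> fin_cases j <;> simp [pauli, Fin.sum_univ_three, sub_eq_add_neg]
  set a := 2 * Real.pi * ξ 0
  set b := 2 * Real.pi * ξ 1
  set c := 2 * Real.pi * ξ 2
  set P : Matrix (Fin 2) (Fin 2) ℂ := !![(c : ℂ), a - b * Complex.I; a + b * Complex.I, -c] with hP
  have h1 : diracSymbol ξ = Matrix.reindex (finSumFinEquiv (m := 2) (n := 2))
      (finSumFinEquiv (m := 2) (n := 2)) (Matrix.fromBlocks 1 P P (-1)) := by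
    have hP' : P = ∑ j : Fin 3, ((2 * Real.pi * ξ j : ℝ) : ℂ) • pauli j := by
      rw [hP, ← hp]
      refine Finset.sum_congr rfl fun j _ => ?_
      fin_cases j <;> rfl
    ext i j
    rw [hP']
    simp only [diracSymbol, diracAlpha, diracBeta, Matrix.add_apply, Matrix.sum_apply,
      Matrix.smul_apply, Matrix.reindex_apply, Matrix.submatrix_apply]
    rcases (finSumFinEquiv (m := 2) (n := 2)).symm i with i | i <;>
      rcases (finSumFinEquiv (m := 2) (n := 2)).symm j with j | j <;>
      simp [Matrix.sum_apply]
  have hPP : P * P = ((a ^ 2 + b ^ 2 + c ^ 2 : ℝ) : ℂ) • 1 := by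
    ext i j
    fin_cases i <;> fin_cases j <;> simp [hP, Matrix.mul_apply, Fin.sum_univ_two] <;> ring_nf <;>
      simp
  rw [h1, Matrix.reindex_apply, Matrix.submatrix_mul_equiv, Matrix.fromBlocks_multiply]
  simp only [one_mul, mul_one, hPP, mul_neg, neg_mul, add_neg_cancel, neg_neg]
  rw [← Matrix.submatrix_one_equiv (finSumFinEquiv (m := 2) (n := 2)).symm, ← Matrix.fromBlocks_one]
  ext i j
  simp only [Matrix.smul_apply, Matrix.submatrix_apply]
  rcases (finSumFinEquiv (m := 2) (n := 2)).symm i with i | i <;>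
      rcases (finSumFinEquiv (m := 2) (n := 2)).symm j with j | j <;>
    simp [a, b, c] <;> ring

theorem diracSymbolCLM_mul_self (ξ : Space) :
    diracSymbolCLM ξ * diracSymbolCLM ξ = ((japanese (2 * Real.pi * ‖ξ‖) ^ 2 : ℝ) : ℂ) • 1 := by
  rw [diracSymbolCLM, ← map_mul, diracSymbol_mul_self, map_smul, map_one]

theorem norm_diracSymbolCLM_le (ξ : Space) :
    ‖diracSymbolCLM ξ‖ ≤ japanese (2 * Real.pi * ‖ξ‖) := by
  have hs : star (diracSymbolCLM ξ) = diracSymbolCLM ξ := by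
    rw [diracSymbolCLM, ← map_star, Matrix.star_eq_conjTranspose, (diracSymbol_isHermitian ξ).eq]
  have h := CStarRing.norm_star_mul_self (x := diracSymbolCLM ξ)
  rw [hs, diracSymbolCLM_mul_self, norm_smul, norm_one, mul_one, Complex.norm_real,
    Real.norm_of_nonneg (by positivity)] at h
  nlinarith [norm_nonneg (diracSymbolCLM ξ), japanese_pos (2 * Real.pi * ‖ξ‖)]

/-- For `s = ±1`, the spectral projection of the symbol of `𝒟 + β` onto its eigenvalue
`s⟨2πξ⟩`. -/
def diracProjection (s : ℝ) (ξ : Space) : Spinor →L[ℂ] Spinor :=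
  (1 / 2 : ℂ) • (1 + ((s / japanese (2 * Real.pi * ‖ξ‖) : ℝ) : ℂ) • diracSymbolCLM ξ)

theorem norm_diracProjection_le {s : ℝ} (hs : |s| = 1) (ξ : Space) :
    ‖diracProjection s ξ‖ ≤ 1 := by
  have hm := japanese_pos (2 * Real.pi * ‖ξ‖)
  have h : ‖((s / japanese (2 * Real.pi * ‖ξ‖) : ℝ) : ℂ) • diracSymbolCLM ξ‖ ≤ 1 := by
    rw [norm_smul, Complex.norm_real, Real.norm_eq_abs, abs_div, hs, abs_of_pos hm,
      one_div_mul_eq_div, div_le_one hm]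
    exact norm_diracSymbolCLM_le ξ
  rw [diracProjection, norm_smul]
  calc _ ≤ (1 / 2 : ℝ) * (1 + 1) := by
        gcongr
        · simp
        · exact (norm_add_le _ _).trans (add_le_add norm_one.le h)
    _ = 1 := by norm_num

theorem continuous_diracProjection (s : ℝ) : Continuous (diracProjection s) := by
  have h : Continuous diracSymbol := by
    unfold diracSymbol
    fun_prop
  have h2 : Continuous (Matrix.toEuclideanCLM (n := Fin 4) (𝕜 := ℂ)) :=
    LinearMap.continuous_of_finiteDimensional
      (Matrix.toEuclideanCLM (n := Fin 4) (𝕜 := ℂ)).toAlgEquiv.toLinearMap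
  have h3 : Continuous fun ξ : Space => ((s / japanese (2 * Real.pi * ‖ξ‖) : ℝ) : ℂ) :=
    Complex.continuous_ofReal.comp (continuous_const.div (by fun_prop)
      fun ξ => (japanese_pos _).ne')
  have h4 : Continuous fun ξ : Space => (1 : Spinor →L[ℂ] Spinor) +
      ((s / japanese (2 * Real.pi * ‖ξ‖) : ℝ) : ℂ) • diracSymbolCLM ξ :=
    continuous_const.add (h3.smul (h2.comp h))
  exact h4.const_smul (1 / 2 : ℂ)

theorem diracPropagator_eq (t : ℝ) (ξ : Space) :
    diracPropagator t ξ =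
      Complex.exp (Complex.I * ((-t * japanese (2 * Real.pi * ‖ξ‖) : ℝ) : ℂ)) • diracProjection 1 ξ +
      Complex.exp (Complex.I * ((t * japanese (2 * Real.pi * ‖ξ‖) : ℝ) : ℂ)) •
        diracProjection (-1) ξ := by
  set L := diracSymbolCLM ξ with hL
  have hm := japanese_pos (2 * Real.pi * ‖ξ‖)
  set m := japanese (2 * Real.pi * ‖ξ‖) with hmdef
  have hLL : L * L = ((m : ℂ) ^ 2) • 1 := by
    rw [hL, diracSymbolCLM_mul_self]; push_cast; rfl
  have hmc : (m : ℂ) ≠ 0 := by exact_mod_cast hm.ne'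
  have h1 : L * diracProjection 1 ξ = (m : ℂ) • diracProjection 1 ξ := by
    rw [diracProjection, ← hL, ← hmdef, mul_smul_comm, mul_add, mul_one, mul_smul_comm, hLL]
    match_scalars <;> field_simp
  have h2 : L * diracProjection (-1) ξ = (-m : ℂ) • diracProjection (-1) ξ := by
    rw [diracProjection, ← hL, ← hmdef, mul_smul_comm, mul_add, mul_one, mul_smul_comm, hLL]
    match_scalars <;> field_simp
  have h3 : diracProjection 1 ξ + diracProjection (-1) ξ = 1 := by
    rw [diracProjection, diracProjection]
    match_scalars <;> ring
  have hpow : ∀ k : ℕ, L ^ k = (m : ℂ) ^ k • diracProjection 1 ξ +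
      (-m : ℂ) ^ k • diracProjection (-1) ξ := by
    intro k
    induction k with
    | zero => simp [h3]
    | succ k ih =>
      rw [pow_succ', ih, mul_add, mul_smul_comm, mul_smul_comm, h1, h2, smul_smul, smul_smul,
        ← pow_succ, ← pow_succ]
  have hexp : ∀ z : ℂ, HasSum (fun k : ℕ => (k.factorial : ℂ)⁻¹ • z ^ k) (Complex.exp z) := fun z => by
    rw [Complex.exp_eq_exp_ℂ]; exact NormedSpace.exp_series_hasSum_exp' (𝕂 := ℂ) z
  have hs := NormedSpace.exp_series_hasSum_exp' (𝕂 := ℂ) (-(Complex.I * (t : ℂ)) • L)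
  refine hs.unique ?_
  convert! ((hexp (Complex.I * ((-t * m : ℝ) : ℂ))).smul_const (diracProjection 1 ξ)).add
    ((hexp (Complex.I * ((t * m : ℝ) : ℂ))).smul_const (diracProjection (-1) ξ)) using 2 with k
  rw [smul_pow, hpow]
  have e1 : Complex.I * ((-t * m : ℝ) : ℂ) = -(Complex.I * t) * m := by push_cast; ring
  have e2 : Complex.I * ((t * m : ℝ) : ℂ) = -(Complex.I * t) * (-m) := by push_cast; ring
  rw [e1, e2, mul_pow, mul_pow]
  simp only [smul_add, smul_smul, smul_eq_mul]

/-! ### The inverse Fourier transform of an integrable square-integrable function -/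

/-- For an integrable function, the inverse Fourier transform on `L²` is given by the Fourier
integral. -/
theorem fourierInv_ae_eq {E F : Type*} [NormedAddCommGroup E] [InnerProductSpace ℝ E]
    [FiniteDimensional ℝ E] [MeasurableSpace E] [BorelSpace E] [NormedAddCommGroup F]
    [InnerProductSpace ℂ F] [CompleteSpace F] (h : Lp (α := E) F 2 volume)
    (hint : Integrable (h : E → F)) :
    ((𝓕⁻ h : Lp (α := E) F 2 volume) : E → F) =ᵐ[volume] 𝓕⁻ (h : E → F) := by
  have hL : Continuous fun p : E × E => (-innerₗ E) p.1 p.2 :=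
    (continuous_fst.inner continuous_snd).neg
  have hcont : Continuous (𝓕⁻ (h : E → F)) :=
    VectorFourier.fourierIntegral_continuous (L := -innerₗ E) Real.continuous_fourierChar
      hL hint
  refine ae_eq_of_integral_contDiff_smul_eq
    ((Lp.memLp (𝓕⁻ h : Lp (α := E) F 2 volume)).locallyIntegrable (by norm_num))
    hcont.locallyIntegrable fun g hg hg' => ?_
  set G : 𝓢(E, ℂ) := HasCompactSupport.toSchwartzMap (f := fun x => (g x : ℂ))
    (hg'.comp_left Complex.ofReal_zero) (Complex.ofRealCLM.contDiff.comp hg) with hG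
  have hGg : ∀ x, G x = (g x : ℂ) := fun x => rfl
  have h1 := congrArg (fun T : 𝓢'(E, F) => T G) (Lp.fourierInv_toTemperedDistribution_eq h)
  simp only [TemperedDistribution.fourierInv_apply, Lp.toTemperedDistribution_apply] at h1
  have h2 := VectorFourier.integral_fourierIntegral_smul_eq_flip (L := -innerₗ E) (μ := volume)
    (ν := volume) (f := (G : E → ℂ)) (g := (h : E → F)) Real.continuous_fourierChar hL
    G.integrable hint
  have hflip : (-innerₗ E).flip = -innerₗ E := by
    ext x y
    simp [real_inner_comm]
  rw [hflip] at h2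
  calc ∫ x, g x • (𝓕⁻ h : Lp (α := E) F 2 volume) x
      = ∫ x, G x • (𝓕⁻ h : Lp (α := E) F 2 volume) x := by
        simp only [hGg, Complex.coe_smul]
    _ = ∫ x, (𝓕⁻ G : 𝓢(E, ℂ)) x • h x := h1.symm
    _ = ∫ x, G x • 𝓕⁻ (h : E → F) x := by
        rw [SchwartzMap.fourierInv_coe]; exact h2
    _ = _ := by simp only [hGg, Complex.coe_smul]

/-! ### The flow of band-limited data -/

theorem sobolevNorm_eq (σ : ℝ) (f : SpinorL2) :
    sobolevNorm σ f = eLpNorm (fun ξ : Space => japanese (2 * Real.pi * ‖ξ‖) ^ σ •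
      (𝓕 f : SpinorL2) ξ) 2 volume := by
  unfold sobolevNorm
  congr 1
  ext1 ξ
  rw [norm_smul, Real.norm_of_nonneg (by positivity), japanese, Real.sqrt_eq_rpow,
    ← Real.rpow_mul (by positivity)]
  ring_nf

theorem sobolevNorm_mono {σ σ' : ℝ} (h : σ' ≤ σ) (f : SpinorL2) :
    sobolevNorm σ' f ≤ sobolevNorm σ f := by
  rw [sobolevNorm_eq, sobolevNorm_eq]
  refine eLpNorm_mono fun ξ => ?_
  rw [norm_smul, norm_smul, Real.norm_of_nonneg (Real.rpow_nonneg (japanese_pos _).le _),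
    Real.norm_of_nonneg (Real.rpow_nonneg (japanese_pos _).le _)]
  gcongr
  exact one_le_japanese _

/-- The part of the flow, of frequencies at most `n`, of the data with Fourier transform `g`, that
lies in the positive (`s = 1`) or negative (`s = -1`) spectral subspace of `𝒟 + β`. -/
def halfFlow (s n : ℝ) (g : Space → Spinor) (t : ℝ) (x : Space) : Spinor :=
  ∫ ξ in Metric.closedBall (0 : Space) n,
    (Complex.exp (Complex.I * ((2 * Real.pi * inner ℝ x ξ : ℝ) : ℂ)) *
      Complex.exp (Complex.I * ((-(s * t) * japanese (2 * Real.pi * ‖ξ‖) : ℝ) : ℂ))) •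
        diracProjection s ξ (g ξ)

theorem norm_exp_I_mul_ofReal (y : ℝ) : ‖Complex.exp (Complex.I * (y : ℂ))‖ = 1 := by
  rw [mul_comm, Complex.norm_exp_ofReal_mul_I]

theorem continuous_japanese_norm_rpow (σ : ℝ) :
    Continuous fun ξ : Space => japanese (2 * Real.pi * ‖ξ‖) ^ σ :=
  (continuous_japanese_rpow σ).comp (by fun_prop)

theorem continuous_phase (s : ℝ) : Continuous fun p : (ℝ × Space) × Space =>
    Complex.exp (Complex.I * ((2 * Real.pi * inner ℝ p.1.2 p.2 : ℝ) : ℂ)) *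
      Complex.exp (Complex.I * ((-(s * p.1.1) * japanese (2 * Real.pi * ‖p.2‖) : ℝ) : ℂ)) := by
  have h : Continuous fun p : (ℝ × Space) × Space => inner ℝ p.1.2 p.2 :=
    (by fun_prop : Continuous fun p : (ℝ × Space) × Space => p.1.2).inner continuous_snd
  fun_prop

theorem stronglyMeasurable_diracProjection (s : ℝ) (f : SpinorL2) :
    StronglyMeasurable (fun ξ : Space => diracProjection s ξ (f ξ)) :=
  (ContinuousLinearMap.apply ℂ Spinor).flip.continuous₂.comp_stronglyMeasurable
    ((continuous_diracProjection s).stronglyMeasurable.prodMk (Lp.stronglyMeasurable f))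

/-- The `TT*` inequality for a half-wave; half of the derivatives in `kleinGordonKernel` go with each
of the two factors. -/
theorem enorm_integral_inner_halfFlow_le {s n a σ α β γ δ : ℝ} {C : ℝ≥0} (hs : s = 1 ∨ s = -1)
    (hσ : 0 ≤ σ) (haσ : a - 3 = -(2 * σ))
    (hC : ∀ (t : ℝ) (x : Space),
      ‖kleinGordonKernel a n t x‖ₑ ≤ C * (powerWeight β δ t * powerWeight α γ x))
    (f : SpinorL2) {G : ℝ × Space → Spinor} (hG : Integrable G) :
    ‖∫ z, inner ℂ (G z) (halfFlow s n (𝓕 f : SpinorL2) z.1 z.2)‖ₑ ≤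
      (C : ℝ≥0∞) ^ (1 / 2 : ℝ) * sobolevNorm σ f * (∫⁻ z, ∫⁻ z', ‖G z‖ₑ *
        (powerWeight β δ (z.1 - z'.1) * powerWeight α γ (z.2 - z'.2)) * ‖G z'‖ₑ) ^ (1 / 2 : ℝ) := by
  have hs1 : |s| = 1 := by rcases hs with rfl | rfl <;> simp
  set m : Space → ℝ := fun ξ => japanese (2 * Real.pi * ‖ξ‖) with hm
  have hm1 : ∀ ξ, 1 ≤ m ξ := fun ξ => one_le_japanese _
  have hm0 : ∀ ξ, 0 < m ξ := fun ξ => japanese_pos _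
  set μ := (volume : Measure Space).restrict (Metric.closedBall 0 n) with hμ
  have : IsFiniteMeasure μ := ⟨by rw [hμ, Measure.restrict_apply_univ]; exact measure_closedBall_lt_top⟩
  set e : ℝ × Space → Space → ℂ := fun z ξ =>
    (Complex.exp (Complex.I * ((2 * Real.pi * inner ℝ z.2 ξ : ℝ) : ℂ)) *
      Complex.exp (Complex.I * ((-(s * z.1) * japanese (2 * Real.pi * ‖ξ‖) : ℝ) : ℂ))) *
        ((m ξ ^ (-σ) : ℝ) : ℂ) with he
  set g : Space → Spinor := fun ξ => m ξ ^ σ • diracProjection s ξ ((𝓕 f : SpinorL2) ξ) with hg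
  have hem : StronglyMeasurable (Function.uncurry e) :=
    ((continuous_phase s).mul (Complex.continuous_ofReal.comp
      ((continuous_japanese_norm_rpow (-σ)).comp continuous_snd))).stronglyMeasurable
  have he1 : ∀ z ξ, ‖e z ξ‖ ≤ 1 := fun z ξ => by
    rw [he]
    simp only [norm_mul, norm_exp_I_mul_ofReal, one_mul, Complex.norm_real]
    rw [Real.norm_of_nonneg (Real.rpow_nonneg (hm0 _).le _)]
    exact Real.rpow_le_one_of_one_le_of_nonpos (hm1 _) (by linarith)
  have hgm : StronglyMeasurable g := (continuous_japanese_norm_rpow σ).stronglyMeasurable.smul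
    (stronglyMeasurable_diracProjection s _)
  have hproj : ∀ ξ, ‖diracProjection s ξ ((𝓕 f : SpinorL2) ξ)‖ ≤ ‖(𝓕 f : SpinorL2) ξ‖ := fun ξ => by
    simpa using (diracProjection s ξ).le_of_opNorm_le (norm_diracProjection_le hs1 ξ) _
  have hgσ : eLpNorm g 2 μ ≤ sobolevNorm σ f := by
    rw [sobolevNorm_eq]
    refine (eLpNorm_mono_measure _ Measure.restrict_le_self).trans (eLpNorm_mono fun ξ => ?_)
    rw [hg]
    dsimp only
    rw [norm_smul, norm_smul]
    gcongr
    exact hproj ξ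
  have hgL : MemLp g 2 μ := by
    refine MemLp.of_le_mul (c := japanese (2 * Real.pi * n) ^ σ)
      ((Lp.memLp (𝓕 f : SpinorL2)).restrict (Metric.closedBall 0 n)) hgm.aestronglyMeasurable ?_
    filter_upwards [ae_restrict_mem Metric.isClosed_closedBall.measurableSet] with ξ hξ
    rw [hg]
    dsimp only
    rw [norm_smul, Real.norm_of_nonneg (Real.rpow_nonneg (hm0 _).le _)]
    rw [mem_closedBall_zero_iff] at hξ
    refine mul_le_mul (Real.rpow_le_rpow (hm0 _).le (Real.sqrt_le_sqrt ?_) hσ) (hproj ξ)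
      (norm_nonneg _) (Real.rpow_nonneg (japanese_pos _).le _)
    gcongr
  have hflow : ∀ z : ℝ × Space, halfFlow s n (𝓕 f : SpinorL2) z.1 z.2 = ∫ ξ, e z ξ • g ξ ∂μ := by
    intro z
    refine integral_congr_ae (ae_of_all _ fun ξ => ?_)
    rw [he, hg]
    dsimp only
    rw [RCLike.real_smul_eq_coe_smul (K := ℂ), smul_smul]
    congr 1
    change _ = _ * ((m ξ ^ (-σ) : ℝ) : ℂ) * ((m ξ ^ σ : ℝ) : ℂ)
    rw [mul_assoc _ ((m ξ ^ (-σ) : ℝ) : ℂ), ← Complex.ofReal_mul, ← Real.rpow_add (hm0 ξ),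
      neg_add_cancel, Real.rpow_zero, Complex.ofReal_one, mul_one]
  have hker : ∀ z z' : ℝ × Space, ‖∫ ξ, e z ξ * (starRingEnd ℂ) (e z' ξ) ∂μ‖ₑ ≤
      C * (powerWeight β δ (z.1 - z'.1) * powerWeight α γ (z.2 - z'.2)) := by
    intro z z'
    have h1 : ∫ ξ, e z ξ * (starRingEnd ℂ) (e z' ξ) ∂μ =
        kleinGordonKernel a n (s * (z.1 - z'.1)) (z.2 - z'.2) := by
      refine integral_congr_ae (ae_of_all _ fun ξ => ?_)
      rw [he]
      dsimp only
      rw [map_mul, map_mul, ← Complex.exp_conj, ← Complex.exp_conj, map_mul, map_mul,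
        Complex.conj_I, Complex.conj_ofReal, Complex.conj_ofReal, Complex.conj_ofReal, haσ,
        show -(2 * σ) = -σ + -σ by ring, Real.rpow_add (japanese_pos _), ← Complex.exp_add,
        ← Complex.exp_add]
      have h2 : ∀ (A B : ℂ) (p : ℂ), Complex.exp A * p * (Complex.exp B * p) =
          Complex.exp (A + B) * (p * p) := fun A B p => by rw [Complex.exp_add]; ring
      rw [h2, ← mul_assoc (Complex.exp _) (Complex.exp _), ← Complex.exp_add]
      congr 1
      · congr 1
        rw [inner_sub_left]
        push_cast
        ring
      · push_cast; rfl
    rw [h1]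
    refine (hC _ _).trans_eq ?_
    rcases hs with rfl | rfl
    · rw [one_mul]
    · rw [neg_one_mul, powerWeight_neg]
  simp_rw [hflow]
  refine (enorm_integral_inner_le hem he1 hgL hG).trans ?_
  calc _ ≤ sobolevNorm σ f * (∫⁻ z, ∫⁻ z', C * (‖G z‖ₑ *
        (powerWeight β δ (z.1 - z'.1) * powerWeight α γ (z.2 - z'.2)) * ‖G z'‖ₑ)) ^ (1 / 2 : ℝ) := by
        refine mul_le_mul' hgσ (ENNReal.rpow_le_rpow (lintegral_mono fun z =>
          lintegral_mono fun z' => ?_) (by positivity))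
        refine (mul_le_mul' (mul_le_mul' le_rfl (hker z z')) le_rfl).trans_eq ?_
        ring
    _ = _ := by
        simp_rw [lintegral_const_mul' _ _ ENNReal.coe_ne_top]
        rw [ENNReal.mul_rpow_of_nonneg _ _ (by positivity)]
        ring

theorem integrableOn_closedBall_fourier (n : ℝ) (f : SpinorL2) :
    IntegrableOn (f : Space → Spinor) (Metric.closedBall 0 n) :=
  ((Lp.memLp f).locallyIntegrable (by norm_num)).integrableOn_isCompact (isCompact_closedBall 0 n)

theorem stronglyMeasurable_halfFlow (s n : ℝ) (f : SpinorL2) :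
    StronglyMeasurable (Function.uncurry (halfFlow s n f)) := by
  refine StronglyMeasurable.integral_prod_right (f := fun (z : ℝ × Space) ξ =>
    (Complex.exp (Complex.I * ((2 * Real.pi * inner ℝ z.2 ξ : ℝ) : ℂ)) *
      Complex.exp (Complex.I * ((-(s * z.1) * japanese (2 * Real.pi * ‖ξ‖) : ℝ) : ℂ))) •
        diracProjection s ξ (f ξ)) ?_
  exact (continuous_phase s).stronglyMeasurable.smul
    ((stronglyMeasurable_diracProjection s f).comp_measurable measurable_snd)

theorem norm_halfFlow_le {s : ℝ} (hs : |s| = 1) (n : ℝ) (f : SpinorL2) (t : ℝ) (x : Space) :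
    ‖halfFlow s n f t x‖ ≤ ∫ ξ in Metric.closedBall (0 : Space) n, ‖f ξ‖ := by
  refine norm_integral_le_of_norm_le (integrableOn_closedBall_fourier n f).norm
    (ae_of_all _ fun ξ => ?_)
  rw [norm_smul, norm_mul, norm_exp_I_mul_ofReal, norm_exp_I_mul_ofReal, one_mul, one_mul]
  simpa using (diracProjection s ξ).le_of_opNorm_le (norm_diracProjection_le hs ξ) (f ξ)

/-- The part of the Dirac flow with data `f` at frequencies at most `n`. -/
def truncatedFlow (n : ℝ) (f : SpinorL2) (t : ℝ) (x : Space) : Spinor :=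
  halfFlow 1 n (𝓕 f : SpinorL2) t x + halfFlow (-1) n (𝓕 f : SpinorL2) t x

theorem stronglyMeasurable_truncatedFlow (n : ℝ) (f : SpinorL2) :
    StronglyMeasurable (Function.uncurry (truncatedFlow n f)) :=
  (stronglyMeasurable_halfFlow 1 n _).add (stronglyMeasurable_halfFlow (-1) n _)

section Bound

variable {qt q rt r α β γ δ ρ n a σ : ℝ} {φ : ℝ → ℝ≥0∞} {ψ : Space → ℝ≥0∞} {M : ℝ≥0∞}
  {bt : ℝ → ℝ≥0∞} {bx : Space → ℝ≥0∞} {CA CB : ℝ≥0∞} {C : ℝ≥0}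

theorem mixedNorm_truncatedFlow_le (hqt : 2 ≤ qt) (hq : 2 ≤ q) (hrt : 2 ≤ rt) (hr : 2 ≤ r)
    (hφ : Measurable φ) (hψ : Measurable ψ) (hM : M ≠ ⊤) (hφM : ∀ t, φ t ≤ M)
    (hψM : ∀ x, ψ x ≤ M) (hφρ : ∀ t, ρ < ‖t‖ → φ t = 0) (hψρ : ∀ x, ρ < ‖x‖ → ψ x = 0)
    (hβ : 0 ≤ β) (hδ : 0 ≤ δ) (hα : 0 ≤ α) (hγ : 0 ≤ γ)
    (hA : IsAmalgamKernel qt q φ (powerWeight β δ) bt CA) (hCA : CA ≠ ⊤)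
    (hB : IsAmalgamKernel rt r ψ (powerWeight α γ) bx CB) (hCB : CB ≠ ⊤)
    (hσ : 0 ≤ σ) (haσ : a - 3 = -(2 * σ))
    (hC : ∀ (t : ℝ) (x : Space),
      ‖kleinGordonKernel a n t x‖ₑ ≤ C * (powerWeight β δ t * powerWeight α γ x))
    (f : SpinorL2) :
    mixedNorm qt q φ (fun t => mixedNorm rt r ψ (fun x => ‖truncatedFlow n f t x‖ₑ)) ≤
      2 * ((C : ℝ≥0∞) ^ (1 / 2 : ℝ) * sobolevNorm σ f) * (CA * CB) ^ (1 / 2 : ℝ) := by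
  have hbd : ∀ s : ℝ, s = 1 ∨ s = -1 → ∀ z : ℝ × Space, ‖halfFlow s n (𝓕 f : SpinorL2) z.1 z.2‖ ≤
      ∫ ξ in Metric.closedBall (0 : Space) n, ‖(𝓕 f : SpinorL2) ξ‖ := fun s hs z =>
    norm_halfFlow_le (by rcases hs with rfl | rfl <;> simp) n _ z.1 z.2
  have hint : ∀ s : ℝ, s = 1 ∨ s = -1 → ∀ G : ℝ × Space → Spinor, Integrable G →
      Integrable fun z => inner ℂ (G z) (halfFlow s n (𝓕 f : SpinorL2) z.1 z.2) := by
    intro s hs G hG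
    have hm : AEStronglyMeasurable fun z : ℝ × Space => halfFlow s n (𝓕 f : SpinorL2) z.1 z.2 :=
      (stronglyMeasurable_halfFlow s n _).aestronglyMeasurable
    refine (hG.norm.mul_const (∫ ξ in Metric.closedBall (0 : Space) n, ‖(𝓕 f : SpinorL2) ξ‖)).mono'
      (hG.aestronglyMeasurable.inner hm) (ae_of_all _ fun z => ?_)
    exact (norm_inner_le_norm _ _).trans (by gcongr; exact hbd s hs z)
  refine mixedNorm_le_of_pairing hqt hq hrt hr hφ hψ hM hφM hψM hφρ hψρ hβ hδ hα hγ hA hCA hB hCB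
    (stronglyMeasurable_truncatedFlow n f) (fun t x => (norm_add_le _ _).trans (add_le_add
      (hbd 1 (Or.inl rfl) (t, x)) (hbd (-1) (Or.inr rfl) (t, x)))) fun G hG => ?_
  simp only [truncatedFlow, inner_add_right]
  rw [integral_add (hint 1 (Or.inl rfl) G hG) (hint (-1) (Or.inr rfl) G hG), two_mul, add_mul]
  exact (enorm_add_le _ _).trans (add_le_add
    (enorm_integral_inner_halfFlow_le (Or.inl rfl) hσ haσ hC f hG)
    (enorm_integral_inner_halfFlow_le (Or.inr rfl) hσ haσ hC f hG))

end Bound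

/-! ### Convergence of the truncated flow -/

theorem truncatedFlow_eq_fourierInv (n : ℝ) (f : SpinorL2) (t : ℝ) (x : Space) :
    truncatedFlow n f t x = 𝓕⁻ ((Metric.closedBall (0 : Space) n).indicator
      fun ξ => diracPropagator t ξ ((𝓕 f : SpinorL2) ξ)) x := by
  have hint : ∀ s : ℝ, |s| = 1 → IntegrableOn (fun ξ : Space =>
      (Complex.exp (Complex.I * ((2 * Real.pi * inner ℝ x ξ : ℝ) : ℂ)) *
      Complex.exp (Complex.I * ((-(s * t) * japanese (2 * Real.pi * ‖ξ‖) : ℝ) : ℂ))) •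
        diracProjection s ξ ((𝓕 f : SpinorL2) ξ)) (Metric.closedBall 0 n) := by
    intro s hs
    refine Integrable.mono (integrableOn_closedBall_fourier n (𝓕 f : SpinorL2)) ?_ (ae_of_all _ fun ξ => ?_)
    · have : Continuous fun ξ : Space => Complex.exp (Complex.I * ((2 * Real.pi * inner ℝ x ξ : ℝ) : ℂ)) *
          Complex.exp (Complex.I * ((-(s * t) * japanese (2 * Real.pi * ‖ξ‖) : ℝ) : ℂ)) :=
        (continuous_phase s).comp (f := fun ξ : Space => ((t, x), ξ)) (by fun_prop)
      exact (this.stronglyMeasurable.smul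
        (stronglyMeasurable_diracProjection s _)).aestronglyMeasurable
    · rw [norm_smul, norm_mul, norm_exp_I_mul_ofReal, norm_exp_I_mul_ofReal, one_mul, one_mul]
      simpa using (diracProjection s ξ).le_of_opNorm_le (norm_diracProjection_le hs ξ) _
  rw [truncatedFlow, halfFlow, halfFlow, ← integral_add (hint 1 (by simp)) (hint (-1) (by simp)),
    Real.fourierInv_eq', ← integral_indicator Metric.isClosed_closedBall.measurableSet]
  refine integral_congr_ae (ae_of_all _ fun ξ => ?_)
  by_cases hξ : ξ ∈ Metric.closedBall (0 : Space) n
  · simp only [Set.indicator_of_mem hξ]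
    rw [diracPropagator_eq, add_apply, smul_apply, smul_apply, smul_add,
      smul_smul, smul_smul, real_inner_comm ξ x, one_mul, neg_one_mul, neg_neg, mul_comm Complex.I]
  · simp only [Set.indicator_of_notMem hξ, smul_zero]

theorem tendsto_toLp_indicator_closedBall {h : Space → Spinor} (hh : MemLp h 2 volume) :
    Filter.Tendsto (fun n : ℕ => (hh.indicator (s := Metric.closedBall (0 : Space) n)
      Metric.isClosed_closedBall.measurableSet).toLp _) Filter.atTop (nhds (hh.toLp h)) := by
  rw [Lp.tendsto_Lp_iff_tendsto_eLpNorm'']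
  have hev : ∀ ξ : Space, ∀ᶠ n : ℕ in Filter.atTop, ξ ∈ Metric.closedBall (0 : Space) n := fun ξ => by
    filter_upwards [Filter.eventually_ge_atTop ⌈‖ξ‖⌉₊] with n hn
    simpa using Nat.ceil_le.1 hn
  have hsub : ∀ (n : ℕ) ξ, ‖((Metric.closedBall (0 : Space) n).indicator h - h) ξ‖ₑ ≤ ‖h ξ‖ₑ := by
    intro n ξ
    by_cases hξ : ξ ∈ Metric.closedBall (0 : Space) n
    · simp only [Pi.sub_apply, Set.indicator_of_mem hξ, sub_self, enorm_zero, zero_le]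
    · simp only [Pi.sub_apply, Set.indicator_of_notMem hξ, zero_sub, enorm_neg, le_refl]
  have hfin : ∫⁻ ξ, ‖h ξ‖ₑ ^ (2 : ℝ) ≠ ⊤ := by
    simpa using (lintegral_rpow_enorm_lt_top_of_eLpNorm_lt_top two_ne_zero ENNReal.ofNat_ne_top
      hh.2).ne
  have hlim := tendsto_lintegral_of_dominated_convergence' (μ := (volume : Measure Space))
    (F := fun (n : ℕ) ξ => ‖((Metric.closedBall (0 : Space) n).indicator h - h) ξ‖ₑ ^ (2 : ℝ))
    (f := fun _ => 0) (fun ξ => ‖h ξ‖ₑ ^ (2 : ℝ))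
    (fun n => (((hh.1.indicator Metric.isClosed_closedBall.measurableSet).sub
      hh.1).enorm.pow_const _))
    (fun n => ae_of_all _ fun ξ => ENNReal.rpow_le_rpow (hsub n ξ) (by norm_num)) hfin
    (ae_of_all _ fun ξ => by
      refine tendsto_const_nhds.congr' ?_
      filter_upwards [hev ξ] with n hn
      simp [Set.indicator_of_mem hn])
  rw [lintegral_zero] at hlim
  have h2 := hlim.ennrpow_const (1 / 2)
  rw [ENNReal.zero_rpow_of_pos (by norm_num)] at h2
  refine h2.congr fun n => ?_
  rw [eLpNorm_eq_lintegral_rpow_enorm_toReal two_ne_zero ENNReal.ofNat_ne_top]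
  simp

theorem exists_tendsto_truncatedFlow (f : SpinorL2) (t : ℝ) :
    ∃ F : ℕ → SpinorL2, Filter.Tendsto F Filter.atTop (nhds (diracFlow t f)) ∧
      ∀ n : ℕ, (F n : Space → Spinor) =ᵐ[volume] truncatedFlow n f t := by
  have hh := memLp_diracPropagator t (𝓕 f)
  refine ⟨fun n => 𝓕⁻ ((hh.indicator (s := Metric.closedBall (0 : Space) n)
      Metric.isClosed_closedBall.measurableSet).toLp _),
    (ContinuousFourierInv.continuous_fourierInv.tendsto _).comp
      (tendsto_toLp_indicator_closedBall hh), fun n => ?_⟩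
  set k := (hh.indicator (s := Metric.closedBall (0 : Space) n)
      Metric.isClosed_closedBall.measurableSet).toLp _ with hk
  have hkae : (k : Space → Spinor) =ᵐ[volume] (Metric.closedBall (0 : Space) n).indicator
      fun ξ => diracPropagator t ξ ((𝓕 f : SpinorL2) ξ) := MemLp.coeFn_toLp _
  have hint : Integrable (k : Space → Spinor) := by
    refine (integrable_congr hkae).2 ?_
    rw [integrable_indicator_iff Metric.isClosed_closedBall.measurableSet]
    exact (hh.locallyIntegrable (by norm_num)).integrableOn_isCompact (isCompact_closedBall 0 _)
  filter_upwards [fourierInv_ae_eq k hint] with x hx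
  rw [hx, truncatedFlow_eq_fourierInv]
  exact Real.fourierInv_congr_ae hkae x

/-- A pointwise majorant of `t ↦ ‖e^(-it(𝒟+β)) f‖_{W(rt,r)}`, measurable in `t`. -/
def flowMajorant (rt r : ℝ) (ψ : Space → ℝ≥0∞) (f : SpinorL2) (t : ℝ) : ℝ≥0∞ :=
  Filter.liminf (fun n : ℕ => mixedNorm rt r ψ (fun x => ‖truncatedFlow n f t x‖ₑ)) Filter.atTop

section Majorant

variable {qt q rt r : ℝ} {φ : ℝ → ℝ≥0∞} {ψ : Space → ℝ≥0∞}

theorem measurable_mixedNorm_truncatedFlow (hψ : Measurable ψ) (n : ℝ) (f : SpinorL2) :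
    Measurable fun t => mixedNorm rt r ψ (fun x => ‖truncatedFlow n f t x‖ₑ) :=
  measurable_mixedNorm hψ (stronglyMeasurable_truncatedFlow n f).enorm

theorem measurable_flowMajorant (hψ : Measurable ψ) (f : SpinorL2) :
    Measurable (flowMajorant rt r ψ f) :=
  .liminf fun n => measurable_mixedNorm_truncatedFlow hψ n f

/-- Only a subsequence of the truncated flows converges almost everywhere, but it may be chosen
inside one along which the norms tend to their lower limit. -/
theorem mixedNorm_diracFlow_le (hrt : 0 < rt) (hr : 0 < r) (hψ : Measurable ψ)
    (hψ' : ∀ y, ψ y ≠ ⊤) (f : SpinorL2) (t : ℝ) :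
    mixedNorm rt r ψ (fun x => ‖diracFlow t f x‖ₑ) ≤ flowMajorant rt r ψ f t := by
  obtain ⟨F, hF, hFae⟩ := exists_tendsto_truncatedFlow f t
  by_contra! hlt
  obtain ⟨c, hc1, hc2⟩ := exists_between hlt
  have hfr : ∃ᶠ n : ℕ in Filter.atTop,
      mixedNorm rt r ψ (fun x => ‖truncatedFlow n f t x‖ₑ) < c :=
    Filter.frequently_lt_of_liminf_lt (by isBoundedDefault) hc1
  obtain ⟨k, hk, hkc⟩ := Filter.extraction_of_frequently_atTop hfr
  obtain ⟨l, hl, hlim⟩ := (tendstoInMeasure_of_tendsto_Lp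
    (hF.comp hk.tendsto_atTop)).exists_seq_tendsto_ae
  refine hc2.not_ge ((mixedNorm_le_liminf hrt hr hψ hψ'
    (w := fun i x => ‖truncatedFlow (k (l i)) f t x‖ₑ) (fun i => ?_) ?_).trans ?_)
  · exact ((stronglyMeasurable_truncatedFlow _ f).comp_measurable measurable_prodMk_left).enorm
  · filter_upwards [hlim, ae_all_iff.2 hFae] with x hx hx'
    refine (Filter.Tendsto.liminf_eq ?_).ge
    have := hx.enorm
    refine this.congr fun i => ?_
    simp [hx']
  · exact Filter.liminf_le_of_le (by isBoundedDefault) fun y hy =>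
      let ⟨i, hi⟩ := hy.exists; hi.trans (hkc _).le

end Majorant

/-! ### The estimate for finite and infinite local time exponents -/

/-- The parameter `c` is `2 / qt`, and `c = 0` stands for `qt = ∞`; then the constant serves all
finite exponents in place of `qt`. -/
theorem exists_mixedNorm_flowMajorant_le {σ q r rt c ρ : ℝ} {φ : ℝ → ℝ≥0∞} {ψ : Space → ℝ≥0∞}
    {M : ℝ≥0∞} (hσ : 1 < σ) (hq : 2 < q) (hr : 6 < r) (hrt : r ≤ rt) (hc : 0 ≤ c)
    (hσc : 3 / 2 - σ < c / 2 + 3 / rt) (hqr : 1 / q + 3 / r = 1 / 2) (hρ : 0 ≤ ρ)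
    (hφ : Measurable φ) (hψ : Measurable ψ) (hM : M ≠ ⊤) (hφM : ∀ t, φ t ≤ M)
    (hψM : ∀ x, ψ x ≤ M) (hφρ : ∀ t, ρ < ‖t‖ → φ t = 0) (hψρ : ∀ x, ρ < ‖x‖ → ψ x = 0) :
    ∃ K : ℝ≥0, ∀ qt, 2 ≤ qt → (0 < c → qt = 2 / c) → ∀ f : SpinorL2,
      mixedNorm qt q φ (flowMajorant rt r ψ f) ≤ K * sobolevNorm σ f := by
  have hrt0 : 0 < rt := by linarith
  -- the kernel estimates need a regularity between `1` and `3 / 2`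
  obtain ⟨τ, hτ1, hτ2, hτσ, hτc⟩ : ∃ τ, 1 < τ ∧ τ < 3 / 2 ∧ τ ≤ σ ∧ 3 / 2 - τ < c / 2 + 3 / rt := by
    rcases lt_or_ge σ (3 / 2) with h | h
    · exact ⟨σ, hσ, h, le_rfl, hσc⟩
    · have h1 : 0 < 3 / rt := by positivity
      have h2 : 0 < min (1 / 4) (3 / rt / 2) := by positivity
      have h3 := min_le_left (1 / 4) (3 / rt / 2)
      have h4 := min_le_right (1 / 4) (3 / rt / 2)
      exact ⟨3 / 2 - min (1 / 4) (3 / rt / 2), by linarith, by linarith, by linarith, by linarith⟩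
  have h6 : 6 / rt = 2 * (3 / rt) := by ring
  obtain ⟨α, β, γ, δ, hα0, hα, hβ0, hβc0, hβc, hγ, hδ, C, hC⟩ :=
    exists_kleinGordonKernel_le_powerWeight (a := 3 - 2 * τ) (c := c) (by linarith) (by linarith) hc
      hr hrt hqr (by linarith)
  have hγ0 : 0 ≤ γ := le_trans (by positivity) hγ.le
  have hδ0 : 0 ≤ δ := le_trans (by positivity) hδ.le
  have hδq : 1 < δ * (q / 2) := by
    rw [div_lt_iff₀ (by linarith)] at hδ; linarith
  obtain ⟨bx, CB, hCB, hB⟩ := exists_isAmalgamKernel_powerWeight (E := Space) (α := α) (γ := γ)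
    (p := rt) (q := r) (by simp) hγ0 (by linarith) (by linarith)
    (by rw [lt_div_iff₀ hrt0] at hα; simp; linarith)
    (by rw [div_lt_iff₀ (by linarith)] at hγ; simp; linarith) hρ hM hψM hψρ
  obtain ⟨bt, CA, hCA, hA⟩ : ∃ bt CA, CA ≠ ⊤ ∧ ∀ qt, 2 ≤ qt → (0 < c → qt = 2 / c) →
      IsAmalgamKernel qt q φ (powerWeight β δ) bt CA := by
    rcases hc.eq_or_lt with h0 | h0
    · obtain ⟨b, CA, hCA, h⟩ := exists_forall_isAmalgamKernel_powerWeight (E := ℝ) (γ := δ)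
        (q := q) hδ0 hq.le (by simpa using hδq) hρ hM hφM hφρ
      rw [hβc0 h0.symm]
      exact ⟨b, CA, hCA, fun qt hqt _ => h qt hqt⟩
    · rcases le_or_gt 2 (2 / c) with h2 | h2
      · obtain ⟨b, CA, hCA, h⟩ := exists_isAmalgamKernel_powerWeight (E := ℝ) (α := β) (γ := δ)
          (p := 2 / c) (q := q) (by simp) hδ0 h2 hq.le
          (by
            have := hβc h0
            rw [div_div_cancel_left' two_ne_zero, ← div_eq_mul_inv, Module.finrank_self, Nat.cast_one,
              div_lt_one h0]
            exact this)
          (by simpa using hδq) hρ hM hφM hφρ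
        exact ⟨b, CA, hCA, fun qt _ hqt => by rw [hqt h0]; exact h⟩
      · exact ⟨0, 0, by simp, fun qt hqt h => by rw [h h0] at hqt; linarith⟩
  have hK : 2 * (C : ℝ≥0∞) ^ (1 / 2 : ℝ) * (CA * CB) ^ (1 / 2 : ℝ) ≠ ⊤ :=
    ENNReal.mul_ne_top (ENNReal.mul_ne_top ENNReal.ofNat_ne_top
      (ENNReal.rpow_ne_top_of_nonneg (by norm_num) ENNReal.coe_ne_top))
      (ENNReal.rpow_ne_top_of_nonneg (by norm_num) (ENNReal.mul_ne_top hCA hCB))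
  refine ⟨(2 * (C : ℝ≥0∞) ^ (1 / 2 : ℝ) * (CA * CB) ^ (1 / 2 : ℝ)).toNNReal,
    fun qt hqt hqtc f => ?_⟩
  rw [ENNReal.coe_toNNReal hK]
  refine (mixedNorm_le_liminf (by linarith) (by linarith) hφ
    (fun t => ((hφM t).trans_lt hM.lt_top).ne)
    (fun n : ℕ => measurable_mixedNorm_truncatedFlow hψ n f) (ae_of_all _ fun t => le_rfl)).trans ?_
  refine Filter.liminf_le_of_le (by isBoundedDefault) fun y hy => ?_
  obtain ⟨n, hn⟩ := hy.exists
  calc y ≤ _ := hn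
    _ ≤ _ := mixedNorm_truncatedFlow_le (σ := τ) hqt hq.le (by linarith) (by linarith) hφ hψ hM hφM
        hψM hφρ hψρ hβ0 hδ0 hα0.le hγ0 (hA qt hqt hqtc) hCA hB hCB (by linarith) (by ring)
        (fun t x => hC n t x n.cast_nonneg) f
    _ = 2 * (C : ℝ≥0∞) ^ (1 / 2 : ℝ) * (CA * CB) ^ (1 / 2 : ℝ) * sobolevNorm τ f := by ring
    _ ≤ _ := by gcongr; exact sobolevNorm_mono hτσ f

/-- No integrability is assumed, so that the right-hand side may be infinite. -/
theorem essSup_le_liminf_lintegral_rpow {α : Type*} [MeasurableSpace α] {μ : Measure α}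
    {g : α → ℝ≥0∞} (hg : Measurable g) :
    essSup g μ ≤ Filter.liminf (fun k : ℕ => (∫⁻ y, g y ^ ((k : ℝ) + 2) ∂μ) ^ (1 / ((k : ℝ) + 2)))
      Filter.atTop := by
  refine le_of_forall_lt_imp_le_of_dense fun c hc => ?_
  set A := {y | c < g y} with hA
  have hAm : MeasurableSet A := measurableSet_lt measurable_const hg
  have hA0 : μ A ≠ 0 := fun h => hc.not_ge (essSup_le_of_ae_le c (by
    filter_upwards [measure_eq_zero_iff_ae_notMem.1 h] with y hy
    exact not_lt.1 hy))
  set ε := min 1 (μ A) with hε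
  have hεtop : ε ≠ ⊤ := ((min_le_left _ _).trans_lt ENNReal.one_lt_top).ne
  have hε0 : 0 < ε := lt_min one_pos (pos_iff_ne_zero.2 hA0)
  have hle : ∀ k : ℕ, c * ε ^ (1 / ((k : ℝ) + 2)) ≤
      (∫⁻ y, g y ^ ((k : ℝ) + 2) ∂μ) ^ (1 / ((k : ℝ) + 2)) := fun k => by
    have hk : 0 < (k : ℝ) + 2 := by positivity
    calc c * ε ^ (1 / ((k : ℝ) + 2)) ≤ c * (μ A) ^ (1 / ((k : ℝ) + 2)) := by
          gcongr; exact min_le_right _ _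
      _ = (c ^ ((k : ℝ) + 2) * μ A) ^ (1 / ((k : ℝ) + 2)) := by
          rw [ENNReal.mul_rpow_of_nonneg _ _ (by positivity), ← ENNReal.rpow_mul,
            mul_one_div_cancel hk.ne', ENNReal.rpow_one]
      _ ≤ _ := by
          gcongr
          rw [← setLIntegral_const]
          refine (setLIntegral_mono' hAm fun y hy => ?_).trans (setLIntegral_le_lintegral A _)
          exact ENNReal.rpow_le_rpow (le_of_lt hy) hk.le
  have hlim : Filter.Tendsto (fun k : ℕ => c * ε ^ (1 / ((k : ℝ) + 2))) Filter.atTop (nhds c) := by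
    have h1 : Filter.Tendsto (fun k : ℕ => 1 / ((k : ℝ) + 2)) Filter.atTop (nhds 0) :=
      tendsto_const_nhds.div_atTop
        (Filter.tendsto_atTop_add_const_right _ _ tendsto_natCast_atTop_atTop)
    have hr0 : 0 < ε.toReal := ENNReal.toReal_pos hε0.ne' hεtop
    have h2 : Filter.Tendsto (fun k : ℕ => ENNReal.ofReal (ε.toReal ^ (1 / ((k : ℝ) + 2))))
        Filter.atTop (nhds (ENNReal.ofReal (ε.toReal ^ (0 : ℝ)))) :=
      ENNReal.tendsto_ofReal ((Real.continuousAt_const_rpow hr0.ne').tendsto.comp h1)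
    rw [Real.rpow_zero, ENNReal.ofReal_one] at h2
    have h3 := ENNReal.Tendsto.const_mul (a := c) h2 (Or.inl one_ne_zero)
    rw [mul_one] at h3
    refine h3.congr fun k => ?_
    rw [← ENNReal.ofReal_rpow_of_pos hr0, ENNReal.ofReal_toReal hεtop]
  rw [← hlim.liminf_eq]
  exact Filter.liminf_le_liminf (Filter.Eventually.of_forall hle)

theorem eLpNorm_ofReal_exponent {α ε : Type*} [MeasurableSpace α] {μ : Measure α} [ENorm ε] {p : ℝ}
    (hp : 0 < p) (f : α → ε) :
    eLpNorm f (ENNReal.ofReal p) μ = (∫⁻ x, ‖f x‖ₑ ^ p ∂μ) ^ (1 / p) := by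
  rw [eLpNorm_eq_lintegral_rpow_enorm_toReal (by simpa using hp) ENNReal.ofReal_ne_top,
    ENNReal.toReal_ofReal hp.le]

theorem amalgamNorm_ofReal {E F : Type*} [NormedAddCommGroup E] [MeasureSpace E] [ENorm F] {p q : ℝ}
    (hp : 0 < p) (hq : 0 < q) (φ : E → ℂ) (f : E → F) :
    amalgamNorm (ENNReal.ofReal p) (ENNReal.ofReal q) φ f =
      mixedNorm p q (fun y => ‖φ y‖ₑ) (fun y => ‖f y‖ₑ) := by
  simp only [amalgamNorm, eLpNorm_ofReal_exponent hp, eLpNorm_ofReal_exponent hq, mixedNorm, localNorm, enorm_eq_self]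

theorem amalgamNorm_mono {E F G : Type*} [NormedAddCommGroup E] [MeasureSpace E] [ENorm F] [ENorm G]
    {p q : ℝ≥0∞} {φ : E → ℂ} {f : E → F} {g : E → G} (h : ∀ x, ‖f x‖ₑ ≤ ‖g x‖ₑ) :
    amalgamNorm p q φ f ≤ amalgamNorm p q φ g := by
  refine eLpNorm_mono_enorm fun x => ?_
  rw [enorm_eq_self, enorm_eq_self]
  refine eLpNorm_mono_enorm fun y => ?_
  rw [enorm_eq_self, enorm_eq_self]
  gcongr
  exact h y

theorem amalgamNorm_top_le {E : Type*} [NormedAddCommGroup E] [MeasureSpace E] [BorelSpace E]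
    [SecondCountableTopology E] [SFinite (volume : Measure E)] {q : ℝ} (hq : 0 < q) {φ : E → ℂ}
    (hφ : Continuous φ) {W : E → ℝ≥0∞} (hW : Measurable W) {B : ℝ≥0∞}
    (h : ∀ p, 2 ≤ p → mixedNorm p q (fun y => ‖φ y‖ₑ) W ≤ B) :
    amalgamNorm ⊤ (ENNReal.ofReal q) φ W ≤ B := by
  have hφm : Measurable fun y => ‖φ y‖ₑ := hφ.measurable.enorm
  simp only [amalgamNorm, eLpNorm_ofReal_exponent hq, eLpNorm_exponent_top, eLpNormEssSup_eq_essSup_enorm,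
    enorm_eq_self]
  refine (lintegral_rpow_le_liminf hq
    (w := fun (k : ℕ) x => localNorm ((k : ℝ) + 2) (fun y => ‖φ y‖ₑ) W x) (fun k => ?_)
    (ae_of_all _ fun x => essSup_le_liminf_lintegral_rpow
      (hW.mul (hφm.comp (measurable_id.sub_const x))))).trans ?_
  · exact ((measurable_localNorm (T := Unit) (v := fun _ => W) hφm (by fun_prop)).comp
      (f := fun x => ((), x)) (by fun_prop)).aemeasurable
  · refine Filter.liminf_le_of_le (by isBoundedDefault) fun y hy => ?_
    obtain ⟨k, hk⟩ := hy.exists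
    exact hk.trans (h _ (by linarith [k.cast_nonneg (α := ℝ)]))

/-! ### Amalgam norms with equal exponents -/

theorem mixedNorm_self {E : Type*} [NormedAddCommGroup E] [MeasureSpace E] [BorelSpace E]
    [SecondCountableTopology E] [SFinite (volume : Measure E)]
    [(volume : Measure E).IsAddLeftInvariant] [(volume : Measure E).IsNegInvariant] {p : ℝ}
    (hp : 0 < p) {ψ v : E → ℝ≥0∞} (hψ : Measurable ψ) (hv : Measurable v) :
    mixedNorm p p ψ v = (∫⁻ y, v y ^ p) ^ (1 / p) * (∫⁻ y, ψ y ^ p) ^ (1 / p) := by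
  rw [mixedNorm, ← ENNReal.mul_rpow_of_nonneg _ _ (by positivity)]
  simp_rw [localNorm_rpow hp]
  congr 1
  rw [lintegral_lintegral_swap (by fun_prop), ← lintegral_mul_const _ (by fun_prop)]
  refine lintegral_congr fun y => ?_
  simp_rw [ENNReal.mul_rpow_of_nonneg _ _ hp.le]
  rw [lintegral_const_mul _ (by fun_prop), lintegral_sub_left_eq_self (fun z => ψ z ^ p) y]

theorem IsWindow.exists_bound {E : Type*} [NormedAddCommGroup E] [NormedSpace ℝ E] [MeasureSpace E]
    {φ : E → ℂ} (hφ : IsWindow φ) :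
    ∃ (ρ : ℝ) (M : ℝ≥0), 0 ≤ ρ ∧ (∀ y, ‖φ y‖ₑ ≤ M) ∧ ∀ y, ρ < ‖y‖ → ‖φ y‖ₑ = 0 := by
  obtain ⟨c, hc⟩ := hφ.contDiff.continuous.bounded_above_of_compact_support hφ.hasCompactSupport
  obtain ⟨ρ, hρ⟩ := hφ.hasCompactSupport.isCompact.isBounded.subset_closedBall 0
  refine ⟨max ρ 0, c.toNNReal, le_max_right _ _, fun y => ?_, fun y hy => ?_⟩
  · rw [← ofReal_norm]; exact ENNReal.ofReal_le_ofReal (hc y)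
  · rw [enorm_eq_zero]
    by_contra h
    have := hρ (subset_tsupport φ h)
    rw [mem_closedBall_zero_iff] at this
    exact absurd hy (not_lt.2 (this.trans (le_max_left _ _)))

theorem exists_amalgamNorm_diracFlow_le {σ q r rt : ℝ} {qt : ℝ≥0∞} (hσ : 1 < σ) (hqt : 2 ≤ qt)
    (hq : 2 < q) (hr : 6 < r) (hrt : r ≤ rt) (hσq : 3 / 2 - σ < (qt⁻¹).toReal + 3 / rt)
    (hqr : 1 / q + 3 / r = 1 / 2) {φ : ℝ → ℂ} {ψ : Space → ℂ} (hφ : IsWindow φ) (hψ : IsWindow ψ) :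
    ∃ C : ℝ≥0, ∀ f : SpinorL2, amalgamNorm qt (ENNReal.ofReal q) φ (fun t : ℝ =>
      amalgamNorm (ENNReal.ofReal rt) (ENNReal.ofReal r) ψ (diracFlow t f)) ≤
        C * sobolevNorm σ f := by
  obtain ⟨ρ₁, M₁, hρ₁, hM₁, hφρ⟩ := hφ.exists_bound
  obtain ⟨ρ₂, M₂, hρ₂, hM₂, hψρ⟩ := hψ.exists_bound
  have hφm : Measurable fun t => ‖φ t‖ₑ := hφ.contDiff.continuous.measurable.enorm
  have hψm : Measurable fun x => ‖ψ x‖ₑ := hψ.contDiff.continuous.measurable.enorm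
  obtain ⟨K, hK⟩ := exists_mixedNorm_flowMajorant_le (c := 2 * (qt⁻¹).toReal) (M := max M₁ M₂)
    (ρ := max ρ₁ ρ₂) hσ hq hr hrt (by positivity) (by linarith) hqr (hρ₁.trans (le_max_left _ _))
    hφm hψm (by simp) (fun t => (hM₁ t).trans (le_max_left _ _))
    (fun x => (hM₂ x).trans (le_max_right _ _)) (fun t ht => hφρ t ((le_max_left _ _).trans_lt ht))
    (fun x hx => hψρ x ((le_max_right _ _).trans_lt hx))
  refine ⟨K, fun f => ?_⟩
  set W := flowMajorant rt r (fun x => ‖ψ x‖ₑ) f with hWdef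
  have hW : Measurable W := measurable_flowMajorant hψm f
  refine (amalgamNorm_mono (g := W) fun t => ?_).trans ?_
  · rw [enorm_eq_self, enorm_eq_self, amalgamNorm_ofReal (by linarith) (by linarith)]
    exact mixedNorm_diracFlow_le (by linarith) (by linarith) hψm (fun y => enorm_ne_top) f t
  · rcases eq_or_ne qt ⊤ with rfl | htop
    · exact amalgamNorm_top_le (by linarith) hφ.contDiff.continuous hW fun p hp =>
        hK p hp (by simp) f
    · have h2 : 2 ≤ qt.toReal := by
        simpa using ENNReal.toReal_mono htop hqt
      rw [← ENNReal.ofReal_toReal htop, amalgamNorm_ofReal (by linarith) (by linarith)]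
      refine hK qt.toReal h2 (fun _ => ?_) f
      rw [ENNReal.toReal_inv]
      field_simp

theorem exists_eLpNorm_diracFlow_le {σ q r : ℝ} (hσ : 1 < σ) (hq : 2 < q) (hr : 6 < r)
    (hqr : 1 / q + 3 / r = 1 / 2) :
    ∃ C : ℝ≥0, ∀ f : SpinorL2,
      eLpNorm (fun t : ℝ => eLpNorm (diracFlow t f) (ENNReal.ofReal r) volume)
        (ENNReal.ofReal q) volume ≤ C * sobolevNorm σ f := by
  have hq0 : 0 < q := by linarith
  have hr0 : 0 < r := by linarith
  -- sharp cut-offs serve as windows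
  set φ : ℝ → ℝ≥0∞ := (Metric.closedBall 0 1).indicator 1 with hφ
  set ψ : Space → ℝ≥0∞ := (Metric.closedBall 0 1).indicator 1 with hψ
  have hφm : Measurable φ := measurable_one.indicator Metric.isClosed_closedBall.measurableSet
  have hψm : Measurable ψ := measurable_one.indicator Metric.isClosed_closedBall.measurableSet
  have hψ1 : ∀ x, ψ x ≤ 1 := fun x => Set.indicator_le_self' (fun _ _ => zero_le) x
  obtain ⟨K, hK⟩ := exists_mixedNorm_flowMajorant_le (c := 2 / q) (M := 1) (ρ := 1) hσ hq hr le_rfl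
    (by positivity) (by have : 2 / q / 2 = 1 / q := by ring
                        linarith) hqr zero_le_one hφm hψm (by simp)
    (fun t => Set.indicator_le_self' (fun _ _ => zero_le) t) hψ1
    (fun t ht => Set.indicator_of_notMem (by simpa using ht) _)
    (fun x hx => Set.indicator_of_notMem (by simpa using hx) _)
  set V₁ := (∫⁻ t, φ t ^ q) ^ (1 / q) with hV₁
  set V₂ := (∫⁻ x, ψ x ^ r) ^ (1 / r) with hV₂
  have key : ∀ {E : Type} [NormedAddCommGroup E] [NormedSpace ℝ E] [FiniteDimensional ℝ E]
      [MeasureSpace E] [BorelSpace E] [(volume : Measure E).IsAddHaarMeasure] {p : ℝ}, 0 < p →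
      (∫⁻ x : E, ((Metric.closedBall (0 : E) 1).indicator (1 : E → ℝ≥0∞) x) ^ p) ^ (1 / p) ≠ 0 ∧
      (∫⁻ x : E, ((Metric.closedBall (0 : E) 1).indicator (1 : E → ℝ≥0∞) x) ^ p) ^ (1 / p) ≠ ⊤ := by
    intro E _ _ _ _ _ _ p hp
    have : (∫⁻ x : E, ((Metric.closedBall (0 : E) 1).indicator (1 : E → ℝ≥0∞) x) ^ p) =
        volume (Metric.closedBall (0 : E) 1) := by
      rw [← lintegral_indicator_one Metric.isClosed_closedBall.measurableSet]
      refine lintegral_congr fun x => ?_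
      by_cases hx : x ∈ Metric.closedBall (0 : E) 1
      · simp [Set.indicator_of_mem hx]
      · simp [Set.indicator_of_notMem hx, hp]
    rw [this]
    have h0 := Metric.measure_closedBall_pos (volume : Measure E) (0 : E) one_pos
    have h1 := (measure_closedBall_lt_top (μ := (volume : Measure E)) (x := (0 : E)) (r := 1)).ne
    exact ⟨(ENNReal.rpow_pos h0 h1).ne', ENNReal.rpow_ne_top_of_nonneg (by positivity) h1⟩
  obtain ⟨h10, h1t⟩ : V₁ ≠ 0 ∧ V₁ ≠ ⊤ := key hq0
  obtain ⟨h20, h2t⟩ : V₂ ≠ 0 ∧ V₂ ≠ ⊤ := key hr0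
  refine ⟨(V₂⁻¹ * V₁⁻¹ * K).toNNReal, fun f => ?_⟩
  rw [ENNReal.coe_toNNReal (by finiteness)]
  set W := flowMajorant r r ψ f with hWdef
  have hW : Measurable W := measurable_flowMajorant hψm f
  have hN : ∀ t, eLpNorm (diracFlow t f) (ENNReal.ofReal r) volume ≤ V₂⁻¹ * W t := fun t => by
    rw [eLpNorm_ofReal_exponent hr0, mul_comm, ← div_eq_mul_inv,
      ENNReal.le_div_iff_mul_le (Or.inl h20) (Or.inl h2t), hV₂,
      ← mixedNorm_self hr0 hψm (Lp.stronglyMeasurable _).enorm]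
    exact mixedNorm_diracFlow_le hr0 hr0 hψm (fun y => ((hψ1 y).trans_lt ENNReal.one_lt_top).ne) f t
  have hm := hK q hq.le (fun _ => by field_simp) f
  rw [mixedNorm_self hq0 hφm hW, ← hV₁, ← ENNReal.le_div_iff_mul_le (Or.inl h10) (Or.inl h1t)] at hm
  calc _ ≤ (∫⁻ t, (V₂⁻¹ * W t) ^ q) ^ (1 / q) := by
        rw [eLpNorm_ofReal_exponent hq0]
        simp only [enorm_eq_self]
        gcongr with t
        exact hN t
    _ = V₂⁻¹ * (∫⁻ t, W t ^ q) ^ (1 / q) := by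
        simp_rw [ENNReal.mul_rpow_of_nonneg _ _ hq0.le]
        rw [lintegral_const_mul _ (by fun_prop), ENNReal.mul_rpow_of_nonneg _ _ (by positivity),
          ← ENNReal.rpow_mul, mul_one_div_cancel hq0.ne', ENNReal.rpow_one]
    _ ≤ V₂⁻¹ * (K * sobolevNorm σ f / V₁) := by gcongr
    _ = _ := by rw [div_eq_mul_inv]; ring

end

theorem theorem1 :
    -- the estimate in Wiener amalgam spaces
    (∀ (σ q r rt : ℝ) (qt : ℝ≥0∞),
      1 < σ → 2 ≤ qt → 2 < q → 6 < r → r ≤ rt →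
      3 / 2 - σ < (qt⁻¹).toReal + 3 / rt → 1 / q + 3 / r = 1 / 2 →
      ∀ (φ : ℝ → ℂ) (ψ : Space → ℂ), IsWindow φ → IsWindow ψ →
      ∃ C : ℝ≥0, ∀ f : SpinorL2, TemperedDistribution.MemSobolev σ 2 (f : 𝓢'(Space, Spinor)) →
        amalgamNorm qt (ENNReal.ofReal q) φ
            (fun t : ℝ => amalgamNorm (ENNReal.ofReal rt) (ENNReal.ofReal r) ψ (diracFlow t f))
          ≤ C * sobolevNorm σ f) ∧
    -- the resulting classical Strichartz estimate
    (∀ (σ q r : ℝ), 1 < σ → 2 < q → 6 < r → 1 / q + 3 / r = 1 / 2 →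
      ∃ C : ℝ≥0, ∀ f : SpinorL2, TemperedDistribution.MemSobolev σ 2 (f : 𝓢'(Space, Spinor)) →
        eLpNorm (fun t : ℝ => eLpNorm (diracFlow t f) (ENNReal.ofReal r) volume)
            (ENNReal.ofReal q) volume
          ≤ C * sobolevNorm σ f) := by
  refine ⟨fun σ q r rt qt hσ hqt hq hr hrt hσq hqr φ ψ hφ hψ => ?_, fun σ q r hσ hq hr hqr => ?_⟩
  · obtain ⟨C, hC⟩ := exists_amalgamNorm_diracFlow_le hσ hqt hq hr hrt hσq hqr hφ hψ
    exact ⟨C, fun f _ => hC f⟩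
  · obtain ⟨C, hC⟩ := exists_eLpNorm_diracFlow_le hσ hq hr hqr
    exact ⟨C, fun f _ => hC f⟩
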